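/- **Setting.** Let $X$ be a connected, Hausdorff, second countable smooth 4-manifold with an oriented atlas, $\eta=\mathrm{diag}(1,-1,-1,-1)$, $L$ the proper orthochronous Lorentz group, $LX\to X$ the $GL^+(4,\mathbb R)$-principal bundle of oriented linear frames and $\Sigma=LX/L\to X$. A tetrad field is a smooth global section $h$ of $\Sigma\to X$; it defines the Lorentz metric $g_h$ for which the frames in the class $h(x)$ are pseudo-orthonormal. Let $V$ be a minimal left ideal of the complex Clifford algebra of Minkowski space, with relations $ee'+e'e=2\eta(e,e')$, let $\gamma^a$ be the left multiplication by the basis vector $e^a$, $\gamma_a=\eta_{ab}\gamma^b$ and $I_{ab}=\frac14[\gamma_a,\gamma_b]$. Let $P_\Sigma\to\Sigma$ be a lift of the $L$-principal bundle $LX\to\Sigma$ to the group $L_s=\mathrm{Spin}^+(1,3)=SL(2,\mathbb C)$, with an atlas of local sections over open sets $U_i$ covering $\Sigma$, let $z_i:U_i\to LX$ be the underlying smooth local sections, and let $S_\Sigma=(P_\Sigma\times V)/L_s$, so that $S\to\Sigma\to X$ is the composite spinor bundle, where $S$ is the total space of $S_\Sigma$. Let $y=(y^A)$ be the fibre coordinates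 of $S\to\Sigma$ over $U_i$, $x^\lambda$ the coordinates of a chart of $X$, $\sigma^\mu_a$ the components of $z_i(\sigma)$ in that chart and $(\sigma^a_\mu)$ the inverse matrix. Let $S_h=h^*S_\Sigma$, and let $i_h:S_h\to S$ be the natural map. $VS_\Sigma$ and $VS_h$ are the vertical tangent bundles of $S\to\Sigma$ and $S_h\to X$; by the canonical vertical splitting, a morphism $T^*X\otimes S_\Sigma\to S_\Sigma$ over $\Sigma$ induces a morphism $T^*X\otimes VS_\Sigma\to VS_\Sigma$ over $S$, and similarly for $S_h$. **(1)** There is a well-defined morphism $\gamma_\Sigma:T^*X\otimes_\Sigma S_\Sigma\to S_\Sigma$ over $\Sigma$ given in every trivialization by $\gamma_\Sigma(dx^\lambda)=\sigma^\lambda_a\gamma^a$. Its restriction to $h(X)$ is denoted by $\gamma_h:T^*X\otimes S_h\to S_h$. **(2)** Let $\widetilde A$ be any smooth connection on the fibred manifold $S\to\Sigma$, let $\mathrm{pr}_1:VS\to VS_\Sigma$, $w\mapsto w-\widetilde A(Tq\,w)$ (with $q:S\to\Sigma$) be its vertical projection, and let $\widetilde D:J^1S\to T^*X\otimes VS_\Sigma$,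 $\widetilde D(\varphi)v=\varphi(v)-\widetilde A(Tq\,\varphi(v))$, be the vertical covariant differential, where a jet $\varphi\in J^1_yS$ of $S\to X$ is regarded as a right inverse $T_xX\to T_yS$ of the tangent map of $S\to X$. (a) For every connection $\Gamma$ on $\Sigma\to X$, the composition of $\Gamma$ and $\widetilde A$ is a connection $B$ on $S\to X$, and $\widetilde D=\mathrm{pr}_1\circ D_B$, $D_B$ being the covariant differential relative to $B$. (b) $\mathcal D=\gamma_\Sigma\circ\widetilde D:J^1S\to VS_\Sigma$ is a smooth first order differential operator on $S$ (a bundle morphism over $S$ carrying smooth families to smooth families), with coordinate expression $$\dot y\circ\mathcal D=\sigma^\lambda_a\gamma^a\bigl(y_\lambda-dy(\widetilde A(Tq\,\varphi(\partial_\lambda)))\bigr),$$ that is, $\sigma^\lambda_a\gamma^{aA}{}_B(y^B_\lambda-\widetilde A^B_\lambda-A^B{}^a_\mu\sigma^\mu_{a\lambda})$ if $\widetilde A=dx^\lambda\otimes(\partial_\lambda+\widetilde A^B_\lambda\partial_B)+d\sigma^\mu_a\otimes(\partial^a_\mu+A^B{}^a_\mu\partial_B)$. (c) For every tetrad field $h$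 there is exactly one connection $A_h$ on $S_h\to X$ with $Ti_h\circ A_h=\widetilde A\circ Th$. For every $\psi\in J^1S_h$, the map $Ti_h\circ\psi$ is an element of $J^1S$ and $Ti_h(\mathcal D_h\psi)=\mathcal D(Ti_h\circ\psi)$, where $\mathcal D_h=\gamma_h\circ D_{A_h}:J^1S_h\to VS_h$ is the Dirac operator relative to $A_h$. **(3)** Let $K$ be a smooth symmetric (torsion-free) connection on $TX$, $\nabla_{\partial_\mu}\partial_\lambda=K^\nu{}_{\lambda\mu}\partial_\nu$. Put $A^{ab}=\widetilde A^{ab}{}_\mu dx^\mu+A^{ab}{}^c_\mu d\sigma^\mu_c$ with $$\widetilde A^{ab}{}_\mu=\tfrac12K^\nu{}_{\lambda\mu}\sigma^\lambda_c(\eta^{cb}\sigma^a_\nu-\eta^{ca}\sigma^b_\nu),\qquad A^{ab}{}^c_\mu=\tfrac12(\eta^{cb}\sigma^a_\mu-\eta^{ca}\sigma^b_\mu).$$ (a) These are the local connection forms of a principal connection on $LX\to\Sigma$: with $A_i=(A^{ae}\eta_{eb})$ on $U_i$ and $l=z_j^{-1}z_i$ on $U_i\cap U_j$, one has $l\,A_i=A_j\,l+dl$,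 whatever charts of $X$ are used for $A_i$ and $A_j$. (b) There is exactly one connection $\widetilde A_\Sigma$ on $S\to\Sigma$ whose horizontal lifts satisfy $dy=-\frac12A^{ab}I_{ab}\,y$ in all trivializations and charts. (c) For every tetrad field $h$, with $h^\mu_a=\sigma^\mu_a\circ h$, the connection $A_h$ on $S_h$ induced by $\widetilde A_\Sigma$ satisfies $dy=-\frac12A_h^{ab}{}_\mu I_{ab}\,y\,dx^\mu$, where $$A_h^{ab}{}_\mu=\tfrac12\bigl[K^\nu{}_{\lambda\mu}h^\lambda_c(\eta^{cb}h^a_\nu-\eta^{ca}h^b_\nu)+\partial_\mu h^\nu_c(\eta^{cb}h^a_\nu-\eta^{ca}h^b_\nu)\bigr].$$ (d) If $K$ is the Levi-Civita connection of $g_h$ (that is, $\nabla g_h=0$), then $A_h^{ab}{}_\mu=\eta^{bd}h^a(\nabla_{\partial_\mu}h_d)$, and $A_h$ is the Levi-Civita spin connection of $g_h$, i.e. the connection on $S_h$ with $dy=-\frac12\omega^{ab}I_{ab}y$, $\omega^{ab}(v)=\eta^{bd}h^a(\nabla_vh_d)$. More generally, for arbitrary symmetric $K$ and a torsion-free connection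 $N$ on $TX$ with $N g_h=0$, $A_h$ is the spin connection of $N$ if and only if $\nabla g_h$ (with $\nabla=K$) is totally symmetric. -/

import Mathlib

open scoped Manifold ContDiff Topology Matrix TensorProduct
open Bundle Set

namespace CompositeSpinor

noncomputable section

set_option linter.unusedSectionVars false

/-- The model space `ℝ⁴` of the world manifold. -/
abbrev E4 := EuclideanSpace ℝ (Fin 4)

/-- Real `4 × 4` matrices. -/
abbrev Mat4 := Matrix (Fin 4) (Fin 4) ℝ

/-- Signs of the Minkowski metric of signature `(1,3)`. -/
def sgn : Fin 4 → ℝ := ![1, -1, -1, -1]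

/-- The Minkowski metric as a matrix. -/
def eta : Mat4 := Matrix.diagonal sgn

/-- Elements of the connected Lorentz group `L = SO(3,1)`: proper orthochronous Lorentz matrices. -/
structure IsLorentz (l : Mat4) : Prop where
  preserves : l * eta * lᵀ = eta
  det_eq : l.det = 1
  time_pos : 0 < l 0 0

lemma eta_mul_eta : eta * eta = 1 := by
  ext i j
  fin_cases i <;> fin_cases j <;> simp [eta, sgn]

lemma IsLorentz.preserves' {l : Mat4} (h : IsLorentz l) : lᵀ * eta * l = eta := by
  have h1 : l * (eta * lᵀ * eta) = 1 := by
    rw [← mul_assoc, ← mul_assoc, h.preserves, eta_mul_eta]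
  have h2 : (eta * lᵀ * eta) * l = 1 := mul_eq_one_comm.mp h1
  calc lᵀ * eta * l = (eta * eta) * (lᵀ * eta * l) := by rw [eta_mul_eta, one_mul]
    _ = eta * ((eta * lᵀ * eta) * l) := by simp only [mul_assoc]
    _ = eta := by rw [h2, mul_one]

lemma IsLorentz.one : IsLorentz 1 := ⟨by simp, by simp, by simp⟩

lemma IsLorentz.row {l : Mat4} (h : IsLorentz l) :
    l 0 0 ^ 2 = 1 + (l 0 1 ^ 2 + l 0 2 ^ 2 + l 0 3 ^ 2) := by
  have := congrFun (congrFun h.preserves 0) 0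
  simp [eta, sgn, Matrix.mul_apply, Fin.sum_univ_four, Matrix.diagonal_apply] at this
  linarith

lemma IsLorentz.col {l : Mat4} (h : IsLorentz l) :
    l 0 0 ^ 2 = 1 + (l 1 0 ^ 2 + l 2 0 ^ 2 + l 3 0 ^ 2) := by
  have := congrFun (congrFun h.preserves' 0) 0
  simp [eta, sgn, Matrix.mul_apply, Fin.sum_univ_four, Matrix.diagonal_apply] at this
  linarith

lemma IsLorentz.mul {l m : Mat4} (hl : IsLorentz l) (hm : IsLorentz m) : IsLorentz (l * m) := by
  refine ⟨?_, by rw [Matrix.det_mul, hl.det_eq, hm.det_eq, one_mul], ?_⟩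
  · calc l * m * eta * (l * m)ᵀ = l * (m * eta * mᵀ) * lᵀ := by
          simp only [Matrix.transpose_mul, mul_assoc]
      _ = eta := by rw [hm.preserves, hl.preserves]
  · have hr := hl.row
    have hc := hm.col
    have e : (l * m) 0 0 = l 0 0 * m 0 0 + (l 0 1 * m 1 0 + l 0 2 * m 2 0 + l 0 3 * m 3 0) := by
      simp [Matrix.mul_apply, Fin.sum_univ_four]; ring
    rw [e]
    set s := l 0 1 * m 1 0 + l 0 2 * m 2 0 + l 0 3 * m 3 0 with hs
    have cs : s ^ 2 ≤ (l 0 1 ^ 2 + l 0 2 ^ 2 + l 0 3 ^ 2) * (m 1 0 ^ 2 + m 2 0 ^ 2 + m 3 0 ^ 2) := by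
      rw [hs]
      nlinarith [sq_nonneg (l 0 1 * m 2 0 - l 0 2 * m 1 0),
        sq_nonneg (l 0 1 * m 3 0 - l 0 3 * m 1 0), sq_nonneg (l 0 2 * m 3 0 - l 0 3 * m 2 0)]
    have hp : 0 < l 0 0 * m 0 0 := mul_pos hl.time_pos hm.time_pos
    have lt : s ^ 2 < (l 0 0 * m 0 0) ^ 2 := by
      rw [mul_pow, hr, hc]
      have a1 : 0 ≤ l 0 1 ^ 2 + l 0 2 ^ 2 + l 0 3 ^ 2 := by positivity
      have a2 : 0 ≤ m 1 0 ^ 2 + m 2 0 ^ 2 + m 3 0 ^ 2 := by positivity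
      nlinarith
    have := abs_lt_of_sq_lt_sq lt hp.le
    linarith [neg_abs_le s]

lemma IsLorentz.inv_mul {l : Mat4} (h : IsLorentz l) : (eta * lᵀ * eta) * l = 1 := by
  have h1 : l * (eta * lᵀ * eta) = 1 := by
    rw [← mul_assoc, ← mul_assoc, h.preserves, eta_mul_eta]
  exact mul_eq_one_comm.mp h1

lemma eta_transpose : etaᵀ = eta := by simp [eta]

lemma det_eta_mul_det_eta : eta.det * eta.det = 1 := by
  rw [← Matrix.det_mul, eta_mul_eta, Matrix.det_one]

lemma IsLorentz.inv {l : Mat4} (h : IsLorentz l) : IsLorentz (eta * lᵀ * eta) := by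
  refine ⟨?_, ?_, ?_⟩
  · have : (eta * lᵀ * eta)ᵀ = eta * l * eta := by
      simp [Matrix.transpose_mul, eta_transpose, mul_assoc]
    rw [this]
    calc eta * lᵀ * eta * eta * (eta * l * eta) = eta * lᵀ * (eta * eta) * eta * l * eta := by
          simp only [mul_assoc]
      _ = eta * (lᵀ * eta * l) * eta := by rw [eta_mul_eta, mul_one]; simp only [mul_assoc]
      _ = eta := by rw [h.preserves', eta_mul_eta, one_mul]
  · rw [Matrix.det_mul, Matrix.det_mul, Matrix.det_transpose, h.det_eq, mul_one,
      det_eta_mul_det_eta]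
  · have : (eta * lᵀ * eta) 0 0 = l 0 0 := by
      simp [eta, sgn, Matrix.mul_apply, Matrix.diagonal_apply]
    rw [this]; exact h.time_pos

/-! ### Lower triangular slice of the Lorentz action -/

/-- Lower triangular matrices, given by their entries. -/
abbrev LowTri := {p : Fin 4 × Fin 4 // p.2 ≤ p.1} → ℝ

/-- The lower triangular matrix with given entries. -/
def toMat (b : LowTri) : Mat4 := Matrix.of fun i j => if h : j ≤ i then b ⟨(i, j), h⟩ else 0

/-- Positivity of the diagonal. -/
def PosDiag (b : LowTri) : Prop := ∀ i, 0 < b ⟨(i, i), le_rfl⟩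

/-- The matrices `b l` with `b` lower triangular of positive diagonal and `l` in `L`. -/
def InCell (m : Mat4) : Prop := ∃ b : LowTri, PosDiag b ∧ ∃ l, IsLorentz l ∧ m = toMat b * l

def c00 (q : Mat4) : ℝ := √(q 0 0)
def c10 (q : Mat4) : ℝ := q 1 0 / c00 q
def c20 (q : Mat4) : ℝ := q 2 0 / c00 q
def c30 (q : Mat4) : ℝ := q 3 0 / c00 q
def d1 (q : Mat4) : ℝ := c10 q ^ 2 - q 1 1
def c11 (q : Mat4) : ℝ := √(d1 q)
def c21 (q : Mat4) : ℝ := (c20 q * c10 q - q 2 1) / c11 q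
def c31 (q : Mat4) : ℝ := (c30 q * c10 q - q 3 1) / c11 q
def d2 (q : Mat4) : ℝ := c20 q ^ 2 - c21 q ^ 2 - q 2 2
def c22 (q : Mat4) : ℝ := √(d2 q)
def c32 (q : Mat4) : ℝ := (c30 q * c20 q - c31 q * c21 q - q 3 2) / c22 q
def d3 (q : Mat4) : ℝ := c30 q ^ 2 - c31 q ^ 2 - c32 q ^ 2 - q 3 3
def c33 (q : Mat4) : ℝ := √(d3 q)

/-- The lower triangular factor `b` of `q = b η bᵀ`. -/
def chol (q : Mat4) : Mat4 :=
  !![c00 q, 0, 0, 0; c10 q, c11 q, 0, 0; c20 q, c21 q, c22 q, 0; c30 q, c31 q, c32 q, c33 q]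

/-- The positive lower triangular factor of `m = b l`. -/
def cholLT (m : Mat4) : LowTri := fun p => chol (m * eta * mᵀ) p.1.1 p.1.2

lemma toMat_cholLT (m : Mat4) : toMat (cholLT m) = chol (m * eta * mᵀ) := by
  ext i j
  fin_cases i <;> fin_cases j <;> simp [toMat, cholLT, chol]

lemma toMat_injective : Function.Injective toMat := by
  intro b b' h
  ext ⟨⟨i, j⟩, hij⟩
  have := congrFun (congrFun h i) j
  simpa [toMat, show j ≤ i from hij] using this

/-- The open conditions describing the cell. -/
structure CellCond (m : Mat4) : Prop where
  h0 : 0 < (m * eta * mᵀ) 0 0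
  h1 : 0 < d1 (m * eta * mᵀ)
  h2 : 0 < d2 (m * eta * mᵀ)
  h3 : 0 < d3 (m * eta * mᵀ)
  ht : 0 < m 0 0
  hd : 0 < m.det

lemma toMat_entries (b : LowTri) : toMat b = !![b ⟨(0,0), by decide⟩, 0, 0, 0;
    b ⟨(1,0), by decide⟩, b ⟨(1,1), by decide⟩, 0, 0;
    b ⟨(2,0), by decide⟩, b ⟨(2,1), by decide⟩, b ⟨(2,2), by decide⟩, 0;
    b ⟨(3,0), by decide⟩, b ⟨(3,1), by decide⟩, b ⟨(3,2), by decide⟩, b ⟨(3,3), by decide⟩] := by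
  ext i j
  fin_cases i <;> fin_cases j <;> simp [toMat]

/-- `b η bᵀ` for lower triangular `b`, entry by entry (lower half). -/
lemma quad_entries (a00 a10 a20 a30 a11 a21 a31 a22 a32 a33 : ℝ) :
    (!![a00, 0, 0, 0; a10, a11, 0, 0; a20, a21, a22, 0; a30, a31, a32, a33] : Mat4) * eta *
      (!![a00, 0, 0, 0; a10, a11, 0, 0; a20, a21, a22, 0; a30, a31, a32, a33] : Mat4)ᵀ =
    !![a00 ^ 2, a00 * a10, a00 * a20, a00 * a30;
       a00 * a10, a10 ^ 2 - a11 ^ 2, a10 * a20 - a11 * a21, a10 * a30 - a11 * a31;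
       a00 * a20, a10 * a20 - a11 * a21, a20 ^ 2 - a21 ^ 2 - a22 ^ 2,
         a20 * a30 - a21 * a31 - a22 * a32;
       a00 * a30, a10 * a30 - a11 * a31, a20 * a30 - a21 * a31 - a22 * a32,
         a30 ^ 2 - a31 ^ 2 - a32 ^ 2 - a33 ^ 2] := by
  have he : eta = !![1, 0, 0, 0; 0, -1, 0, 0; 0, 0, -1, 0; 0, 0, 0, -1] := by
    ext i j
    fin_cases i <;> fin_cases j <;> simp [eta, sgn]
  rw [he]
  ext i j
  fin_cases i <;> fin_cases j <;>
    simp [Matrix.mul_apply, Fin.sum_univ_four] <;> ring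

lemma chol_quad {a00 a10 a20 a30 a11 a21 a31 a22 a32 a33 : ℝ} (h0 : 0 < a00) (h1 : 0 < a11)
    (h2 : 0 < a22) (h3 : 0 < a33) {q : Mat4}
    (hq : q = (!![a00, 0, 0, 0; a10, a11, 0, 0; a20, a21, a22, 0; a30, a31, a32, a33] : Mat4) * eta *
      (!![a00, 0, 0, 0; a10, a11, 0, 0; a20, a21, a22, 0; a30, a31, a32, a33] : Mat4)ᵀ) :
    chol q = !![a00, 0, 0, 0; a10, a11, 0, 0; a20, a21, a22, 0; a30, a31, a32, a33] ∧
      0 < q 0 0 ∧ 0 < d1 q ∧ 0 < d2 q ∧ 0 < d3 q := by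
  rw [quad_entries] at hq
  have e00 : c00 q = a00 := by simp [c00, hq, Real.sqrt_sq h0.le]
  have e10 : c10 q = a10 := by rw [c10, e00, hq]; simp; field_simp
  have e20 : c20 q = a20 := by rw [c20, e00, hq]; simp; field_simp
  have e30 : c30 q = a30 := by rw [c30, e00, hq]; simp; field_simp
  have f1 : d1 q = a11 ^ 2 := by rw [d1, e10, hq]; simp
  have e11 : c11 q = a11 := by rw [c11, f1, Real.sqrt_sq h1.le]
  have e21 : c21 q = a21 := by rw [c21, e20, e10, e11, hq]; simp; field_simp; ring
  have e31 : c31 q = a31 := by rw [c31, e30, e10, e11, hq]; simp; field_simp; ring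
  have f2 : d2 q = a22 ^ 2 := by rw [d2, e20, e21, hq]; simp
  have e22 : c22 q = a22 := by rw [c22, f2, Real.sqrt_sq h2.le]
  have e32 : c32 q = a32 := by rw [c32, e30, e20, e31, e21, e22, hq]; simp; field_simp; ring
  have f3 : d3 q = a33 ^ 2 := by rw [d3, e30, e31, e32, hq]; simp
  have e33 : c33 q = a33 := by rw [c33, f3, Real.sqrt_sq h3.le]
  refine ⟨?_, ?_, ?_, ?_, ?_⟩
  · rw [chol, e00, e10, e20, e30, e11, e21, e31, e22, e32, e33]
  · rw [hq]; simp; positivity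
  · rw [f1]; positivity
  · rw [f2]; positivity
  · rw [f3]; positivity

lemma det_toMat_pos {b : LowTri} (hb : PosDiag b) : 0 < (toMat b).det := by
  rw [Matrix.det_of_isLowerTriangular]
  · refine Finset.prod_pos fun i _ => ?_
    simpa [toMat] using hb i
  · intro i j hij
    have : ¬ j ≤ i := not_le.mpr hij
    simp [toMat, this]

lemma quad_mul_lorentz (m l : Mat4) (hl : IsLorentz l) :
    m * l * eta * (m * l)ᵀ = m * eta * mᵀ := by
  calc m * l * eta * (m * l)ᵀ = m * (l * eta * lᵀ) * mᵀ := by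
        simp only [Matrix.transpose_mul, mul_assoc]
    _ = _ := by rw [hl.preserves]

lemma cholLT_mul_lorentz (m l : Mat4) (hl : IsLorentz l) : cholLT (m * l) = cholLT m := by
  funext p
  rw [cholLT, cholLT, quad_mul_lorentz m l hl]

lemma cholLT_toMat {b : LowTri} (hb : PosDiag b) : cholLT (toMat b) = b := by
  apply toMat_injective
  rw [toMat_cholLT]
  have := (chol_quad (hb 0) (hb 1) (hb 2) (hb 3) (q := toMat b * eta * (toMat b)ᵀ)
    (by rw [toMat_entries])).1
  rw [this, ← toMat_entries]

lemma cellCond_of_inCell {m : Mat4} (h : InCell m) : CellCond m := by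
  obtain ⟨b, hb, l, hl, rfl⟩ := h
  have := (chol_quad (hb 0) (hb 1) (hb 2) (hb 3) (q := toMat b * eta * (toMat b)ᵀ)
    (by rw [toMat_entries])).2
  obtain ⟨k0, k1, k2, k3⟩ := this
  rw [← quad_mul_lorentz _ l hl] at k0 k1 k2 k3
  refine ⟨k0, k1, k2, k3, ?_, ?_⟩
  · have : (toMat b * l) 0 0 = b ⟨(0,0), by decide⟩ * l 0 0 := by
      simp [toMat_entries, Matrix.mul_apply, Fin.sum_univ_four]
    rw [this]; exact mul_pos (hb 0) hl.time_pos
  · rw [Matrix.det_mul, hl.det_eq, mul_one]; exact det_toMat_pos hb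

lemma posDiag_cholLT {m : Mat4} (h : CellCond m) : PosDiag (cholLT m) := by
  intro i
  fin_cases i
  · have : 0 < c00 (m * eta * mᵀ) := Real.sqrt_pos.mpr h.h0
    simpa [cholLT, chol] using this
  · have : 0 < c11 (m * eta * mᵀ) := Real.sqrt_pos.mpr h.h1
    simpa [cholLT, chol] using this
  · have : 0 < c22 (m * eta * mᵀ) := Real.sqrt_pos.mpr h.h2
    simpa [cholLT, chol] using this
  · have : 0 < c33 (m * eta * mᵀ) := Real.sqrt_pos.mpr h.h3
    simpa [cholLT, chol] using this

lemma quad_cholLT {m : Mat4} (h : CellCond m) :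
    toMat (cholLT m) * eta * (toMat (cholLT m))ᵀ = m * eta * mᵀ := by
  rw [toMat_cholLT]
  obtain ⟨h0, h1, h2, h3, -, -⟩ := h
  have hsym : (m * eta * mᵀ)ᵀ = m * eta * mᵀ := by
    simp [Matrix.transpose_mul, eta_transpose, mul_assoc]
  generalize m * eta * mᵀ = q at *
  have s : ∀ i j, q i j = q j i := fun i j => by
    conv_lhs => rw [← hsym]
    rfl
  rw [chol, quad_entries]
  have p0 : 0 < c00 q := Real.sqrt_pos.mpr h0
  have p1 : 0 < c11 q := Real.sqrt_pos.mpr h1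
  have p2 : 0 < c22 q := Real.sqrt_pos.mpr h2
  have q0 : c00 q ^ 2 = q 0 0 := Real.sq_sqrt h0.le
  have q1 : c11 q ^ 2 = d1 q := Real.sq_sqrt h1.le
  have q2 : c22 q ^ 2 = d2 q := Real.sq_sqrt h2.le
  have q3 : c33 q ^ 2 = d3 q := Real.sq_sqrt h3.le
  have r10 : c00 q * c10 q = q 1 0 := by rw [c10]; field_simp
  have r20 : c00 q * c20 q = q 2 0 := by rw [c20]; field_simp
  have r30 : c00 q * c30 q = q 3 0 := by rw [c30]; field_simp
  have r21 : c11 q * c21 q = c20 q * c10 q - q 2 1 := by rw [c21]; field_simp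
  have r31 : c11 q * c31 q = c30 q * c10 q - q 3 1 := by rw [c31]; field_simp
  have r32 : c22 q * c32 q = c30 q * c20 q - c31 q * c21 q - q 3 2 := by rw [c32]; field_simp
  rw [q0, q1, q2, q3, r10, r20, r30, r21, r31, r32]
  ext i j
  fin_cases i <;> fin_cases j <;> simp [d1, d2, d3] <;>
    first | done | exact s _ _ | (linarith [s 1 2, s 1 3, s 2 3])

lemma inCell_of_cellCond {m : Mat4} (h : CellCond m) : InCell m := by
  have hb := posDiag_cholLT h
  set b := cholLT m with hbdef
  have hdet := det_toMat_pos hb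
  have hu : IsUnit (toMat b).det := hdet.ne'.isUnit
  have hml : toMat b * ((toMat b)⁻¹ * m) = m := Matrix.mul_nonsing_inv_cancel_left _ _ hu
  have hquad := quad_cholLT h
  rw [← hbdef] at hquad
  have hut : IsUnit (toMat b)ᵀ.det := by rwa [Matrix.det_transpose]
  have hpres : ((toMat b)⁻¹ * m) * eta * ((toMat b)⁻¹ * m)ᵀ = eta := by
    have : ((toMat b)⁻¹ * m) * eta * ((toMat b)⁻¹ * m)ᵀ
        = (toMat b)⁻¹ * (m * eta * mᵀ) * ((toMat b)⁻¹)ᵀ := by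
      simp only [Matrix.transpose_mul, mul_assoc]
    rw [this, ← hquad, Matrix.transpose_nonsing_inv]
    calc (toMat b)⁻¹ * (toMat b * eta * (toMat b)ᵀ) * (toMat b)ᵀ⁻¹
        = ((toMat b)⁻¹ * toMat b) * eta * ((toMat b)ᵀ * (toMat b)ᵀ⁻¹) := by
          simp only [mul_assoc]
      _ = eta := by rw [Matrix.nonsing_inv_mul _ hu, Matrix.mul_nonsing_inv _ hut]; simp
  refine ⟨b, hb, (toMat b)⁻¹ * m, ⟨hpres, ?_, ?_⟩, hml.symm⟩
  · have hd2 := congrArg Matrix.det hpres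
    rw [Matrix.det_mul, Matrix.det_mul, Matrix.det_transpose] at hd2
    have hd3 : (toMat b).det * ((toMat b)⁻¹ * m).det = m.det := by rw [← Matrix.det_mul, hml]
    have hpos : 0 < ((toMat b)⁻¹ * m).det := by
      have := h.hd
      rw [← hd3] at this
      exact (pos_iff_pos_of_mul_pos this).mp hdet
    have hne : eta.det ≠ 0 := fun h0 => by
      have := det_eta_mul_det_eta; rw [h0] at this; simp at this
    have : (((toMat b)⁻¹ * m).det) ^ 2 = 1 := by
      apply mul_right_cancel₀ hne; linarith
    nlinarith
  · have e : (toMat b * ((toMat b)⁻¹ * m)) 0 0 = b ⟨(0,0), by decide⟩ * ((toMat b)⁻¹ * m) 0 0 := by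
      rw [Matrix.mul_apply, Fin.sum_univ_four]
      simp [toMat_entries b]
    rw [hml] at e
    have := h.ht
    rw [e] at this
    exact (pos_iff_pos_of_mul_pos this).mp (hb 0)

lemma inCell_iff {m : Mat4} : InCell m ↔ CellCond m := ⟨cellCond_of_inCell, inCell_of_cellCond⟩

lemma inCell_one : InCell 1 := by
  refine ⟨fun p => if p.1.1 = p.1.2 then 1 else 0, fun i => by simp, 1, .one, ?_⟩
  rw [mul_one]
  ext i j
  fin_cases i <;> fin_cases j <;> simp [toMat]

lemma InCell.mul_lorentz {m l : Mat4} (h : InCell m) (hl : IsLorentz l) : InCell (m * l) := by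
  obtain ⟨b, hb, l', hl', rfl⟩ := h
  exact ⟨b, hb, l' * l, hl'.mul hl, by rw [mul_assoc]⟩

lemma InCell.exists_lorentz {m : Mat4} (h : InCell m) :
    ∃ l, IsLorentz l ∧ toMat (cholLT m) = m * l := by
  obtain ⟨b, hb, l, hl, rfl⟩ := h
  refine ⟨eta * lᵀ * eta, hl.inv, ?_⟩
  rw [cholLT_mul_lorentz _ _ hl, cholLT_toMat hb, mul_assoc, mul_eq_one_comm.mp hl.inv_mul, mul_one]

/-! ### Smoothness of the factorisation -/

section smooth
variable {F : Type*} [NormedAddCommGroup F] [NormedSpace ℝ F]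

lemma contDiffAt_quad {f : F → Mat4} {x : F} (hf : ∀ i j, ContDiffAt ℝ ∞ (fun y => f y i j) x)
    (i j : Fin 4) : ContDiffAt ℝ ∞ (fun y => (f y * eta * (f y)ᵀ) i j) x := by
  simp only [Matrix.mul_apply, Matrix.transpose_apply]
  refine ContDiffAt.sum fun k _ => ContDiffAt.mul (ContDiffAt.sum fun l _ => ?_) (hf j k)
  exact (hf i l).mul contDiffAt_const

/-- Entries of the factorisation of a smooth family of matrices. -/
lemma chol_smooth {q : F → Mat4} {x : F} (hq : ∀ i j, ContDiffAt ℝ ∞ (fun y => q y i j) x)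
    (h0 : 0 < q x 0 0) (h1 : 0 < d1 (q x)) (h2 : 0 < d2 (q x)) (h3 : 0 < d3 (q x)) :
    (∀ i j, ContDiffAt ℝ ∞ (fun y => chol (q y) i j) x) ∧
    ContinuousAt (fun y => d1 (q y)) x ∧ ContinuousAt (fun y => d2 (q y)) x ∧
    ContinuousAt (fun y => d3 (q y)) x := by
  have n0 : c00 (q x) ≠ 0 := (Real.sqrt_pos.mpr h0).ne'
  have n1 : c11 (q x) ≠ 0 := (Real.sqrt_pos.mpr h1).ne'
  have n2 : c22 (q x) ≠ 0 := (Real.sqrt_pos.mpr h2).ne'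
  have e00 : ContDiffAt ℝ ∞ (fun y => c00 (q y)) x := (hq 0 0).sqrt h0.ne'
  have e10 : ContDiffAt ℝ ∞ (fun y => c10 (q y)) x := (hq 1 0).div e00 n0
  have e20 : ContDiffAt ℝ ∞ (fun y => c20 (q y)) x := (hq 2 0).div e00 n0
  have e30 : ContDiffAt ℝ ∞ (fun y => c30 (q y)) x := (hq 3 0).div e00 n0
  have f1 : ContDiffAt ℝ ∞ (fun y => d1 (q y)) x := (e10.pow 2).sub (hq 1 1)
  have e11 : ContDiffAt ℝ ∞ (fun y => c11 (q y)) x := f1.sqrt h1.ne'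
  have e21 : ContDiffAt ℝ ∞ (fun y => c21 (q y)) x := ((e20.mul e10).sub (hq 2 1)).div e11 n1
  have e31 : ContDiffAt ℝ ∞ (fun y => c31 (q y)) x := ((e30.mul e10).sub (hq 3 1)).div e11 n1
  have f2 : ContDiffAt ℝ ∞ (fun y => d2 (q y)) x := ((e20.pow 2).sub (e21.pow 2)).sub (hq 2 2)
  have e22 : ContDiffAt ℝ ∞ (fun y => c22 (q y)) x := f2.sqrt h2.ne'
  have e32 : ContDiffAt ℝ ∞ (fun y => c32 (q y)) x :=
    (((e30.mul e20).sub (e31.mul e21)).sub (hq 3 2)).div e22 n2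
  have f3 : ContDiffAt ℝ ∞ (fun y => d3 (q y)) x :=
    (((e30.pow 2).sub (e31.pow 2)).sub (e32.pow 2)).sub (hq 3 3)
  have e33 : ContDiffAt ℝ ∞ (fun y => c33 (q y)) x := f3.sqrt h3.ne'
  refine ⟨fun i j => ?_, f1.continuousAt, f2.continuousAt, f3.continuousAt⟩
  fin_cases i <;> fin_cases j <;> simp [chol] <;> first | assumption | exact contDiffAt_const

lemma cholLT_smooth {f : F → Mat4} {x : F} (hf : ∀ i j, ContDiffAt ℝ ∞ (fun y => f y i j) x)
    (h : InCell (f x)) : ContDiffAt ℝ ∞ (fun y => cholLT (f y)) x := by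
  have h' := inCell_iff.mp h
  refine contDiffAt_pi.mpr fun p => ?_
  exact (chol_smooth (contDiffAt_quad hf) h'.h0 h'.h1 h'.h2 h'.h3).1 p.1.1 p.1.2

lemma eventually_inCell {f : F → Mat4} {x : F} (hf : ∀ i j, ContDiffAt ℝ ∞ (fun y => f y i j) x)
    (h : InCell (f x)) : ∀ᶠ y in 𝓝 x, InCell (f y) := by
  have h' := inCell_iff.mp h
  obtain ⟨-, k1, k2, k3⟩ := chol_smooth (contDiffAt_quad hf) h'.h0 h'.h1 h'.h2 h'.h3
  have hdet : ContinuousAt (fun y => (f y).det) x := by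
    simp only [Matrix.det_apply]
    refine tendsto_finsetSum _ fun σ _ => Filter.Tendsto.const_smul
      (tendsto_finsetProd _ fun i _ => (hf _ _).continuousAt) _
  filter_upwards [(contDiffAt_quad hf 0 0).continuousAt.eventually (lt_mem_nhds h'.h0),
    k1.eventually (lt_mem_nhds h'.h1), k2.eventually (lt_mem_nhds h'.h2),
    k3.eventually (lt_mem_nhds h'.h3), (hf 0 0).continuousAt.eventually (lt_mem_nhds h'.ht),
    hdet.eventually (lt_mem_nhds h'.hd)] with y a0 a1 a2 a3 a4 a5
  exact inCell_iff.mpr ⟨a0, a1, a2, a3, a4, a5⟩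

end smooth

/-! ### Oriented frames and the bundle of tetrads -/

/-- The matrix of a linear endomorphism of `ℝ⁴`. -/
def matOf (T : E4 →L[ℝ] E4) : Mat4 := Matrix.of fun ν μ => T (EuclideanSpace.single μ 1) ν

/-- The matrix whose columns are the given vectors. -/
def frameMat (v : Fin 4 → E4) : Mat4 := Matrix.of fun ν a => v a ν

/-- The vectors given by the columns of a matrix. -/
def cols (m : Mat4) : Fin 4 → E4 := fun a => WithLp.toLp 2 fun ν => m ν a

lemma frameMat_cols (m : Mat4) : frameMat (cols m) = m := by
  ext i j; rfl

lemma E4_eq_sum (v : E4) : v = ∑ μ, v μ • EuclideanSpace.single μ (1 : ℝ) := by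
  ext i
  simp [Finset.sum_apply, Pi.single_apply]

lemma matOf_apply_vec (T : E4 →L[ℝ] E4) (v : E4) (ν : Fin 4) :
    T v ν = ∑ μ, matOf T ν μ * v μ := by
  conv_lhs => rw [E4_eq_sum v, map_sum]
  simp [matOf, mul_comm]

lemma frameMat_map (T : E4 →L[ℝ] E4) (v : Fin 4 → E4) :
    frameMat (fun a => T (v a)) = matOf T * frameMat v := by
  ext ν a
  simp [frameMat, Matrix.mul_apply, matOf_apply_vec]

section manifold

variable {X : Type*} [TopologicalSpace X] [ChartedSpace E4 X] [IsManifold 𝓘(ℝ, E4) ∞ X]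

/-- The Jacobian matrix `∂c'/∂c` at `x` of the transition from the chart `c` to `c'`. -/
def jacMat (c c' : atlas E4 X) (x : X) : Mat4 :=
  matOf ((tangentBundleCore 𝓘(ℝ, E4) X).coordChange c c' x)

variable (X) in
/-- The atlas is oriented: all transition maps have positive Jacobian determinant. -/
class OrientedAtlas : Prop where
  det_pos : ∀ (c c' : atlas E4 X) (x : X), x ∈ c.1.source → x ∈ c'.1.source →
    0 < (jacMat c c' x).det

lemma jacMat_self (c : atlas E4 X) {x : X} (hx : x ∈ c.1.source) : jacMat c c x = 1 := by
  ext ν μ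
  have := (tangentBundleCore 𝓘(ℝ, E4) X).coordChange_self c x hx (EuclideanSpace.single μ 1)
  rw [jacMat, matOf, Matrix.of_apply, this]
  simp [Matrix.one_apply]

lemma jacMat_mul (c c' c'' : atlas E4 X) {x : X} (h : x ∈ c.1.source) (h' : x ∈ c'.1.source)
    (h'' : x ∈ c''.1.source) : jacMat c' c'' x * jacMat c c' x = jacMat c c'' x := by
  ext ν μ
  have := (tangentBundleCore 𝓘(ℝ, E4) X).coordChange_comp c c' c'' x ⟨⟨h, h'⟩, h''⟩
    (EuclideanSpace.single μ 1)
  rw [jacMat, jacMat, jacMat, Matrix.mul_apply]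
  simp only [← this, matOf, Matrix.of_apply]
  rw [matOf_apply_vec]
  rfl

lemma jacMat_smooth (c c' : atlas E4 X) {u : E4} (hu : u ∈ c.1.target)
    (hu' : c.1.symm u ∈ c'.1.source) (i j : Fin 4) :
    ContDiffAt ℝ ∞ (fun y => jacMat c c' (c.1.symm y) i j) u := by
  have hopen : IsOpen (c.1.symm ≫ₕ c'.1).source := (c.1.symm ≫ₕ c'.1).open_source
  have hmem : u ∈ (c.1.symm ≫ₕ c'.1).source := by
    rw [OpenPartialHomeomorph.trans_source]; exact ⟨hu, hu'⟩
  have : IsManifold 𝓘(ℝ, E4) (∞ + 1) X := by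
    rw [show (∞ : WithTop ℕ∞) + 1 = ∞ from rfl]; infer_instance
  have h := contDiffOn_fderiv_coord_change (n := ∞) (I := 𝓘(ℝ, E4)) c c'
  have hs : ((c.1.extend 𝓘(ℝ, E4)).symm ≫ c'.1.extend 𝓘(ℝ, E4)).source
      = (c.1.symm ≫ₕ c'.1).source := by
    ext y; simp [PartialEquiv.trans_source]
  rw [hs] at h
  have h2 := (h u hmem).contDiffAt (hopen.mem_nhds hmem)
  have h3 : ContDiffAt ℝ ∞ (fun y => (fderivWithin ℝ (c'.1.extend 𝓘(ℝ, E4) ∘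
      (c.1.extend 𝓘(ℝ, E4)).symm) (range 𝓘(ℝ, E4)) y) (EuclideanSpace.single j 1)) u :=
    h2.clm_apply contDiffAt_const
  have h4 := (contDiffAt_piLp 2).mp h3 i
  refine h4.congr_of_eventuallyEq ?_
  filter_upwards [c.1.open_target.mem_nhds hu] with y hy
  simp only [jacMat, matOf, tangentBundleCore_coordChange, Matrix.of_apply]
  rw [show c.1.extend 𝓘(ℝ, E4) (c.1.symm y) = y from by simp [c.1.right_inv hy]]

/-- A positively oriented linear frame of the tangent space `T_x X`, that is, an element of the
fibre over `x` of the frame bundle `LX` with structure group `GL⁺(4,ℝ)`. Tangent vectors are given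
by their components in the preferred chart at `x`. -/
structure Frame (x : X) where
  vec : Fin 4 → TangentSpace 𝓘(ℝ, E4) x
  pos : 0 < (frameMat vec).det

/-- The matrix of components of a frame in the preferred chart. -/
def Frame.mat {x : X} (f : Frame x) : Mat4 := frameMat f.vec

/-- The fibre of `LX → LX/L`: frames that differ by an element of `L` acting on the right. -/
def frameSetoid (x : X) : Setoid (Frame x) where
  r f f' := ∃ l, IsLorentz l ∧ f'.mat = f.mat * l
  iseqv :=
    { refl := fun f => ⟨1, .one, by simp⟩
      symm := by
        rintro f f' ⟨l, hl, h⟩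
        refine ⟨_, hl.inv, ?_⟩
        rw [h, mul_assoc, mul_eq_one_comm.mp hl.inv_mul, mul_one]
      trans := by
        rintro f f' f'' ⟨l, hl, h⟩ ⟨l', hl', h'⟩
        exact ⟨l * l', hl.mul hl', by rw [h', h, mul_assoc]⟩ }

variable (X) in
/-- The quotient `Σ = LX/L` of the bundle of oriented frames by the connected Lorentz group. -/
structure Tetrads where
  /-- The projection `Σ → X`. -/
  pt : X
  cls : Quotient (frameSetoid pt)

/-- The projection `LX → Σ = LX/L`. -/
def Frame.toTetrads {x : X} (f : Frame x) : Tetrads X := ⟨x, Quotient.mk _ f⟩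

/-- The coordinate frame of the preferred chart. -/
def stdFrame (x : X) : Frame x := ⟨cols 1, by rw [frameMat_cols]; simp⟩

/-- The components of a frame in the chart `c`. -/
def Frame.matIn {x : X} (c : atlas E4 X) (f : Frame x) : Mat4 := jacMat (achart E4 x) c x * f.mat

lemma Frame.matIn_of_rel {x : X} (c : atlas E4 X) {f f' : Frame x} {l : Mat4}
    (h : f'.mat = f.mat * l) : f'.matIn c = f.matIn c * l := by
  rw [matIn, matIn, h, mul_assoc]

lemma Tetrads.exists_rep (σ : Tetrads X) : ∃ (x : X) (f : Frame x), σ = f.toTetrads := by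
  obtain ⟨x, q⟩ := σ
  obtain ⟨f, rfl⟩ := Quotient.exists_rep q
  exact ⟨x, f, rfl⟩

open Classical in
/-- The class of the frame at `x` with component matrix `m` (if `m` has positive determinant). -/
def ofMat (x : X) (m : Mat4) : Tetrads X :=
  if h : 0 < (frameMat (cols m)).det then Frame.toTetrads (x := x) ⟨cols m, h⟩
  else (stdFrame x).toTetrads

lemma ofMat_pt (x : X) (m : Mat4) : (ofMat x m).pt = x := by
  unfold ofMat; split_ifs <;> rfl

lemma ofMat_exists (x : X) {m : Mat4} (hm : 0 < m.det) :
    ∃ f : Frame x, f.mat = m ∧ ofMat x m = f.toTetrads := by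
  have h : 0 < (frameMat (cols m)).det := by rwa [frameMat_cols]
  exact ⟨⟨cols m, h⟩, frameMat_cols m, dif_pos h⟩

lemma toTetrads_eq {x : X} {f f' : Frame x} {l : Mat4} (hl : IsLorentz l)
    (h : f'.mat = f.mat * l) : f'.toTetrads = f.toTetrads := by
  have : Quotient.mk (frameSetoid x) f' = Quotient.mk _ f :=
    Quotient.sound ((frameSetoid x).symm ⟨l, hl, h⟩)
  rw [Frame.toTetrads, Frame.toTetrads, this]

/-- The fibre coordinates of a chart of `Σ`. -/
def fibreCoord (c : atlas E4 X) (k : Mat4) (σ : Tetrads X) : LowTri :=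
  Quotient.lift (fun f : Frame σ.pt => cholLT (k⁻¹ * f.matIn c))
    (by
      rintro f f' ⟨l, hl, h⟩
      simp only [Frame.matIn_of_rel c h, ← mul_assoc]
      rw [cholLT_mul_lorentz _ _ hl]) σ.cls

/-- The domain of the fibre coordinates of a chart of `Σ`. -/
def fibreCell (c : atlas E4 X) (k : Mat4) (σ : Tetrads X) : Prop :=
  ∃ f : Frame σ.pt, Quotient.mk _ f = σ.cls ∧ InCell (k⁻¹ * f.matIn c)

lemma fibreCoord_toTetrads (c : atlas E4 X) (k : Mat4) {x : X} (f : Frame x) :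
    fibreCoord c k f.toTetrads = cholLT (k⁻¹ * f.matIn c) := rfl

lemma fibreCell_toTetrads (c : atlas E4 X) (k : Mat4) {x : X} (f : Frame x) :
    fibreCell c k f.toTetrads ↔ InCell (k⁻¹ * f.matIn c) := by
  constructor
  · rintro ⟨f', h, hc⟩
    obtain ⟨l, hl, e⟩ := Quotient.exact h
    have e' : f.matIn c = f'.matIn c * l := Frame.matIn_of_rel (f := f') (f' := f) c e
    rw [e', ← mul_assoc]
    exact hc.mul_lorentz hl
  · exact fun h => ⟨f, rfl, h⟩

/-- The frame class with given coordinates. -/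
def fibrePoint (c : atlas E4 X) (k : Mat4) (p : E4 × LowTri) : Tetrads X :=
  ofMat (c.1.symm p.1) (jacMat c (achart E4 (c.1.symm p.1)) (c.1.symm p.1) * (k * toMat p.2))

lemma fibrePoint_exists [OrientedAtlas X] (c : atlas E4 X) {k : Mat4} (hk : 0 < k.det)
    {p : E4 × LowTri} (hu : p.1 ∈ c.1.target) (hb : PosDiag p.2) :
    ∃ f : Frame (c.1.symm p.1), fibrePoint c k p = f.toTetrads ∧
      ∀ c' : atlas E4 X, c.1.symm p.1 ∈ c'.1.source →
        f.matIn c' = jacMat c c' (c.1.symm p.1) * (k * toMat p.2) := by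
  have hx : c.1.symm p.1 ∈ c.1.source := c.1.map_target hu
  have hx' := mem_chart_source E4 (c.1.symm p.1)
  obtain ⟨f, hf, e⟩ := ofMat_exists (c.1.symm p.1)
    (m := jacMat c (achart E4 (c.1.symm p.1)) (c.1.symm p.1) * (k * toMat p.2)) (by
      rw [Matrix.det_mul, Matrix.det_mul]
      exact mul_pos (OrientedAtlas.det_pos _ _ _ hx hx') (mul_pos hk (det_toMat_pos hb)))
  refine ⟨f, e, fun c' hc' => ?_⟩
  rw [Frame.matIn, hf, ← mul_assoc, jacMat_mul _ _ _ hx hx' hc']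

/-- Charts of `Σ`: near the class of a frame with component matrix `k` in the chart `c`, a point of
`Σ` is represented by a unique frame with component matrix `k b`, `b` lower triangular of positive
diagonal. -/
def tetradChart (c : atlas E4 X) (k : {k : Mat4 // 0 < k.det}) [OrientedAtlas X] :
    PartialEquiv (Tetrads X) (E4 × LowTri) where
  toFun σ := (c.1 σ.pt, fibreCoord c k.1 σ)
  invFun p := fibrePoint c k.1 p
  source := {σ | σ.pt ∈ c.1.source ∧ fibreCell c k.1 σ}
  target := {p | p.1 ∈ c.1.target ∧ PosDiag p.2}
  map_source' := by
    intro σ hσ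
    obtain ⟨x, f, rfl⟩ := σ.exists_rep
    obtain ⟨hx, hc⟩ := hσ
    exact ⟨c.1.map_source hx, posDiag_cholLT (inCell_iff.mp ((fibreCell_toTetrads _ _ _).mp hc))⟩
  map_target' := by
    rintro p ⟨hu, hb⟩
    have hx : c.1.symm p.1 ∈ c.1.source := c.1.map_target hu
    have hk : IsUnit k.1.det := k.2.ne'.isUnit
    obtain ⟨f, e, hf⟩ := fibrePoint_exists c k.2 hu hb
    rw [e]
    refine ⟨hx, (fibreCell_toTetrads _ _ _).mpr ?_⟩
    rw [hf c hx, jacMat_self _ hx, one_mul, Matrix.nonsing_inv_mul_cancel_left _ _ hk]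
    exact ⟨p.2, hb, 1, .one, by rw [mul_one]⟩
  left_inv' := by
    intro σ hσ
    obtain ⟨x, f, rfl⟩ := σ.exists_rep
    obtain ⟨hx, hc⟩ := hσ
    replace hx : x ∈ c.1.source := hx
    have hx' : x ∈ (achart E4 x).1.source := mem_chart_source E4 x
    have hk : IsUnit k.1.det := k.2.ne'.isUnit
    obtain ⟨l, hl, e⟩ := ((fibreCell_toTetrads _ _ _).mp hc).exists_lorentz
    have key : jacMat c (achart E4 x) x * (k.1 * toMat (cholLT (k.1⁻¹ * f.matIn c)))
        = f.mat * l := by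
      rw [e, mul_assoc, Matrix.mul_nonsing_inv_cancel_left _ _ hk, Frame.matIn,
        mul_assoc, ← mul_assoc (jacMat _ _ _), jacMat_mul _ _ _ hx' hx hx', jacMat_self _ hx',
        one_mul]
    have hinv : c.1.symm (c.1 x) = x := c.1.left_inv hx
    change ofMat (c.1.symm (c.1 x)) (jacMat c (achart E4 (c.1.symm (c.1 x))) (c.1.symm (c.1 x)) *
      (k.1 * toMat (cholLT (k.1⁻¹ * f.matIn c)))) = f.toTetrads
    rw [hinv, key]
    obtain ⟨f', hf', e'⟩ := ofMat_exists x (m := f.mat * l) (by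
      rw [Matrix.det_mul, hl.det_eq, mul_one]; exact f.pos)
    rw [e', toTetrads_eq hl hf']
  right_inv' := by
    rintro p ⟨hu, hb⟩
    have hx : c.1.symm p.1 ∈ c.1.source := c.1.map_target hu
    have hk : IsUnit k.1.det := k.2.ne'.isUnit
    obtain ⟨f, e, hf⟩ := fibrePoint_exists c k.2 hu hb
    rw [e, fibreCoord_toTetrads, hf c hx, jacMat_self _ hx, one_mul,
      Matrix.nonsing_inv_mul_cancel_left _ _ hk, cholLT_toMat hb]
    exact Prod.ext (c.1.right_inv hu) rfl

/-- The matrix governing a change of charts of `Σ`. -/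
def transMat (c c' : atlas E4 X) (k k' : {k : Mat4 // 0 < k.det}) (p : E4 × LowTri) : Mat4 :=
  k'.1⁻¹ * (jacMat c c' (c.1.symm p.1) * (k.1 * toMat p.2))

variable [OrientedAtlas X]

lemma transition_mem (c c' : atlas E4 X) (k k' : {k : Mat4 // 0 < k.det}) (p : E4 × LowTri) :
    p ∈ ((tetradChart c k).symm.trans (tetradChart c' k')).source ↔
      (p.1 ∈ c.1.target ∧ PosDiag p.2) ∧ c.1.symm p.1 ∈ c'.1.source ∧
        InCell (transMat c c' k k' p) := by
  rw [PartialEquiv.trans_source]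
  change (p.1 ∈ c.1.target ∧ PosDiag p.2) ∧ ((fibrePoint c k.1 p).pt ∈ c'.1.source ∧
    fibreCell c' k'.1 (fibrePoint c k.1 p)) ↔ _
  refine and_congr_right fun ⟨hu, hb⟩ => ?_
  obtain ⟨f, e, hf⟩ := fibrePoint_exists c k.2 hu hb
  rw [e]
  refine and_congr_right fun hx' => ?_
  rw [fibreCell_toTetrads, hf c' hx', transMat]

lemma transition_apply (c c' : atlas E4 X) (k k' : {k : Mat4 // 0 < k.det}) (p : E4 × LowTri)
    (hp : p ∈ ((tetradChart c k).symm.trans (tetradChart c' k')).source) :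
    (tetradChart c k).symm.trans (tetradChart c' k') p =
      (c'.1 (c.1.symm p.1), cholLT (transMat c c' k k' p)) := by
  obtain ⟨⟨hu, hb⟩, hx', hc⟩ := (transition_mem c c' k k' p).mp hp
  change (c'.1 (fibrePoint c k.1 p).pt, fibreCoord c' k'.1 (fibrePoint c k.1 p)) = _
  obtain ⟨f, e, hf⟩ := fibrePoint_exists c k.2 hu hb
  rw [e, fibreCoord_toTetrads, hf c' hx', transMat]
  rfl

lemma contDiffAt_mat_mul {F : Type*} [NormedAddCommGroup F] [NormedSpace ℝ F] {f g : F → Mat4}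
    {x : F} (hf : ∀ i j, ContDiffAt ℝ ∞ (fun y => f y i j) x)
    (hg : ∀ i j, ContDiffAt ℝ ∞ (fun y => g y i j) x) (i j : Fin 4) :
    ContDiffAt ℝ ∞ (fun y => (f y * g y) i j) x := by
  simp only [Matrix.mul_apply]
  exact ContDiffAt.sum fun k _ => (hf i k).mul (hg k j)

lemma transMat_smooth (c c' : atlas E4 X) (k k' : {k : Mat4 // 0 < k.det}) {p : E4 × LowTri}
    (hp : p.1 ∈ c.1.target) (hp' : c.1.symm p.1 ∈ c'.1.source) (i j : Fin 4) :
    ContDiffAt ℝ ∞ (fun y => transMat c c' k k' y i j) p := by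
  have hj : ∀ a b, ContDiffAt ℝ ∞ (fun y : E4 × LowTri => jacMat c c' (c.1.symm y.1) a b) p :=
    fun a b => ContDiffAt.comp (g := fun y => jacMat c c' (c.1.symm y) a b) (f := Prod.fst) p
      (jacMat_smooth c c' hp hp' a b) contDiffAt_fst
  have ht : ∀ a b, ContDiffAt ℝ ∞ (fun y : E4 × LowTri => toMat y.2 a b) p := by
    intro a b
    by_cases h : b ≤ a
    · simp only [toMat, Matrix.of_apply, dif_pos h]
      exact ((contDiff_apply ℝ ℝ (⟨(a, b), h⟩ : {p : Fin 4 × Fin 4 // p.2 ≤ p.1})).comp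
        contDiff_snd).contDiffAt
    · simp only [toMat, Matrix.of_apply, dif_neg h]
      exact contDiffAt_const
  have hk := contDiffAt_mat_mul (f := fun _ : E4 × LowTri => k.1) (fun _ _ => contDiffAt_const) ht
  have hk' := contDiffAt_mat_mul hj hk
  exact contDiffAt_mat_mul (f := fun _ : E4 × LowTri => k'.1⁻¹) (fun _ _ => contDiffAt_const) hk' i j

lemma transition_open (c c' : atlas E4 X) (k k' : {k : Mat4 // 0 < k.det}) :
    IsOpen ((tetradChart c k).symm.trans (tetradChart c' k')).source := by
  rw [isOpen_iff_mem_nhds]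
  intro p hp
  obtain ⟨⟨hu, hb⟩, hx', hc⟩ := (transition_mem c c' k k' p).mp hp
  have h1 : ∀ᶠ y in 𝓝 p, y.1 ∈ (c.1.symm ≫ₕ c'.1).source :=
    continuousAt_fst.eventually ((c.1.symm ≫ₕ c'.1).open_source.mem_nhds (by
      rw [OpenPartialHomeomorph.trans_source]; exact ⟨hu, hx'⟩))
  have h2 : ∀ᶠ y : E4 × LowTri in 𝓝 p, PosDiag y.2 := by
    refine Filter.eventually_all.mpr fun i => ?_
    have : Continuous fun y : E4 × LowTri => y.2 ⟨(i, i), le_rfl⟩ :=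
      (continuous_apply _).comp continuous_snd
    exact this.continuousAt.eventually (lt_mem_nhds (hb i))
  filter_upwards [h1, h2, eventually_inCell (transMat_smooth c c' k k' hu hx') hc] with y a1 a2 a3
  rw [OpenPartialHomeomorph.trans_source] at a1
  exact (transition_mem c c' k k' y).mpr ⟨⟨a1.1, a2⟩, a1.2, a3⟩

lemma transition_smooth (c c' : atlas E4 X) (k k' : {k : Mat4 // 0 < k.det}) :
    ContDiffOn ℝ ∞ ((tetradChart c k).symm.trans (tetradChart c' k'))
      ((tetradChart c k).symm.trans (tetradChart c' k')).source := by
  refine ContDiffOn.congr (f := fun p => (c'.1 (c.1.symm p.1), cholLT (transMat c c' k k' p)))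
    (fun p hp => ?_) (fun p hp => transition_apply c c' k k' p hp)
  obtain ⟨⟨hu, hb⟩, hx', hc⟩ := (transition_mem c c' k k' p).mp hp
  refine ContDiffAt.contDiffWithinAt (ContDiffAt.prodMk ?_
    (cholLT_smooth (transMat_smooth c c' k k' hu hx') hc))
  have hmem : p.1 ∈ (c.1.symm ≫ₕ c'.1).source := by
    rw [OpenPartialHomeomorph.trans_source]; exact ⟨hu, hx'⟩
  have h : ContDiffWithinAt ℝ ∞ (c'.1.extend 𝓘(ℝ, E4) ∘ (c.1.extend 𝓘(ℝ, E4)).symm)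
      (range 𝓘(ℝ, E4)) (c.1.extend 𝓘(ℝ, E4) (c.1.symm p.1)) :=
    𝓘(ℝ, E4).contDiffWithinAt_extendCoordChange' (IsManifold.subset_maximalAtlas c.2)
      (IsManifold.subset_maximalAtlas c'.2) (c.1.map_target hu) hx'
  simp only [mfld_simps, contDiffWithinAt_univ, c.1.right_inv hu] at h
  exact ContDiffAt.comp (g := fun y => c'.1 (c.1.symm y)) (f := Prod.fst) p h contDiffAt_fst

variable (X) in
/-- The manifold structure of `Σ = LX/L`. -/
def tetradCore : ChartedSpaceCore (E4 × LowTri) (Tetrads X) where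
  atlas := range fun q : atlas E4 X × {k : Mat4 // 0 < k.det} => tetradChart q.1 q.2
  chartAt σ := tetradChart (achart E4 σ.pt) ⟨σ.cls.out.mat, σ.cls.out.pos⟩
  mem_chart_source σ := by
    have hx := mem_chart_source E4 σ.pt
    refine ⟨hx, σ.cls.out, σ.cls.out_eq, ?_⟩
    have hk : IsUnit (σ.cls.out.mat).det := (σ.cls.out.pos).ne'.isUnit
    rw [Frame.matIn, jacMat_self _ hx, one_mul, Matrix.nonsing_inv_mul _ hk]
    exact inCell_one
  chart_mem_atlas σ := ⟨(_, _), rfl⟩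
  open_source := by
    rintro _ _ ⟨⟨c, k⟩, rfl⟩ ⟨⟨c', k'⟩, rfl⟩
    exact transition_open c c' k k'
  continuousOn_toFun := by
    rintro _ _ ⟨⟨c, k⟩, rfl⟩ ⟨⟨c', k'⟩, rfl⟩
    exact (transition_smooth c c' k k').continuousOn

instance : TopologicalSpace (Tetrads X) := (tetradCore X).toTopologicalSpace

instance : ChartedSpace (E4 × LowTri) (Tetrads X) := (tetradCore X).toChartedSpace

instance : IsManifold 𝓘(ℝ, E4 × LowTri) ∞ (Tetrads X) := by
  apply isManifold_of_contDiffOn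
  intro e e' he he'
  obtain ⟨a, ha⟩ := mem_iUnion.mp he
  obtain ⟨⟨⟨c, k⟩, rfl⟩, h⟩ := mem_iUnion.mp ha
  obtain rfl := h
  obtain ⟨a', ha'⟩ := mem_iUnion.mp he'
  obtain ⟨⟨⟨c', k'⟩, rfl⟩, h'⟩ := mem_iUnion.mp ha'
  obtain rfl := h'
  refine (transition_smooth c c' k k').mono ?_
  rintro p ⟨hp, -⟩
  exact hp

end manifold

/-! ### Spinors -/

/-- The Minkowski quadratic form on `M = ℝ⁴`. -/
def minkQ : QuadraticForm ℝ (Fin 4 → ℝ) := QuadraticMap.weightedSumSquares ℝ sgn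

/-- The real Clifford algebra of Minkowski space: `e e' + e' e = 2 η(e, e')`. -/
abbrev Cl := CliffordAlgebra minkQ

/-- The complex Clifford algebra `ℂ₁,₃`. -/
abbrev CCl := ℂ ⊗[ℝ] Cl

/-- A spinor space: the complex vector space `V` is (identified with) a minimal left ideal of the
complex Clifford algebra. -/
structure SpinorSpace (V : Type*) [NormedAddCommGroup V] [NormedSpace ℂ V] where
  ideal : Ideal CCl
  minimal : IsAtom ideal
  iso : V ≃ₗ[ℂ] ideal

namespace SpinorSpace

variable {V : Type*} [NormedAddCommGroup V] [NormedSpace ℂ V] [FiniteDimensional ℂ V]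
  (𝒮 : SpinorSpace V)

/-- Left multiplication by elements of the real Clifford algebra on spinors. -/
def act (a : Cl) : V →L[ℝ] V := LinearMap.toContinuousLinearMap
  { toFun := fun v => 𝒮.iso.symm (((1 : ℂ) ⊗ₜ[ℝ] a : CCl) • 𝒮.iso v)
    map_add' := fun v w => by simp
    map_smul' := fun r v => by
      have h2 : ∀ w : V, (r • w : V) = (r : ℂ) • w := fun w => (Complex.coe_smul r w).symm
      rw [RingHom.id_apply, h2, h2, LinearEquiv.map_smul 𝒮.iso,
        ← LinearEquiv.map_smul 𝒮.iso.symm]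
      exact congrArg 𝒮.iso.symm (Subtype.ext (mul_smul_comm (r : ℂ) _ _)) }

lemma act_apply (a : Cl) (v : V) :
    𝒮.act a v = 𝒮.iso.symm (((1 : ℂ) ⊗ₜ[ℝ] a : CCl) • 𝒮.iso v) := rfl

lemma act_one : 𝒮.act 1 = ContinuousLinearMap.id ℝ V := by
  ext v
  rw [act_apply, ← Algebra.TensorProduct.one_def, one_smul]
  simp

lemma act_mul (a b : Cl) (v : V) : 𝒮.act (a * b) v = 𝒮.act a (𝒮.act b v) := by
  simp only [act_apply, LinearEquiv.apply_symm_apply]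
  have h : ((1 : ℂ) ⊗ₜ[ℝ] (a * b) : CCl) = (1 : ℂ) ⊗ₜ[ℝ] a * (1 : ℂ) ⊗ₜ[ℝ] b := by
    rw [Algebra.TensorProduct.tmul_mul_tmul, one_mul]
  rw [h]
  exact congrArg 𝒮.iso.symm (Subtype.ext (mul_assoc _ _ _))

/-- The action as a linear map. -/
def actHom : Cl →ₗ[ℝ] (V →L[ℝ] V) where
  toFun := 𝒮.act
  map_add' a b := by
    ext v
    simp [act_apply, TensorProduct.tmul_add, add_smul]
  map_smul' r a := by
    ext v
    have h2 : ∀ w : V, (r • w : V) = (r : ℂ) • w := fun w => (Complex.coe_smul r w).symm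
    have h3 : ((1 : ℂ) ⊗ₜ[ℝ] (r • a) : CCl) = (r : ℂ) • ((1 : ℂ) ⊗ₜ[ℝ] a : CCl) := by
      rw [TensorProduct.smul_tmul', smul_eq_mul, mul_one, ← TensorProduct.smul_tmul]
      simp
    rw [RingHom.id_apply, smul_apply, act_apply, act_apply, h2,
      ← LinearEquiv.map_smul 𝒮.iso.symm, h3]
    exact congrArg 𝒮.iso.symm (Subtype.ext (smul_mul_assoc (r : ℂ) _ _))

/-- The Dirac matrix `γ^a`, the action of the basis vector `e^a` of Minkowski space. -/
def gamma (a : Fin 4) : V →L[ℝ] V := 𝒮.act (CliffordAlgebra.ι minkQ (Pi.single a 1))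

/-- The Dirac matrix `γ_a = η_{ab} γ^b`. -/
def gammaLow (a : Fin 4) : V →L[ℝ] V := sgn a • 𝒮.gamma a

/-- The spin generator `I_{ab} = ¼ [γ_a, γ_b]`. -/
def gen (a b : Fin 4) : V →L[ℝ] V :=
  (1 / 4 : ℝ) • (𝒮.gammaLow a ∘L 𝒮.gammaLow b - 𝒮.gammaLow b ∘L 𝒮.gammaLow a)

end SpinorSpace

/-! ### The spinor lift of the bundle of frames and the composite spinor bundle -/

section lift

variable (X : Type*) [TopologicalSpace X] [ChartedSpace E4 X] [IsManifold 𝓘(ℝ, E4) ∞ X]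
  [OrientedAtlas X]

/-- An `L_s`-principal lift `P_Σ` of the `L`-principal bundle `LX → Σ`, given by its bundle atlas:
smooth local sections `z_i` of `LX → Σ` over an open cover of `Σ`, and a smooth cocycle with values
in `L_s = Spin⁺(1,3) = SL(2,ℂ)` (realized in the Clifford algebra) which covers the
`L`-valued transition functions `z_j⁻¹ z_i`. The last condition says that conjugation by the spin
cocycle is the induced change of the components `α(z_{i,a})` of covectors `α`. -/
structure SpinLift (ι : Type*) where
  baseSet : ι → Set (Tetrads X)
  isOpen_baseSet : ∀ i, IsOpen (baseSet i)
  indexAt : Tetrads X → ι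
  mem_baseSet_at : ∀ σ, σ ∈ baseSet (indexAt σ)
  frame : ι → ∀ σ : Tetrads X, Frame σ.pt
  frame_section : ∀ i, ∀ σ ∈ baseSet i, (frame i σ).toTetrads = σ
  frame_smooth : ∀ i a, ContMDiffOn 𝓘(ℝ, E4 × LowTri) 𝓘(ℝ, E4).tangent ∞
    (fun σ => (⟨σ.pt, (frame i σ).vec a⟩ : TangentBundle 𝓘(ℝ, E4) X)) (baseSet i)
  trans : ι → ι → Tetrads X → Cl
  trans_mem : ∀ i j, ∀ σ ∈ baseSet i ∩ baseSet j, trans i j σ ∈ spinGroup minkQ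
  trans_smooth : ∀ i j (φ : Cl →ₗ[ℝ] ℝ), ContMDiffOn 𝓘(ℝ, E4 × LowTri) 𝓘(ℝ, ℝ) ∞
    (fun σ => φ (trans i j σ)) (baseSet i ∩ baseSet j)
  trans_comp : ∀ i j k, ∀ σ ∈ baseSet i ∩ baseSet j ∩ baseSet k,
    trans j k σ * trans i j σ = trans i k σ
  trans_covers : ∀ i j, ∀ σ ∈ baseSet i ∩ baseSet j, ∀ α : E4 →L[ℝ] ℝ,
    trans i j σ * CliffordAlgebra.ι minkQ (fun a => α ((frame i σ).vec a)) =
      CliffordAlgebra.ι minkQ (fun a => α ((frame j σ).vec a)) * trans i j σ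

end lift

section bundle

variable {X : Type*} [TopologicalSpace X] [ChartedSpace E4 X] [IsManifold 𝓘(ℝ, E4) ∞ X]
  [OrientedAtlas X] {ι : Type*} (P : SpinLift X ι)
  {V : Type*} [NormedAddCommGroup V] [NormedSpace ℂ V] [FiniteDimensional ℂ V]
  (𝒮 : SpinorSpace V)

lemma SpinLift.trans_self (i : ι) (σ : Tetrads X) (hσ : σ ∈ P.baseSet i) :
    P.trans i i σ = 1 := by
  have h := P.trans_comp i i i σ ⟨⟨hσ, hσ⟩, hσ⟩
  have hm := P.trans_mem i i σ ⟨hσ, hσ⟩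
  have := spinGroup.star_mul_self_of_mem hm
  calc P.trans i i σ = (star (P.trans i i σ) * P.trans i i σ) * P.trans i i σ := by
        rw [this, one_mul]
    _ = 1 := by rw [mul_assoc, h, this]

lemma SpinLift.act_smooth (i j : ι) : ContMDiffOn 𝓘(ℝ, E4 × LowTri) 𝓘(ℝ, V →L[ℝ] V) ∞
    (fun σ => 𝒮.act (P.trans i j σ)) (P.baseSet i ∩ P.baseSet j) := by
  let b := Module.finBasis ℝ (V →L[ℝ] V)
  have h : (fun σ => 𝒮.act (P.trans i j σ)) =
      fun σ => ∑ k, ((b.coord k).comp 𝒮.actHom) (P.trans i j σ) • b k := by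
    funext σ
    exact (b.sum_repr _).symm
  rw [h]
  refine contMDiffOn_finsetSum fun k _ => ?_
  exact (P.trans_smooth i j ((b.coord k).comp 𝒮.actHom)).smul contMDiffOn_const

/-- The spinor bundle `S_Σ = (P_Σ × V)/L_s → Σ`, glued from `U_i × V` by the spin cocycle. -/
def SpinLift.core : VectorBundleCore ℝ (Tetrads X) V ι where
  baseSet := P.baseSet
  isOpen_baseSet := P.isOpen_baseSet
  indexAt := P.indexAt
  mem_baseSet_at := P.mem_baseSet_at
  coordChange i j σ := 𝒮.act (P.trans i j σ)
  coordChange_self i σ hσ v := by rw [P.trans_self i σ hσ, 𝒮.act_one]; rfl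
  continuousOn_coordChange i j := (P.act_smooth 𝒮 i j).continuousOn
  coordChange_comp i j k σ hσ v := by rw [← 𝒮.act_mul, P.trans_comp i j k σ hσ]

instance : (P.core 𝒮).IsContMDiff 𝓘(ℝ, E4 × LowTri) ∞ := ⟨P.act_smooth 𝒮⟩

/-- The total space `S` of the composite spinor bundle `S → Σ → X`. -/
abbrev SpinLift.S : Type _ := TotalSpace V (P.core 𝒮).Fiber

/-- The projection `S → Σ`. -/
abbrev SpinLift.projS : P.S 𝒮 → Tetrads X := TotalSpace.proj

/-- The projection `S → X`. -/
abbrev SpinLift.projX : P.S 𝒮 → X := fun y => y.proj.pt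

/-- The fibre coordinate `S ⊇ S|_{U_i} → V` (components `y^A`) of the bundle atlas. -/
def SpinLift.fib (i : ι) (y : P.S 𝒮) : V := ((P.core 𝒮).localTriv i y).2

/-- The morphism `γ_Σ : T*X ⊗ S_Σ → S_Σ` over `Σ`, given in the bundle atlas by
`h^a ⊗ y ↦ γ^a y`, where `h^a` is the coframe dual to the frame `z_i(σ)`. -/
def SpinLift.gammaSigma (σ : Tetrads X) (α : TangentSpace 𝓘(ℝ, E4) σ.pt →L[ℝ] ℝ)
    (u : (P.core 𝒮).Fiber σ) : (P.core 𝒮).Fiber σ :=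
  ((P.core 𝒮).localTriv (P.indexAt σ)).symm σ
    (∑ a, α ((P.frame (P.indexAt σ) σ).vec a) •
      𝒮.gamma a (P.fib 𝒮 (P.indexAt σ) ⟨σ, u⟩))

end bundle

/-! ### Jets, connections and covariant differentials on fibred manifolds -/

section jets

variable {EX : Type*} [NormedAddCommGroup EX] [NormedSpace ℝ EX] {HX : Type*} [TopologicalSpace HX]
  (IX : ModelWithCorners ℝ EX HX) {X : Type*} [TopologicalSpace X] [ChartedSpace HX X]
  {EY : Type*} [NormedAddCommGroup EY] [NormedSpace ℝ EY] {HY : Type*} [TopologicalSpace HY]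
  (IY : ModelWithCorners ℝ EY HY) {Y : Type*} [TopologicalSpace Y] [ChartedSpace HY Y]

/-- The fibre over `y` of the first jet manifold `J¹Y → Y` of a fibred manifold `p : Y → X`,
embedded in `T*X ⊗ TY`: a jet `j¹_x s` with `s(x) = y` is the tangent map of `s` at `x`. -/
def Jet1 (p : Y → X) (y : Y) : Type _ :=
  {φ : TangentSpace IX (p y) →L[ℝ] TangentSpace IY y //
    (mfderiv IY IX p y).comp φ = ContinuousLinearMap.id ℝ (TangentSpace IX (p y))}

/-- The fibre at `y` of the vertical tangent bundle `VY` of `p : Y → X`. -/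
def Vert (p : Y → X) (y : Y) : Submodule ℝ (TangentSpace IY y) :=
  LinearMap.ker (mfderiv IY IX p y).toLinearMap

/-- A smooth connection on the fibred manifold `p : Y → X`: a smooth section of `J¹Y → Y`. -/
structure Conn [IsManifold IX 1 X] [IsManifold IY 1 Y] (p : Y → X) where
  jet : ∀ y, Jet1 IX IY p y
  smooth : ∀ y₀, ContMDiffAt IY 𝓘(ℝ, EX →L[ℝ] EY) ∞
    (inTangentCoordinates IX IY p id (fun y => (jet y).1) y₀) y₀

variable {IX IY} [IsManifold IX 1 X] [IsManifold IY 1 Y] {p : Y → X}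

/-- The covariant differential `D_Γ : J¹Y → T*X ⊗ VY` relative to a connection. -/
def covDiff (Γ : Conn IX IY p) {y : Y} (φ : Jet1 IX IY p y) :
    TangentSpace IX (p y) →ₗ[ℝ] Vert IX IY p y :=
  LinearMap.codRestrict _ (φ.1 - (Γ.jet y).1).toLinearMap fun v => by
    have h1 := congrArg (fun T => T v) φ.2
    have h2 := congrArg (fun T => T v) (Γ.jet y).2
    change (mfderiv IY IX p y) ((φ.1 - (Γ.jet y).1) v) = 0
    rw [sub_apply, map_sub]
    exact sub_eq_zero.mpr (h1.trans h2.symm)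

variable {EB : Type*} [NormedAddCommGroup EB] [NormedSpace ℝ EB] {HB : Type*} [TopologicalSpace HB]
  {IB : ModelWithCorners ℝ EB HB} {B : Type*} [TopologicalSpace B] [ChartedSpace HB B]
  [IsManifold IB 1 B] {q : Y → B} {r : B → X}

/-- The projection `TY → VY_B`, `w ↦ w - A(Tq w)` defined by a connection `A` on `q : Y → B`. On the
vertical tangent bundle `VY` of `Y → X` it is the first projection of the horizontal
splitting `VY = VY_B ⊕ (Y ×_B VB)`. -/
def vertProj (A : Conn IB IY q) (y : Y) : TangentSpace IY y →ₗ[ℝ] Vert IB IY q y :=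
  LinearMap.codRestrict _
    (ContinuousLinearMap.id ℝ (TangentSpace IY y) -
      (A.jet y).1.comp (mfderiv IY IB q y)).toLinearMap fun w => by
    have h := congrArg (fun T => T (mfderiv IY IB q y w)) (A.jet y).2
    change (mfderiv IY IB q y) (w - (A.jet y).1 (mfderiv IY IB q y w)) = 0
    rw [map_sub]
    exact sub_eq_zero.mpr h.symm

/-- The vertical covariant differential `D̃ : J¹Y → T*X ⊗ VY_B` of a composite fibred manifold
`Y → B → X` defined by a connection on `Y → B`; in coordinates it is
`y^i_λ - Ã^i_λ - A^i_m σ^m_λ`. -/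
def vertCovDiff (A : Conn IB IY q) (r : B → X) {y : Y} (φ : Jet1 IX IY (fun y => r (q y)) y) :
    TangentSpace IX (r (q y)) →ₗ[ℝ] Vert IB IY q y :=
  (vertProj A y).comp φ.1.toLinearMap

end jets

/-! ### The vertical splitting of a vector bundle -/

section vertical

variable {EB : Type*} [NormedAddCommGroup EB] [NormedSpace ℝ EB] {HB : Type*} [TopologicalSpace HB]
  (IB : ModelWithCorners ℝ EB HB) {B : Type*} [TopologicalSpace B] [ChartedSpace HB B]
  {F : Type*} [NormedAddCommGroup F] [NormedSpace ℝ F] {E : B → Type*}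
  [TopologicalSpace (TotalSpace F E)] [∀ b, TopologicalSpace (E b)] [∀ b, AddCommMonoid (E b)]
  [∀ b, Module ℝ (E b)] [FiberBundle F E] [VectorBundle ℝ F E]

/-- The vertical lift: the velocity at `y` of the line `t ↦ y + t u` in the fibre of `y`. -/
def vertLift (y : TotalSpace F E) (u : E y.proj) :
    Vert IB (IB.prod 𝓘(ℝ, F)) (TotalSpace.proj : TotalSpace F E → B) y :=
  ⟨mfderiv 𝓘(ℝ, ℝ) (IB.prod 𝓘(ℝ, F))
    (fun t : ℝ => (⟨y.proj, y.2 + t • u⟩ : TotalSpace F E)) 0 (1 : ℝ), by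
    set c := fun t : ℝ => (⟨y.proj, y.2 + t • u⟩ : TotalSpace F E) with hc
    have hc0 : c 0 = y := by simp [hc]
    change (mfderiv (IB.prod 𝓘(ℝ, F)) IB (TotalSpace.proj : TotalSpace F E → B) y)
      (mfderiv 𝓘(ℝ, ℝ) (IB.prod 𝓘(ℝ, F)) c 0 (1 : ℝ)) = 0
    by_cases hd : MDifferentiableAt 𝓘(ℝ, ℝ) (IB.prod 𝓘(ℝ, F)) c 0
    · have hp : MDifferentiableAt (IB.prod 𝓘(ℝ, F)) IB (TotalSpace.proj : TotalSpace F E → B)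
          (c 0) := (contMDiffAt_proj E (n := 1)).mdifferentiableAt one_ne_zero
      have h := mfderiv_comp (0 : ℝ) hp hd
      have h2 : (TotalSpace.proj : TotalSpace F E → B) ∘ c = fun _ => y.proj := rfl
      rw [h2, mfderiv_const] at h
      have h3 := congrArg (fun T => T (1 : ℝ)) h
      rw [hc0] at h3
      exact h3.symm
    · rw [mfderiv_zero_of_not_mdifferentiableAt hd]
      exact map_zero _⟩

/-- The inverse `VE → E` of the vertical lift: the derivative of the fibre coordinate, read back in
the fibre. -/
def vertCoord (y : TotalSpace F E)
    (w : Vert IB (IB.prod 𝓘(ℝ, F)) (TotalSpace.proj : TotalSpace F E → B) y) : E y.proj :=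
  (trivializationAt F E y.proj).symm y.proj
    (mfderiv (IB.prod 𝓘(ℝ, F)) 𝓘(ℝ, F)
      (fun p : TotalSpace F E => (trivializationAt F E y.proj p).2) y w.1)

/-- The morphism `T*X ⊗ VE → VE` induced through the vertical splitting `VE = E ×_B E` by a morphism
`γ : T*X ⊗ E → E`: it sends `Φ = dx^μ ⊗ Φ_μ` to `γ(dx^μ) Φ_μ`. -/
def gammaVert (y : TotalSpace F E) (γ : (E4 →L[ℝ] ℝ) → E y.proj → E y.proj)
    (Φ : E4 →ₗ[ℝ] Vert IB (IB.prod 𝓘(ℝ, F)) (TotalSpace.proj : TotalSpace F E → B) y) :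
    Vert IB (IB.prod 𝓘(ℝ, F)) (TotalSpace.proj : TotalSpace F E → B) y :=
  vertLift IB y (∑ μ, γ (EuclideanSpace.proj μ)
    (vertCoord IB y (Φ (EuclideanSpace.single μ 1))))

end vertical

section dirac

variable {X : Type*} [TopologicalSpace X] [ChartedSpace E4 X] [IsManifold 𝓘(ℝ, E4) ∞ X]
  [OrientedAtlas X] {ι : Type*} (P : SpinLift X ι)
  {V : Type*} [NormedAddCommGroup V] [NormedSpace ℂ V] [FiniteDimensional ℂ V]
  (𝒮 : SpinorSpace V)

/-! ### The total Dirac operator and the Dirac operators -/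

/-- Connections on the bundle `S → Σ`. -/
abbrev SpinLift.ConnS := Conn 𝓘(ℝ, E4 × LowTri) (𝓘(ℝ, E4 × LowTri).prod 𝓘(ℝ, V)) (P.projS 𝒮)

/-- The fibre of `J¹S → S`, where `S` is fibred over `X`. -/
abbrev SpinLift.JetS := Jet1 𝓘(ℝ, E4) (𝓘(ℝ, E4 × LowTri).prod 𝓘(ℝ, V)) (P.projX 𝒮)

/-- The fibre of `VS_Σ → S`, vectors which are vertical for `S → Σ`. -/
abbrev SpinLift.VertS := Vert 𝓘(ℝ, E4 × LowTri) (𝓘(ℝ, E4 × LowTri).prod 𝓘(ℝ, V)) (P.projS 𝒮)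

/-- The total Dirac operator `𝒟 = γ_Σ ∘ D̃ : J¹S → VS_Σ`. -/
def SpinLift.totalDirac (A : P.ConnS 𝒮) (y : P.S 𝒮) (φ : P.JetS 𝒮 y) : P.VertS 𝒮 y :=
  gammaVert 𝓘(ℝ, E4 × LowTri) y (P.gammaSigma 𝒮 y.proj) (vertCovDiff A Tetrads.pt φ)

variable (X) in
/-- Smooth maps `X → Σ`. -/
abbrev TetradMap := C^∞⟮𝓘(ℝ, E4), X; 𝓘(ℝ, E4 × LowTri), Tetrads X⟯

/-- The fibres of the spinor bundle `S_h = h^* S_Σ → X`. -/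
abbrev SpinLift.FibH (h : TetradMap X) : X → Type _ := (h : X → Tetrads X) *ᵖ (P.core 𝒮).Fiber

/-- The total space of the spinor bundle `S_h`. -/
abbrev SpinLift.SH (h : TetradMap X) : Type _ := TotalSpace V (P.FibH 𝒮 h)

/-- The projection `S_h → X`. -/
abbrev SpinLift.projH (h : TetradMap X) : P.SH 𝒮 h → X := TotalSpace.proj

/-- The inclusion `i_h : S_h → S` onto the restriction of `S` to `h(X)`. -/
abbrev SpinLift.incl (h : TetradMap X) : P.SH 𝒮 h → P.S 𝒮 := Pullback.lift (h : X → Tetrads X)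

/-- The tangent map of `i_h`. -/
abbrev SpinLift.tincl (h : TetradMap X) (y : P.SH 𝒮 h) :=
  mfderiv (𝓘(ℝ, E4).prod 𝓘(ℝ, V)) (𝓘(ℝ, E4 × LowTri).prod 𝓘(ℝ, V)) (P.incl 𝒮 h) y

/-- Connections on the spinor bundle `S_h → X`. -/
abbrev SpinLift.ConnH (h : TetradMap X) :=
  Conn 𝓘(ℝ, E4) (𝓘(ℝ, E4).prod 𝓘(ℝ, V)) (P.projH 𝒮 h)

/-- The fibre of `J¹S_h → S_h`. -/
abbrev SpinLift.JetH (h : TetradMap X) := Jet1 𝓘(ℝ, E4) (𝓘(ℝ, E4).prod 𝓘(ℝ, V)) (P.projH 𝒮 h)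

/-- The fibre of `VS_h → S_h`. -/
abbrev SpinLift.VertH (h : TetradMap X) := Vert 𝓘(ℝ, E4) (𝓘(ℝ, E4).prod 𝓘(ℝ, V)) (P.projH 𝒮 h)

/-- The representation `γ_h : T*X ⊗ S_h → S_h`, the restriction of `γ_Σ` to `h(X)`. -/
def SpinLift.gammaH (h : TetradMap X) (x : X) (α : TangentSpace 𝓘(ℝ, E4) x →L[ℝ] ℝ)
    (u : P.FibH 𝒮 h x) : P.FibH 𝒮 h x := P.gammaSigma 𝒮 (h x) α u

/-- The Dirac operator `𝒟_h = γ_h ∘ D : J¹S_h → VS_h` relative to a connection on `S_h`. -/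
def SpinLift.diracH (h : TetradMap X) (B : P.ConnH 𝒮 h) (y : P.SH 𝒮 h) (ψ : P.JetH 𝒮 h y) :
    P.VertH 𝒮 h y :=
  gammaVert 𝓘(ℝ, E4) y (P.gammaH 𝒮 h y.proj) (covDiff B ψ)

/-- The connection `B` on `S_h` is induced by the connection `A` on `S → Σ`: the horizontal
subspaces of `B` are mapped by `T i_h` to horizontal lifts of vectors tangent to `h(X)`. -/
def SpinLift.IsInduced (A : P.ConnS 𝒮) (h : TetradMap X) (B : P.ConnH 𝒮 h) : Prop :=
  ∀ (y : P.SH 𝒮 h) (v : TangentSpace 𝓘(ℝ, E4) y.proj),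
    P.tincl 𝒮 h y ((B.jet y).1 v) =
      (A.jet (P.incl 𝒮 h y)).1 (mfderiv 𝓘(ℝ, E4) 𝓘(ℝ, E4 × LowTri) h y.proj v)

/-- The differentials `dy^A` of the fibre coordinates of `S → Σ`. -/
def SpinLift.dfib (i : ι) (y : P.S 𝒮) :
    TangentSpace (𝓘(ℝ, E4 × LowTri).prod 𝓘(ℝ, V)) y →L[ℝ] V :=
  mfderiv (𝓘(ℝ, E4 × LowTri).prod 𝓘(ℝ, V)) 𝓘(ℝ, V) (P.fib 𝒮 i) y

end dirac

/-! ### World connections and the metric of a tetrad field -/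

section world

variable {X : Type*} [TopologicalSpace X] [ChartedSpace E4 X] [IsManifold 𝓘(ℝ, E4) ∞ X]

/-- The coordinate vector field `∂_λ` of the chart `c`. -/
def coordField (c : atlas E4 X) (lam : Fin 4) (x : X) : TangentSpace 𝓘(ℝ, E4) x :=
  (tangentBundleCore 𝓘(ℝ, E4) X).coordChange c (achart E4 x) x (EuclideanSpace.single lam 1)

/-- The differential at `x` of a real function on `X`. -/
def dfun (f : X → ℝ) (x : X) : TangentSpace 𝓘(ℝ, E4) x →L[ℝ] ℝ := mfderiv 𝓘(ℝ, E4) 𝓘(ℝ, ℝ) f x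

/-- The differential `dx^μ` at `x` of a coordinate function of the chart `c`. -/
def dcoord (c : atlas E4 X) (μ : Fin 4) (x : X) : TangentSpace 𝓘(ℝ, E4) x →L[ℝ] ℝ :=
  dfun (fun x' => c.1 x' μ) x

/-- Connections on `TX`. -/
abbrev WorldConn (X : Type*) [TopologicalSpace X] [ChartedSpace E4 X]
    [IsManifold 𝓘(ℝ, E4) ∞ X] :=
  CovariantDerivative 𝓘(ℝ, E4) E4 (TangentSpace 𝓘(ℝ, E4) : X → Type _)

/-- The components `K^ν_{λμ}` of a connection on `TX`: `∇_{∂_μ} ∂_λ = K^ν_{λμ} ∂_ν`. -/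
def christoffel (K : WorldConn X) (c : atlas E4 X) (x : X) (ν lam μ : Fin 4) : ℝ :=
  dcoord c ν x (K (coordField c lam) x (coordField c μ x))

variable [OrientedAtlas X]

lemma minkowski_invariant {f f' l : Mat4} (hl : IsLorentz l) (h : f' = f * l)
    (u v : Fin 4 → ℝ) :
    ∑ a, sgn a * (f'⁻¹ *ᵥ u) a * (f'⁻¹ *ᵥ v) a = ∑ a, sgn a * (f⁻¹ *ᵥ u) a * (f⁻¹ *ᵥ v) a := by
  have key : ∀ p q : Fin 4 → ℝ, ∑ a, sgn a * p a * q a = p ⬝ᵥ (eta *ᵥ q) := by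
    intro p q
    simp only [dotProduct, eta, Matrix.mulVec_diagonal]
    exact Finset.sum_congr rfl fun a _ => by ring
  have e : ∀ w, f⁻¹ *ᵥ w = l *ᵥ (f'⁻¹ *ᵥ w) := by
    intro w
    have hdet : IsUnit l.det := by rw [hl.det_eq]; exact isUnit_one
    rw [h, Matrix.mul_inv_rev, Matrix.mulVec_mulVec, ← mul_assoc,
      Matrix.mul_nonsing_inv _ hdet, one_mul]
  have inv : ∀ p q : Fin 4 → ℝ, (l *ᵥ p) ⬝ᵥ (eta *ᵥ (l *ᵥ q)) = p ⬝ᵥ (eta *ᵥ q) := by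
    intro p q
    conv_rhs => rw [← hl.preserves']
    rw [← Matrix.mulVec_mulVec, ← Matrix.mulVec_mulVec, Matrix.dotProduct_mulVec p,
      Matrix.vecMul_transpose]
  rw [key, key, e u, e v, inv]

/-- The Lorentz metric on `T_x X` determined by `σ ∈ Σ_x`, for which the frames in the class `σ`
are pseudo-orthonormal: `η_{ab} σ^a(u) σ^b(v)`. -/
def lorentzForm (σ : Tetrads X) (u v : TangentSpace 𝓘(ℝ, E4) σ.pt) : ℝ :=
  Quotient.lift (fun f : Frame σ.pt =>
    ∑ a, sgn a * (f.mat⁻¹ *ᵥ (u : E4).ofLp) a * (f.mat⁻¹ *ᵥ (v : E4).ofLp) a)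
    (by
      rintro f f' ⟨l, hl, h⟩
      exact (minkowski_invariant hl h _ _).symm) σ.cls

/-- The metric `g_h` on `TX` of a tetrad field `h`. -/
def tetradMetric (h : TetradMap X) (x : X) (u v : TangentSpace 𝓘(ℝ, E4) x) : ℝ :=
  lorentzForm (h x) u v

/-- `(∇_v g_h)(Y, Z)` at `x` for a connection `∇ = K` on `TX`. -/
def derivMetric (K : WorldConn X) (h : TetradMap X) (Y Z : ∀ x : X, TangentSpace 𝓘(ℝ, E4) x)
    (x : X) (v : TangentSpace 𝓘(ℝ, E4) x) : ℝ :=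
  dfun (fun x' => tetradMetric h x' (Y x') (Z x')) x v
    - tetradMetric h x (K Y x v) (Z x) - tetradMetric h x (Y x) (K Z x v)

/-- Differentiability at `x` of a vector field. -/
abbrev MDiffField (Y : ∀ x : X, TangentSpace 𝓘(ℝ, E4) x) (x : X) : Prop :=
  MDifferentiableAt 𝓘(ℝ, E4) 𝓘(ℝ, E4).tangent
    (fun x' => (⟨x', Y x'⟩ : TangentBundle 𝓘(ℝ, E4) X)) x

/-- The connection `K` is metric for `g_h`: `∇ g_h = 0`. -/
def IsMetric (K : WorldConn X) (h : TetradMap X) : Prop :=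
  ∀ (x : X) (Y Z : ∀ x : X, TangentSpace 𝓘(ℝ, E4) x), MDiffField Y x → MDiffField Z x →
    ∀ v, derivMetric K h Y Z x v = 0

/-- `∇ g_h` is totally symmetric: `(∇_Y g_h)(Y', Z) = (∇_{Y'} g_h)(Y, Z)`. -/
def IsCodazzi (K : WorldConn X) (h : TetradMap X) : Prop :=
  ∀ (x : X) (Y Y' Z : ∀ x : X, TangentSpace 𝓘(ℝ, E4) x), MDiffField Y x → MDiffField Y' x →
    MDiffField Z x → derivMetric K h Y' Z x (Y x) = derivMetric K h Y Z x (Y' x)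

end world

/-! ### The explicit connection -/

section explicit

variable {X : Type*} [TopologicalSpace X] [ChartedSpace E4 X] [IsManifold 𝓘(ℝ, E4) ∞ X]
  [OrientedAtlas X] {ι : Type*} (P : SpinLift X ι)
  {V : Type*} [NormedAddCommGroup V] [NormedSpace ℂ V] [FiniteDimensional ℂ V]
  (𝒮 : SpinorSpace V)

/-- The coordinates `σ^μ_a` on `Σ`: the components in the chart `c` of the frame `z_i(σ)`. -/
def SpinLift.sig (i : ι) (c : atlas E4 X) (μ a : Fin 4) (σ : Tetrads X) : ℝ :=
  (P.frame i σ).matIn c μ a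

/-- The inverse matrix `σ^a_μ`. -/
def SpinLift.sigInv (i : ι) (c : atlas E4 X) (a μ : Fin 4) (σ : Tetrads X) : ℝ :=
  ((P.frame i σ).matIn c)⁻¹ a μ

/-- The differential at `σ` of a real function on `Σ`. -/
def dfunTet (f : Tetrads X → ℝ) (σ : Tetrads X) : TangentSpace 𝓘(ℝ, E4 × LowTri) σ →L[ℝ] ℝ :=
  mfderiv 𝓘(ℝ, E4 × LowTri) 𝓘(ℝ, ℝ) f σ

/-- The differential `dσ^μ_a` at `σ`. -/
def SpinLift.dsig (i : ι) (c : atlas E4 X) (μ a : Fin 4) (σ : Tetrads X) :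
    TangentSpace 𝓘(ℝ, E4 × LowTri) σ →L[ℝ] ℝ :=
  dfunTet (P.sig i c μ a) σ

/-- The differential `dx^μ` on `Σ`. -/
def dcoordTet (c : atlas E4 X) (μ : Fin 4) (σ : Tetrads X) :
    TangentSpace 𝓘(ℝ, E4 × LowTri) σ →L[ℝ] ℝ :=
  dfunTet (fun τ : Tetrads X => c.1 τ.pt μ) σ

/-- The local connection form `A^{ab} = Ã^{ab}_μ dx^μ + A^{abc}_μ dσ^μ_c` on `U_i`, where
`Ã^{ab}_μ = ½ K^ν_{λμ} σ^λ_c (η^{cb} σ^a_ν - η^{ca} σ^b_ν)` and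
`A^{abc}_μ = ½ (η^{cb} σ^a_μ - η^{ca} σ^b_μ)`. -/
def SpinLift.tetradForm (K : WorldConn X) (i : ι) (c : atlas E4 X) (a b : Fin 4) (σ : Tetrads X)
    (w : TangentSpace 𝓘(ℝ, E4 × LowTri) σ) : ℝ :=
  (∑ μ, (1 / 2 * ∑ ν, ∑ lam, ∑ d, christoffel K c σ.pt ν lam μ * P.sig i c lam d σ *
      (eta d b * P.sigInv i c a ν σ - eta d a * P.sigInv i c b ν σ)) * dcoordTet c μ σ w) +
  ∑ μ, ∑ d, (1 / 2 * (eta d b * P.sigInv i c a μ σ - eta d a * P.sigInv i c b μ σ)) *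
    P.dsig i c μ d σ w

/-- The mixed components `A^a_b = A^{ae} η_{eb}` of the local connection form. -/
def SpinLift.tetradFormMixed (K : WorldConn X) (i : ι) (c : atlas E4 X) (a b : Fin 4)
    (σ : Tetrads X) (w : TangentSpace 𝓘(ℝ, E4 × LowTri) σ) : ℝ :=
  ∑ e, P.tetradForm K i c a e σ w * eta e b

/-- The transition functions `l = z_j⁻¹ z_i` of `LX → Σ` with values in `L`. -/
def SpinLift.lor (i j : ι) (a b : Fin 4) (σ : Tetrads X) : ℝ :=
  ((P.frame j σ).mat⁻¹ * (P.frame i σ).mat) a b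

/-- The components
`A_h^{ab}_μ = ½ [K^ν_{λμ} h^λ_c (η^{cb} h^a_ν - η^{ca} h^b_ν) + ∂_μ h^ν_c (η^{cb} h^a_ν - η^{ca} h^b_ν)]`
where `h^μ_a = σ^μ_a ∘ h` are the tetrad functions. -/
def SpinLift.tetradFormH (K : WorldConn X) (h : TetradMap X) (i : ι) (c : atlas E4 X)
    (a b μ : Fin 4) (x : X) : ℝ :=
  1 / 2 * ((∑ ν, ∑ lam, ∑ d, christoffel K c x ν lam μ * P.sig i c lam d (h x) *
      (eta d b * P.sigInv i c a ν (h x) - eta d a * P.sigInv i c b ν (h x))) +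
    ∑ ν, ∑ d, dfun (fun x' => P.sig i c ν d (h x')) x (coordField c μ x) *
      (eta d b * P.sigInv i c a ν (h x) - eta d a * P.sigInv i c b ν (h x)))

/-- The vector field `h_b = z_i(h(x))_b` of the tetrad `h`. -/
def SpinLift.tetradField (h : TetradMap X) (i : ι) (b : Fin 4) (x : X) :
    TangentSpace 𝓘(ℝ, E4) x := (P.frame i (h x)).vec b

/-- The spin connection components `ω^{ab}(v) = η^{bd} h^a(∇_v h_d)` of a connection `N` on `TX` in
the tetrad `h`. -/
def SpinLift.spinForm (N : WorldConn X) (h : TetradMap X) (i : ι) (a b : Fin 4) (x : X)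
    (v : TangentSpace 𝓘(ℝ, E4) x) : ℝ :=
  ∑ d, eta b d * ((P.frame i (h x)).mat⁻¹ *ᵥ (N (P.tetradField h i d) x v : E4).ofLp) a

/-- The connection `A` on `S → Σ` is associated with the local connection forms `A^{ab}`: its
horizontal lifts satisfy `dy = -½ A^{ab} I_{ab} y` in every atlas trivialization and chart. -/
def SpinLift.IsTetradConn (K : WorldConn X) (A : P.ConnS 𝒮) : Prop :=
  ∀ (i : ι) (c : atlas E4 X) (y : P.S 𝒮), y.proj ∈ P.baseSet i → y.proj.pt ∈ c.1.source →
    ∀ w : TangentSpace 𝓘(ℝ, E4 × LowTri) y.proj,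
      P.dfib 𝒮 i y ((A.jet y).1 w) =
        -(1 / 2 : ℝ) • ∑ a, ∑ b, P.tetradForm K i c a b y.proj w • 𝒮.gen a b (P.fib 𝒮 i y)

/-- The connection `B` on `S_h` is the spin connection of the connection `N` on `TX`: its
horizontal lifts satisfy `dy = -½ ω^{ab} I_{ab} y`. -/
def SpinLift.IsSpinConn (N : WorldConn X) (h : TetradMap X) (B : P.ConnH 𝒮 h) : Prop :=
  ∀ (i : ι) (y : P.SH 𝒮 h), h y.proj ∈ P.baseSet i →
    ∀ v : TangentSpace 𝓘(ℝ, E4) y.proj,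
      P.dfib 𝒮 i (P.incl 𝒮 h y) (P.tincl 𝒮 h y ((B.jet y).1 v)) =
        -(1 / 2 : ℝ) • ∑ a, ∑ b,
          P.spinForm N h i a b y.proj v • 𝒮.gen a b (P.fib 𝒮 i (P.incl 𝒮 h y))

/-- A bundle map `J¹S → VS_Σ` over `S` is smooth: it maps smooth families of jets to smooth
families of vectors. -/
def SpinLift.IsSmoothOperator (D : ∀ y : P.S 𝒮, P.JetS 𝒮 y → P.VertS 𝒮 y) : Prop :=
  ∀ (n : ℕ) (y : EuclideanSpace ℝ (Fin n) → P.S 𝒮) (φ : ∀ t, P.JetS 𝒮 (y t))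
    (t₀ : EuclideanSpace ℝ (Fin n)),
    ContMDiffAt 𝓘(ℝ, EuclideanSpace ℝ (Fin n)) (𝓘(ℝ, E4 × LowTri).prod 𝓘(ℝ, V)) ∞ y t₀ →
    ContMDiffAt 𝓘(ℝ, EuclideanSpace ℝ (Fin n)) 𝓘(ℝ, E4 →L[ℝ] ((E4 × LowTri) × V)) ∞
      (inTangentCoordinates 𝓘(ℝ, E4) (𝓘(ℝ, E4 × LowTri).prod 𝓘(ℝ, V))
        (fun t => P.projX 𝒮 (y t)) y (fun t => (φ t).1) t₀) t₀ →
    ContMDiffAt 𝓘(ℝ, EuclideanSpace ℝ (Fin n)) (𝓘(ℝ, E4 × LowTri).prod 𝓘(ℝ, V)).tangent ∞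
      (fun t => (⟨y t, (D (y t) (φ t)).1⟩ :
        TangentBundle (𝓘(ℝ, E4 × LowTri).prod 𝓘(ℝ, V)) (P.S 𝒮))) t₀

end explicit

end

end CompositeSpinor

open CompositeSpinor

/-!
# Dirac operators on the composite spinor bundle

The argument works with differentials of coordinates instead of coordinate expressions. A tangent
vector of a vector bundle is determined by its projection to the base and by the differential of
the fibre coordinates of one trivialization, and every such pair occurs (`tangent_ext`,
`tangentLift`). Hence a connection on `S → Σ` or `S_h → X` is known once the fibre components of its
horizontal lifts are known in one trivialization. All smoothness statements are reduced to smooth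
families of tangent vectors (`SmoothVec`), which pass through bundle maps, tangent maps and
trivializations.

**The total Dirac operator.** The transition functions of the spinor bundle take values in the
spin group and cover the change of frames, so `γ_Σ` has the same expression in every trivialization.
The identities for composite connections and for restrictions to a tetrad field `h` then hold
because both sides have equal projections and equal fibre components; the induced connection `A_h`
is the lift with the fibre components of `Ã(Th(v))`.

**The explicit connection.** In a frame `z_i` and a chart, put `θ = σ⁻¹ (dσ + K σ)`, the
connection form of `K` on the frame bundle (`frameForm`). The forms `A^{ab}` are the entries of
`½ (θ η - η θᵀ)`, the projection of `θ` to the Lorentz algebra with the second index raised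
(`antisymEta`). The form
`θ` does not depend on the chart and satisfies `l θ_i = θ_j l + dl`. Since `l` takes values in the
Lorentz group, `dl l⁻¹` lies in the Lorentz algebra, and since the projection commutes with
conjugation by `l`, the gauge law passes to `A^{ab}` (`tetradFormMixed_gauge`).

The gauge law lifts to spinors because the spin cocycle `t` satisfies
`dt = ½ (dl l⁻¹)^{ab} I_{ab} t` (`spin_tangent`). Indeed, differentiating the relation by which `t`
covers `l` shows that `dt t⁻¹` and `½ (dl l⁻¹)^{ab} I_{ab}` have the same commutators with the
generators; their difference commutes with the whole Clifford algebra, so it is a scalar, as the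
dimension is even, and it is odd under the star operation, so it vanishes. Therefore the conditions
`dy = -½ A^{ab} I_{ab} y` in different trivializations agree (`horizontal_change`) and define one
connection (`tetradConn`), which is smooth because the coefficients of `K` are (`smooth_connMat`).

**Restriction to a tetrad field.** Along `h` the entries of `θ` are `h^a (∇_v h_b)`. If
`∇ g_h = 0`, then `θ η` is antisymmetric, the projection changes nothing, and `A_h` is the
Levi-Civita spin connection. For a torsion-free `N` with `N g_h = 0`, the generators `I_{ab}` act
linearly independently on a nonzero module (`eq_zero_of_gen_sum`), so `A_h` is the spin connection
of `N` exactly if the antisymmetric parts for `K` and `N` agree, that is, if the difference tensor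
`D = K - N` satisfies `g_h (u, D(v, w)) = g_h (v, D(u, w))`. As `D(v, w) = D(w, v)` and `∇ g_h` is
minus the symmetrization of `g_h (·, D(·, ·))`, this is the total symmetry of `∇ g_h`.
-/

namespace CompositeSpinor

noncomputable section

set_option linter.unusedSectionVars false

/-! ### The Clifford algebra of Minkowski space -/

/-- The basis vector `e^a` of Minkowski space in its Clifford algebra. -/
def cliffGen (a : Fin 4) : Cl := CliffordAlgebra.ι minkQ (Pi.single a 1)

lemma sgn_mul_self (a : Fin 4) : sgn a * sgn a = 1 := by
  fin_cases a <;> simp [sgn]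

lemma minkQ_single (a : Fin 4) : minkQ (Pi.single a 1) = sgn a := by
  simp [minkQ, QuadraticMap.weightedSumSquares_apply, Pi.single_apply]

lemma minkQ_polar_single (a b : Fin 4) :
    QuadraticMap.polar minkQ (Pi.single a 1) (Pi.single b 1) = 2 * eta a b := by
  simp only [QuadraticMap.polar, minkQ, QuadraticMap.weightedSumSquares_apply, eta,
    Matrix.diagonal_apply]
  fin_cases a <;> fin_cases b <;> simp [Fin.sum_univ_four, sgn] <;> norm_num

lemma cliffGen_mul_add (a b : Fin 4) :
    cliffGen a * cliffGen b + cliffGen b * cliffGen a = algebraMap ℝ Cl (2 * eta a b) := by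
  rw [← minkQ_polar_single]
  exact CliffordAlgebra.ι_mul_ι_add_swap _ _

lemma cliffGen_sq (a : Fin 4) : cliffGen a * cliffGen a = algebraMap ℝ Cl (sgn a) := by
  rw [← minkQ_single]
  exact CliffordAlgebra.ι_sq_scalar _ _

lemma cliffGen_anticomm {a b : Fin 4} (h : a ≠ b) :
    cliffGen a * cliffGen b = -(cliffGen b * cliffGen a) := by
  have := cliffGen_mul_add a b
  rw [eta, Matrix.diagonal_apply_ne _ h, mul_zero, map_zero] at this
  exact eq_neg_of_add_eq_zero_left this

lemma ι_eq_sum (v : Fin 4 → ℝ) :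
    CliffordAlgebra.ι minkQ v = ∑ a, v a • cliffGen a := by
  conv_lhs => rw [pi_eq_sum_univ' v, map_sum]
  refine Finset.sum_congr rfl fun a _ => ?_
  rw [map_smul, cliffGen]

lemma star_cliffGen (a : Fin 4) : star (cliffGen a) = -cliffGen a := CliffordAlgebra.star_ι _

/-- Ordered monomials in the generators, with arbitrary exponents. -/
def cliffMon (n : Fin 4 → ℕ) : Cl :=
  cliffGen 0 ^ n 0 * cliffGen 1 ^ n 1 * cliffGen 2 ^ n 2 * cliffGen 3 ^ n 3

lemma cliffGen_mul_pow {a b : Fin 4} (h : a ≠ b) (n : ℕ) :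
    cliffGen a * cliffGen b ^ n = (-1 : ℝ) ^ n • (cliffGen b ^ n * cliffGen a) := by
  induction n with
  | zero => simp
  | succ n ih =>
    rw [pow_succ, ← mul_assoc, ih, smul_mul_assoc, mul_assoc, cliffGen_anticomm h, mul_neg,
      pow_succ, mul_comm ((-1 : ℝ) ^ n), mul_smul, neg_one_smul, smul_neg, mul_assoc]

lemma cliffGen_mul_pow_self (a : Fin 4) (n : ℕ) :
    cliffGen a * cliffGen a ^ n = cliffGen a ^ n * cliffGen a := by
  rw [← pow_succ, ← pow_succ']

/-- The exponent of the sign produced by moving `e^a` through a monomial. -/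
def monSign (a : Fin 4) (n : Fin 4 → ℕ) : ℕ := ∑ b ∈ Finset.univ.erase a, n b

lemma cliffGen_mul_mon_comm (a : Fin 4) (n : Fin 4 → ℕ) :
    cliffGen a * cliffMon n = (-1 : ℝ) ^ monSign a n • (cliffMon n * cliffGen a) := by
  have key : ∀ b, cliffGen a * cliffGen b ^ n b =
      (-1 : ℝ) ^ (if b = a then 0 else n b) • (cliffGen b ^ n b * cliffGen a) := by
    intro b
    by_cases h : b = a
    · subst h; simp [cliffGen_mul_pow_self]
    · rw [if_neg h, cliffGen_mul_pow (Ne.symm h)]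
  have hs : monSign a n = ∑ b, (if b = a then 0 else n b) := by
    rw [monSign, ← Finset.sum_erase_add _ _ (Finset.mem_univ a), if_pos rfl, add_zero]
    exact Finset.sum_congr rfl fun b hb => by rw [if_neg (Finset.ne_of_mem_erase hb)]
  rw [hs, Fin.sum_univ_four, cliffMon]
  simp only [← mul_assoc]
  rw [key 0, smul_mul_assoc, smul_mul_assoc, smul_mul_assoc, mul_assoc _ (cliffGen a), key 1,
    mul_smul_comm, smul_mul_assoc, smul_mul_assoc, ← mul_assoc, mul_assoc _ (cliffGen a), key 2,
    mul_smul_comm, smul_mul_assoc, ← mul_assoc, mul_assoc _ (cliffGen a), key 3, mul_smul_comm,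
    ← mul_assoc]
  simp only [smul_smul, pow_add, ← mul_assoc]

lemma cliffGen_mul_mon_mem (a : Fin 4) (n : Fin 4 → ℕ) :
    cliffGen a * cliffMon n ∈ Submodule.span ℝ (range cliffMon) := by
  have hm : cliffMon (n + Pi.single a 1) ∈ Submodule.span ℝ (range cliffMon) :=
    Submodule.subset_span ⟨_, rfl⟩
  have : ∃ r : ℝ, cliffGen a * cliffMon n = r • cliffMon (n + Pi.single a 1) := by
    fin_cases a
    · refine ⟨1, ?_⟩
      simp [cliffMon, mul_assoc, pow_succ']
    · refine ⟨(-1) ^ n 0, ?_⟩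
      simp only [cliffMon, Fin.mk_one, ← mul_assoc]
      rw [cliffGen_mul_pow (by decide)]
      simp [mul_assoc, pow_succ']
    · refine ⟨(-1) ^ n 0 * (-1) ^ n 1, ?_⟩
      simp only [cliffMon, Fin.reduceFinMk, ← mul_assoc]
      rw [cliffGen_mul_pow (by decide), smul_mul_assoc, mul_assoc _ (cliffGen 2),
        cliffGen_mul_pow (by decide)]
      simp [mul_assoc, pow_succ', smul_smul]
    · refine ⟨(-1) ^ n 0 * (-1) ^ n 1 * (-1) ^ n 2, ?_⟩
      simp only [cliffMon, Fin.reduceFinMk, ← mul_assoc]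
      rw [cliffGen_mul_pow (by decide), smul_mul_assoc, mul_assoc _ (cliffGen 3),
        cliffGen_mul_pow (by decide), mul_smul_comm, smul_mul_assoc, smul_mul_assoc,
        ← mul_assoc (cliffGen 0 ^ n 0), smul_mul_assoc, smul_mul_assoc,
        mul_assoc (cliffGen 0 ^ n 0 * _) (cliffGen 3), cliffGen_mul_pow (by decide)]
      simp [mul_assoc, pow_succ', smul_smul]
  obtain ⟨r, hr⟩ := this
  rw [hr]
  exact Submodule.smul_mem _ _ hm

lemma span_cliffMon : Submodule.span ℝ (range cliffMon) = ⊤ := by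
  rw [eq_top_iff]
  rintro x -
  induction x using CliffordAlgebra.left_induction with
  | algebraMap r =>
    have : algebraMap ℝ Cl r = r • cliffMon 0 := by
      simp [cliffMon, Algebra.algebraMap_eq_smul_one]
    rw [this]
    exact Submodule.smul_mem _ _ (Submodule.subset_span ⟨_, rfl⟩)
  | add x y hx hy => exact Submodule.add_mem _ hx hy
  | ι_mul x v hx =>
    rw [ι_eq_sum, Finset.sum_mul]
    refine Submodule.sum_mem _ fun a _ => ?_
    rw [smul_mul_assoc]
    refine Submodule.smul_mem _ _ ?_
    refine Submodule.span_induction (p := fun x _ => cliffGen a * x ∈ _) ?_ ?_ ?_ ?_ hx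
    · rintro _ ⟨n, rfl⟩
      exact cliffGen_mul_mon_mem a n
    · simp
    · intro x y _ _ hx hy
      rw [mul_add]
      exact Submodule.add_mem _ hx hy
    · intro r x _ hx
      rw [mul_smul_comm]
      exact Submodule.smul_mem _ _ hx

lemma cliffGen_pow_even (a : Fin 4) {n : ℕ} (h : Even n) :
    ∃ r : ℝ, cliffGen a ^ n = algebraMap ℝ Cl r := by
  obtain ⟨k, rfl⟩ := h
  exact ⟨sgn a ^ k, by rw [← two_mul, pow_mul, sq, cliffGen_sq, map_pow]⟩

open Classical in
instance : Module.Finite ℝ Cl := by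
  have key : ∀ n : Fin 4 → ℕ, ∃ r : ℝ, cliffMon n = r • cliffMon (fun a => n a % 2) := by
    intro n
    have h : ∀ a, ∃ r : ℝ, cliffGen a ^ n a = r • cliffGen a ^ (n a % 2) := by
      intro a
      refine ⟨sgn a ^ (n a / 2), ?_⟩
      conv_lhs => rw [← Nat.div_add_mod (n a) 2]
      rw [pow_add, pow_mul, sq, cliffGen_sq, ← map_pow, ← Algebra.smul_def]
    choose r hr using h
    refine ⟨r 0 * r 1 * r 2 * r 3, ?_⟩
    rw [cliffMon, hr 0, hr 1, hr 2, hr 3, cliffMon]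
    simp only [smul_mul_assoc, mul_smul_comm, smul_smul]
    congr 1
    ring
  refine ⟨⟨(Finset.univ : Finset (Fin 4 → Fin 2)).image
    (fun ε => cliffMon fun a => (ε a : ℕ)), ?_⟩⟩
  rw [eq_top_iff, ← span_cliffMon, Submodule.span_le]
  rintro _ ⟨n, rfl⟩
  obtain ⟨r, hr⟩ := key n
  rw [hr]
  refine Submodule.smul_mem _ _ (Submodule.subset_span ?_)
  simp only [Finset.coe_image, Finset.coe_univ, image_univ, mem_range]
  exact ⟨fun a => ⟨n a % 2, Nat.mod_lt _ two_pos⟩, rfl⟩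

/-- The projection of the Clifford algebra onto the commutant of `e^a`. -/
def commProj (a : Fin 4) : Cl →ₗ[ℝ] Cl :=
  (1 / 2 : ℝ) • (LinearMap.id + sgn a • (LinearMap.mulLeft ℝ (cliffGen a) ∘ₗ
    LinearMap.mulRight ℝ (cliffGen a)))

lemma commProj_apply (a : Fin 4) (x : Cl) :
    commProj a x = (1 / 2 : ℝ) • (x + sgn a • (cliffGen a * (x * cliffGen a))) := rfl

lemma commProj_of_comm {a : Fin 4} {x : Cl} (h : cliffGen a * x = x * cliffGen a) :
    commProj a x = x := by
  rw [commProj_apply, ← h, ← mul_assoc, cliffGen_sq, ← Algebra.smul_def, smul_smul, sgn_mul_self,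
    one_smul, ← two_smul ℝ, smul_smul]
  norm_num

lemma commProj_of_anticomm {a : Fin 4} {x : Cl} (h : cliffGen a * x = -(x * cliffGen a)) :
    commProj a x = 0 := by
  have h' : x * cliffGen a = -(cliffGen a * x) := by rw [h, neg_neg]
  rw [commProj_apply, h', mul_neg, ← mul_assoc, cliffGen_sq, ← Algebra.smul_def, smul_neg,
    smul_smul, sgn_mul_self, one_smul, add_neg_cancel, smul_zero]

lemma commProj_mon (a : Fin 4) (n : Fin 4 → ℕ) :
    commProj a (cliffMon n) = if Even (monSign a n) then cliffMon n else 0 := by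
  have := cliffGen_mul_mon_comm a n
  split_ifs with h
  · rw [h.neg_one_pow, one_smul] at this
    exact commProj_of_comm this
  · rw [(Nat.not_even_iff_odd.mp h).neg_one_pow, neg_one_smul] at this
    exact commProj_of_anticomm this

/-- The centre of the Clifford algebra consists of scalars: averaging over conjugation by the
generators annihilates every monomial which fails to commute with one of them. -/
lemma exists_scalar_of_comm {x : Cl} (h : ∀ a, cliffGen a * x = x * cliffGen a) :
    ∃ r : ℝ, x = algebraMap ℝ Cl r := by
  -- each factor of `T` fixes or annihilates a given monomial, so `T` maps it to itself or to zero
  let T : Cl →ₗ[ℝ] Cl := commProj 0 ∘ₗ commProj 1 ∘ₗ commProj 2 ∘ₗ commProj 3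
  have hT : T x = x := by
    simp only [T, LinearMap.comp_apply, commProj_of_comm (h _)]
  have key : ∀ y : Cl, T y ∈ (1 : Submodule ℝ Cl) := by
    intro y
    have hy : y ∈ Submodule.span ℝ (range cliffMon) := by rw [span_cliffMon]; trivial
    refine Submodule.span_induction (p := fun y _ => T y ∈ (1 : Submodule ℝ Cl)) ?_ ?_ ?_ ?_ hy
    · rintro _ ⟨n, rfl⟩
      have step : ∀ a, commProj a (cliffMon n) = cliffMon n ∨ commProj a (cliffMon n) = 0 := by
        intro a; rw [commProj_mon]; split_ifs <;> simp
      by_cases hn : ∀ a, Even (monSign a n)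
      · have hT : T (cliffMon n) = cliffMon n := by
          simp only [T, LinearMap.comp_apply, commProj_mon, if_pos (hn _)]
        rw [hT]
        -- the degree has the parity of each of the four exponents, hence is even, and so are they
        have e : ∀ a, Even (n a) := by
          have h0 := hn 0
          have h1 := hn 1
          have h2 := hn 2
          have h3 := hn 3
          have s : ∀ a, monSign a n + n a = n 0 + n 1 + n 2 + n 3 := fun a => by
            rw [monSign, Finset.sum_erase_add _ _ (Finset.mem_univ a), Fin.sum_univ_four]
          have s0 := s 0
          have s1 := s 1
          have s2 := s 2
          have s3 := s 3
          intro a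
          rw [Nat.even_iff] at *
          fin_cases a <;> simp <;> omega
        obtain ⟨r0, h0⟩ := cliffGen_pow_even 0 (e 0)
        obtain ⟨r1, h1⟩ := cliffGen_pow_even 1 (e 1)
        obtain ⟨r2, h2⟩ := cliffGen_pow_even 2 (e 2)
        obtain ⟨r3, h3⟩ := cliffGen_pow_even 3 (e 3)
        rw [Submodule.mem_one]
        exact ⟨r0 * r1 * r2 * r3, by rw [cliffMon, h0, h1, h2, h3]; simp only [map_mul]⟩
      · push Not at hn
        obtain ⟨a, ha⟩ := hn
        have h0 : commProj a (cliffMon n) = 0 := by rw [commProj_mon, if_neg ha]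
        have hz : T (cliffMon n) = 0 := by
          simp only [T, LinearMap.comp_apply]
          rcases step 3 with e3 | e3 <;> rcases step 2 with e2 | e2 <;>
            rcases step 1 with e1 | e1 <;> rcases step 0 with e0 | e0 <;>
            simp only [e3, e2, e1, e0, map_zero]
          fin_cases a
          · exact e0.symm.trans h0
          · exact e1.symm.trans h0
          · exact e2.symm.trans h0
          · exact e3.symm.trans h0
        rw [hz]
        exact Submodule.zero_mem _
    · simp
    · intro x y _ _ hx hy
      rw [map_add]
      exact Submodule.add_mem _ hx hy
    · intro r x _ hx
      rw [map_smul]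
      exact Submodule.smul_mem _ _ hx
  obtain ⟨r, hr⟩ := Submodule.mem_one.mp (key x)
  exact ⟨r, by rw [hr, hT]⟩

/-- A central element of the Clifford algebra is a scalar, hence fixed by `star`; if it is also odd
under `star`, it vanishes. -/
lemma eq_zero_of_comm_of_star {x : Cl} (h : ∀ a, cliffGen a * x = x * cliffGen a)
    (hs : star x = -x) : x = 0 := by
  obtain ⟨r, rfl⟩ := exists_scalar_of_comm h
  rw [CliffordAlgebra.star_algebraMap] at hs
  have h2 : (2 : ℝ) • algebraMap ℝ Cl r = 0 := by
    rw [two_smul]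
    nth_rewrite 2 [hs]
    exact add_neg_cancel _
  exact (smul_eq_zero.mp h2).resolve_left two_ne_zero

/-- The bivector `½ Ω^{ab} I_{ab}` in the Clifford algebra, with `I_{ab} = ¼ [e_a, e_b]`. -/
def bivec (Ω : Mat4) : Cl :=
  ∑ a, ∑ b, (1 / 2 * Ω a b) • (1 / 4 : ℝ) • ((sgn a • cliffGen a) * (sgn b • cliffGen b) -
    (sgn b • cliffGen b) * (sgn a • cliffGen a))

/-- The commutator of a generator with a bivector is the contraction of the antisymmetric part of
the coefficients with the Minkowski metric. -/
lemma cliffGen_comm_bivec (Ω : Mat4) (c : Fin 4) :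
    cliffGen c * bivec Ω - bivec Ω * cliffGen c =
      ∑ b, (1 / 2 * (Ω c b - Ω b c) * sgn b) • cliffGen b := by
  have key : ∀ a b, cliffGen c * ((sgn a • cliffGen a) * (sgn b • cliffGen b)) -
      ((sgn a • cliffGen a) * (sgn b • cliffGen b)) * cliffGen c =
      (2 * (if c = a then 1 else 0) * sgn b : ℝ) • cliffGen b
        - (2 * (if c = b then 1 else 0) * sgn a : ℝ) • cliffGen a := by
    intro a b
    have h : ∀ a, cliffGen c * (sgn a • cliffGen a) =
        algebraMap ℝ Cl (2 * (if c = a then 1 else 0)) - (sgn a • cliffGen a) * cliffGen c := by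
      intro a
      rw [eq_sub_iff_add_eq, mul_smul_comm, smul_mul_assoc, ← smul_add, cliffGen_mul_add,
        Algebra.smul_def, ← map_mul, eta, Matrix.diagonal_apply]
      congr 1
      split_ifs with hc
      · subst hc
        linear_combination 2 * sgn_mul_self c
      · ring
    rw [← mul_assoc, h a, sub_mul, mul_assoc _ (cliffGen c), h b, mul_sub, ← Algebra.smul_def,
      ← Algebra.commutes, ← Algebra.smul_def, ← mul_assoc, smul_smul, smul_smul]
    abel
  have hsum : cliffGen c * bivec Ω - bivec Ω * cliffGen c =
      ∑ a, ∑ b, (1 / 2 * Ω a b) • ((if c = a then sgn b else 0 : ℝ) • cliffGen b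
        - (if c = b then sgn a else 0 : ℝ) • cliffGen a) := by
    rw [bivec, Finset.mul_sum, Finset.sum_mul, ← Finset.sum_sub_distrib]
    refine Finset.sum_congr rfl fun a _ => ?_
    rw [Finset.mul_sum, Finset.sum_mul, ← Finset.sum_sub_distrib]
    refine Finset.sum_congr rfl fun b _ => ?_
    have lin : ∀ (r : ℝ) (x : Cl), cliffGen c * (r • x) - (r • x) * cliffGen c =
        r • (cliffGen c * x - x * cliffGen c) := fun r x => by
      rw [mul_smul_comm, smul_mul_assoc, ← smul_sub]
    rw [lin, lin, mul_sub, sub_mul]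
    have : ∀ p q r s : Cl, p - q - (r - s) = (p - r) - (q - s) := fun p q r s => by abel
    rw [this, key a b, key b a]
    congr 1
    split_ifs <;> module
  rw [hsum]
  simp only [smul_sub, Finset.sum_sub_distrib, smul_smul]
  have e1 : ∑ a, ∑ b, (1 / 2 * Ω a b * (if c = a then sgn b else 0)) • cliffGen b =
      ∑ b, (1 / 2 * Ω c b * sgn b) • cliffGen b := by
    rw [Finset.sum_comm]
    refine Finset.sum_congr rfl fun b _ => ?_
    rw [← Finset.sum_smul]
    congr 1
    simp
  have e2 : ∑ a, ∑ b, (1 / 2 * Ω a b * (if c = b then sgn a else 0)) • cliffGen a =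
      ∑ a, (1 / 2 * Ω a c * sgn a) • cliffGen a := by
    refine Finset.sum_congr rfl fun a _ => ?_
    rw [← Finset.sum_smul]
    congr 1
    simp
  rw [e1, e2, ← Finset.sum_sub_distrib]
  refine Finset.sum_congr rfl fun b _ => ?_
  rw [← sub_smul]
  congr 1
  ring

lemma star_bivec (Ω : Mat4) : star (bivec Ω) = -bivec Ω := by
  simp only [bivec, star_sum, ← Finset.sum_neg_distrib]
  refine Finset.sum_congr rfl fun a _ => Finset.sum_congr rfl fun b _ => ?_
  simp only [CliffordAlgebra.star_smul, star_sub, star_mul, star_cliffGen, smul_neg, neg_mul,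
    mul_neg,
    neg_neg]
  rw [← smul_neg, ← smul_neg, neg_sub]

lemma bivec_add (Ω Ω' : Mat4) : bivec (Ω + Ω') = bivec Ω + bivec Ω' := by
  simp only [bivec, Matrix.add_apply, mul_add, add_smul, Finset.sum_add_distrib]

/-- Conjugation of the lowered generators by an element of the spin group covering `l`. -/
lemma spin_mul_lowered {t : Cl} {l : Mat4} (hl : IsLorentz l)
    (ht : ∀ b, t * ∑ a, l b a • cliffGen a = cliffGen b * t) (c : Fin 4) :
    t * (sgn c • cliffGen c) = (∑ b, l b c • (sgn b • cliffGen b)) * t := by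
  have h := hl.preserves'
  have e : ∑ b, (l b c * sgn b) • (∑ a, l b a • cliffGen a) = sgn c • cliffGen c := by
    simp only [Finset.smul_sum, smul_smul]
    rw [Finset.sum_comm]
    simp only [← Finset.sum_smul]
    have : ∀ a, ∑ b, l b c * sgn b * l b a = eta c a := fun a => by
      rw [← h, Matrix.mul_apply]
      simp [eta, Matrix.mul_diagonal]
    simp only [this, eta, Matrix.diagonal_apply, ite_smul, zero_smul]
    simp
  rw [← e, Finset.mul_sum, Finset.sum_mul]
  refine Finset.sum_congr rfl fun b _ => ?_
  rw [mul_smul_comm, ht, smul_smul, smul_mul_assoc]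

/-- Conjugation of bivectors by an element of the spin group covering `l`: since
`bivec` is defined through commutators, the coefficients transform as a tensor of rank two. -/
lemma spin_mul_bivec {t : Cl} {l : Mat4} (hl : IsLorentz l)
    (ht : ∀ b, t * ∑ a, l b a • cliffGen a = cliffGen b * t) (Ω : Mat4) :
    t * bivec Ω = bivec (l * Ω * lᵀ) * t := by
  set g : Fin 4 → Cl := fun a => sgn a • cliffGen a with hg
  have h1 : ∀ a, t * g a = (∑ b, l b a • g b) * t := spin_mul_lowered hl ht
  have h2 : ∀ a b, t * (g a * g b) = (∑ c, ∑ d, (l c a * l d b) • (g c * g d)) * t := by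
    intro a b
    rw [← mul_assoc, h1, mul_assoc, h1, ← mul_assoc, Finset.sum_mul_sum]
    simp only [smul_mul_smul_comm]
  have h3 : ∀ a b, t * (g a * g b - g b * g a) =
      (∑ c, ∑ d, (l c a * l d b) • (g c * g d - g d * g c)) * t := by
    intro a b
    rw [mul_sub, h2, h2 b a, ← sub_mul]
    congr 1
    simp only [smul_sub, Finset.sum_sub_distrib]
    congr 1
    rw [Finset.sum_comm]
    simp only [mul_comm]
  change t * (∑ a, ∑ b, (1 / 2 * Ω a b) • (1 / 4 : ℝ) • (g a * g b - g b * g a)) =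
    (∑ a, ∑ b, (1 / 2 * (l * Ω * lᵀ) a b) • (1 / 4 : ℝ) • (g a * g b - g b * g a)) * t
  simp only [Finset.mul_sum, mul_smul_comm, h3]
  rw [Finset.sum_mul]
  simp only [Finset.sum_mul, smul_mul_assoc, Finset.smul_sum, smul_smul]
  calc _ = ∑ c, ∑ d, ∑ a, ∑ b, (1 / 2 * Ω a b * (1 / 4 * (l c a * l d b))) •
          ((g c * g d - g d * g c) * t) := by
        have : ∀ f : Fin 4 → Fin 4 → Fin 4 → Fin 4 → Cl,
            ∑ a, ∑ b, ∑ c, ∑ d, f a b c d = ∑ c, ∑ d, ∑ a, ∑ b, f a b c d := by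
          intro f
          calc _ = ∑ a, ∑ c, ∑ b, ∑ d, f a b c d :=
                Finset.sum_congr rfl fun a _ => Finset.sum_comm
            _ = ∑ c, ∑ a, ∑ d, ∑ b, f a b c d := by
                rw [Finset.sum_comm]
                exact Finset.sum_congr rfl fun c _ => Finset.sum_congr rfl fun a _ =>
                  Finset.sum_comm
            _ = _ := Finset.sum_congr rfl fun c _ => Finset.sum_comm
        exact this _
    _ = _ := by
        refine Finset.sum_congr rfl fun c _ => Finset.sum_congr rfl fun d _ => ?_
        simp only [← Finset.sum_smul]
        congr 1
        simp only [Matrix.mul_apply, Matrix.transpose_apply, Finset.sum_mul, Finset.mul_sum]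
        rw [Finset.sum_comm]
        refine Finset.sum_congr rfl fun b _ => Finset.sum_congr rfl fun a _ => ?_
        ring

/-- The infinitesimal form of the covering `Spin⁺(1,3) → L`: if `t` covers `l`, then a tangent
vector `t'` of the spin group at `t` is determined by the tangent vector `l'` of the Lorentz group
which it covers, `t' = ½ (l' l⁻¹)^{ab} I_{ab} t`. Both sides have the same commutators with the
generators, so they differ by a scalar, and this scalar is odd under `star`. -/
lemma spin_tangent {t t' : Cl} {l l' : Mat4} (hl : IsLorentz l) (hst : star t * t = 1)
    (hts : t * star t = 1) (hs' : t * star t' + t' * star t = 0)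
    (hl' : l' * eta * lᵀ + l * eta * l'ᵀ = 0)
    (ht : ∀ b, t * ∑ a, l b a • cliffGen a = cliffGen b * t)
    (ht' : ∀ b, t' * ∑ a, l b a • cliffGen a + t * ∑ a, l' b a • cliffGen a = cliffGen b * t') :
    t' = bivec (l' * eta * lᵀ) * t := by
  set Ω := l' * eta * lᵀ with hΩ
  have hanti : ∀ a b, Ω b a = -Ω a b := by
    intro a b
    have h : Ω + Ωᵀ = 0 := by
      rw [← hl', hΩ]
      simp [Matrix.transpose_mul, eta_transpose, mul_assoc]
    have := congrFun (congrFun h a) b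
    simp only [Matrix.add_apply, Matrix.transpose_apply, Matrix.zero_apply] at this
    linarith
  have hconj : ∀ b, cliffGen b * (t' * star t) - (t' * star t) * cliffGen b =
      ∑ c, (Ω b c * sgn c) • cliffGen c := by
    intro b
    have e1 : (∑ a, l b a • cliffGen a) * star t = star t * cliffGen b := by
      calc (∑ a, l b a • cliffGen a) * star t
          = star t * (t * ∑ a, l b a • cliffGen a) * star t := by
            rw [← mul_assoc, hst, one_mul]
        _ = star t * cliffGen b := by rw [ht, mul_assoc, mul_assoc, hts, mul_one]
    have e2 : ∀ a, t * cliffGen a * star t = ∑ c, (sgn a * l c a * sgn c) • cliffGen c := by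
      intro a
      have h := spin_mul_lowered hl ht a
      have h2 : t * cliffGen a = sgn a • (t * (sgn a • cliffGen a)) := by
        rw [mul_smul_comm, smul_smul, sgn_mul_self, one_smul]
      rw [h2, h, smul_mul_assoc, mul_assoc, hts, mul_one, Finset.smul_sum]
      simp only [smul_smul, mul_assoc]
    rw [← mul_assoc, ← ht', add_mul, mul_assoc, e1, ← mul_assoc, add_sub_cancel_left,
      Finset.mul_sum, Finset.sum_mul]
    simp only [mul_smul_comm, smul_mul_assoc, e2, Finset.smul_sum, smul_smul]
    rw [Finset.sum_comm]
    refine Finset.sum_congr rfl fun c _ => ?_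
    rw [← Finset.sum_smul]
    congr 1
    rw [hΩ, Matrix.mul_apply, Finset.sum_mul]
    refine Finset.sum_congr rfl fun a _ => ?_
    simp [eta, Matrix.mul_diagonal]
    ring
  have hD : t' * star t - bivec Ω = 0 := by
    refine eq_zero_of_comm_of_star (fun b => ?_) ?_
    · rw [mul_sub, sub_mul, ← sub_eq_zero]
      have e : ∀ p q r s : Cl, p - q - (r - s) = (p - r) - (q - s) := fun p q r s => by abel
      rw [e, hconj, cliffGen_comm_bivec, sub_eq_zero]
      refine Finset.sum_congr rfl fun c _ => ?_
      rw [hanti b c]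
      congr 1
      ring
    · rw [star_sub, star_bivec, star_mul, star_star, eq_neg_of_add_eq_zero_left hs']
      abel
  have := sub_eq_zero.mp hD
  rw [← this, mul_assoc, hst, mul_one]

section spinor

variable {V : Type*} [NormedAddCommGroup V] [NormedSpace ℂ V] [FiniteDimensional ℂ V]
  (𝒮 : SpinorSpace V)

lemma actHom_apply (x : Cl) : 𝒮.actHom x = 𝒮.act x := rfl

lemma act_add (x y : Cl) (v : V) : 𝒮.act (x + y) v = 𝒮.act x v + 𝒮.act y v := by
  rw [← actHom_apply, map_add]; rfl

lemma act_smul (r : ℝ) (x : Cl) (v : V) : 𝒮.act (r • x) v = r • 𝒮.act x v := by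
  rw [← actHom_apply, map_smul]; rfl

lemma act_sum {κ : Type*} (s : Finset κ) (f : κ → Cl) (v : V) :
    𝒮.act (∑ k ∈ s, f k) v = ∑ k ∈ s, 𝒮.act (f k) v := by
  rw [← actHom_apply, map_sum, sum_apply]; rfl

lemma act_bivec (Ω : Mat4) (v : V) :
    𝒮.act (bivec Ω) v = (1 / 2 : ℝ) • ∑ a, ∑ b, Ω a b • 𝒮.gen a b v := by
  have hg : ∀ a b, 𝒮.gen a b v = 𝒮.act ((1 / 4 : ℝ) • ((sgn a • cliffGen a) *
      (sgn b • cliffGen b) - (sgn b • cliffGen b) * (sgn a • cliffGen a))) v := by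
    intro a b
    rw [act_smul, ← actHom_apply, map_sub, sub_apply, actHom_apply,
      actHom_apply, 𝒮.act_mul, 𝒮.act_mul]
    simp only [act_smul]
    rfl
  simp only [bivec, act_sum, hg, Finset.smul_sum, act_smul, smul_smul, mul_assoc]

lemma spinor_nontrivial (𝒮 : SpinorSpace V) : Nontrivial V := by
  by_contra h
  rw [not_nontrivial_iff_subsingleton] at h
  apply 𝒮.minimal.1
  rw [Submodule.eq_bot_iff]
  intro x hx
  have h0 : 𝒮.iso (𝒮.iso.symm ⟨x, hx⟩) = 0 := by rw [Subsingleton.elim (𝒮.iso.symm _) 0, map_zero]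
  rw [LinearEquiv.apply_symm_apply] at h0
  exact congrArg Subtype.val h0

/-- The spin generators act linearly independently on spinors. -/
lemma eq_zero_of_gen_sum (Ω : Mat4) (hΩ : ∀ a b, Ω b a = -Ω a b)
    (h : ∀ v, ∑ a, ∑ b, Ω a b • 𝒮.gen a b v = 0) : Ω = 0 := by
  have h0 : ∀ v, 𝒮.act (bivec Ω) v = 0 := fun v => by rw [act_bivec, h, smul_zero]
  obtain ⟨v, hv⟩ := @exists_ne V (spinor_nontrivial 𝒮) 0
  ext c d
  have hc : ∀ w, 𝒮.act (∑ b, (Ω c b * sgn b) • cliffGen b) w = 0 := by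
    intro w
    have e := cliffGen_comm_bivec Ω c
    have e' : ∀ b, (1 / 2 * (Ω c b - Ω b c) * sgn b) = Ω c b * sgn b := fun b => by
      rw [hΩ c b]; ring
    simp only [e'] at e
    rw [← e, ← actHom_apply, map_sub, sub_apply, actHom_apply, actHom_apply, 𝒮.act_mul, 𝒮.act_mul,
      h0, h0, map_zero, sub_zero]
  have hd : cliffGen d * (∑ b, (Ω c b * sgn b) • cliffGen b) +
      (∑ b, (Ω c b * sgn b) • cliffGen b) * cliffGen d = (2 * Ω c d) • (1 : Cl) := by
    rw [Finset.mul_sum, Finset.sum_mul, ← Finset.sum_add_distrib]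
    simp only [mul_smul_comm, smul_mul_assoc, ← smul_add, cliffGen_mul_add,
      Algebra.algebraMap_eq_smul_one, smul_smul, ← Finset.sum_smul]
    congr 1
    simp only [eta, Matrix.diagonal_apply, mul_ite, mul_zero, Finset.sum_ite_eq,
      Finset.mem_univ, if_true]
    linear_combination 2 * Ω c d * sgn_mul_self d
  have := congrArg (fun x => 𝒮.act x v) hd
  simp only [act_add, 𝒮.act_mul, hc, map_zero, add_zero, act_smul, 𝒮.act_one] at this
  have h2 := (smul_eq_zero.mp this.symm).resolve_right hv
  simpa using h2

end spinor

/-! ### Smooth families of tangent vectors -/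

section families

variable {EN : Type*} [NormedAddCommGroup EN] [NormedSpace ℝ EN] {HN : Type*} [TopologicalSpace HN]
  {IN : ModelWithCorners ℝ EN HN} {N : Type*} [TopologicalSpace N] [ChartedSpace HN N]
  {E : Type*} [NormedAddCommGroup E] [NormedSpace ℝ E] {H : Type*} [TopologicalSpace H]
  {I : ModelWithCorners ℝ E H} {M : Type*} [TopologicalSpace M] [ChartedSpace H M]
  [IsManifold I 1 M]
  {E' : Type*} [NormedAddCommGroup E'] [NormedSpace ℝ E'] {H' : Type*} [TopologicalSpace H']
  {I' : ModelWithCorners ℝ E' H'} {M' : Type*} [TopologicalSpace M'] [ChartedSpace H' M']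
  [IsManifold I' 1 M']
  {F : Type*} [NormedAddCommGroup F] [NormedSpace ℝ F]

variable (IN I) in
/-- A family of tangent vectors `w t ∈ T_{g t} M` is smooth at `t₀`. -/
def SmoothVec (g : N → M)
    (w : ∀ t, TangentSpace I (g t)) (t₀ : N) : Prop :=
  ContMDiffAt IN I.tangent ∞ (fun t => (⟨g t, w t⟩ : TangentBundle I M)) t₀

lemma SmoothVec.base {g : N → M} {w : ∀ t, TangentSpace I (g t)} {t₀ : N}
    (h : SmoothVec IN I g w t₀) : ContMDiffAt IN I ∞ g t₀ :=
  (contMDiffAt_totalSpace.mp h).1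

lemma SmoothVec.comp {EK : Type*} [NormedAddCommGroup EK] [NormedSpace ℝ EK] {HK : Type*}
    [TopologicalSpace HK] {IK : ModelWithCorners ℝ EK HK} {K : Type*} [TopologicalSpace K]
    [ChartedSpace HK K] {g : N → M} {w : ∀ t, TangentSpace I (g t)} {k : K → N} {s₀ : K}
    (h : SmoothVec IN I g w (k s₀)) (hk : ContMDiffAt IK IN ∞ k s₀) :
    SmoothVec IK I (fun s => g (k s)) (fun s => w (k s)) s₀ :=
  ContMDiffAt.comp (g := fun t => (⟨g t, w t⟩ : TangentBundle I M)) s₀ h hk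

lemma SmoothVec.clm_apply {f : N → M} {g : N → M'} {φ : ∀ t, TangentSpace I (f t) →L[ℝ]
    TangentSpace I' (g t)} {w : ∀ t, TangentSpace I (f t)} {t₀ : N}
    (hφ : ContMDiffAt IN 𝓘(ℝ, E →L[ℝ] E') ∞ (inTangentCoordinates I I' f g φ t₀) t₀)
    (hg : ContMDiffAt IN I' ∞ g t₀) (hw : SmoothVec IN I f w t₀) :
    SmoothVec IN I' g (fun t => φ t (w t)) t₀ :=
  ContMDiffAt.clm_apply_of_inCoordinates (F₁ := E) (F₂ := E') hφ hw hg

/-- Smooth maps carry smooth families of tangent vectors to smooth families. -/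
lemma SmoothVec.map {f : M → M'} {g : N → M} {w : ∀ t, TangentSpace I (g t)} {t₀ : N}
    (hf : ContMDiffAt I I' ∞ f (g t₀)) (hw : SmoothVec IN I g w t₀) :
    SmoothVec IN I' (fun t => f (g t)) (fun t => mfderiv I I' f (g t) (w t)) t₀ := by
  refine SmoothVec.clm_apply (φ := fun t => mfderiv I I' f (g t)) ?_ ?_ hw
  · have h := hf.mfderiv_const (m := ∞) le_rfl
    exact ContMDiffAt.comp (g := inTangentCoordinates I I' id f (mfderiv I I' f) (g t₀))
      t₀ h hw.base
  · exact hf.comp t₀ hw.base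

/-- The differential of a smooth vector valued function on a smooth family of tangent vectors. -/
lemma SmoothVec.map_apply {f : M → F} {g : N → M} {w : ∀ t, TangentSpace I (g t)} {t₀ : N}
    (hf : ContMDiffAt I 𝓘(ℝ, F) ∞ f (g t₀)) (hw : SmoothVec IN I g w t₀) :
    ContMDiffAt IN 𝓘(ℝ, F) ∞ (fun t => (mfderiv I 𝓘(ℝ, F) f (g t) (w t) : F)) t₀ := by
  have h := SmoothVec.map hf hw
  exact ContMDiffAt.comp (g := fun p : TangentBundle 𝓘(ℝ, F) F => p.2) t₀
    (contMDiff_snd_tangentBundle_modelSpace F 𝓘(ℝ, F)).contMDiffAt h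

/-- Vectors with constant components in the coordinates centred at `g t₀`. -/
lemma smoothVec_symmL {g : N → M} {t₀ : N} (hg : ContMDiffAt IN I ∞ g t₀) (v : E) :
    SmoothVec IN I g (fun t => (trivializationAt E (TangentSpace I) (g t₀)).symmL ℝ (g t) v)
      t₀ := by
  refine contMDiffAt_totalSpace.mpr ⟨hg, ?_⟩
  refine (contMDiffAt_const (c := v)).congr_of_eventuallyEq ?_
  have := hg.continuousAt.eventually ((trivializationAt E (TangentSpace I : M → Type _)
    (g t₀)).open_baseSet.mem_nhds (mem_baseSet_trivializationAt E (TangentSpace I) (g t₀)))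
  filter_upwards [this] with t ht
  change ((trivializationAt E (TangentSpace I) (g t₀))
    ⟨g t, (trivializationAt E (TangentSpace I) (g t₀)).symmL ℝ (g t) v⟩).2 = v
  rw [Bundle.Trivialization.symmL_apply]
  · exact congrArg Prod.snd (Bundle.Trivialization.apply_mk_symm _ ht v)
  · exact ht

/-- A family of linear maps on a finite dimensional space is smooth if its values on vectors are. -/
lemma contMDiffAt_clm_of_apply [FiniteDimensional ℝ E] {f : N → E →L[ℝ] F} {t₀ : N}
    (h : ∀ v, ContMDiffAt IN 𝓘(ℝ, F) ∞ (fun t => f t v) t₀) :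
    ContMDiffAt IN 𝓘(ℝ, E →L[ℝ] F) ∞ f t₀ := by
  let b := Module.finBasis ℝ E
  have e : f = fun t => ∑ k, ContinuousLinearMap.smulRightL ℝ E F
      (LinearMap.toContinuousLinearMap (b.coord k)) (f t (b k)) := by
    funext t
    ext v
    rw [sum_apply]
    conv_lhs => rw [← b.sum_repr v, map_sum]
    refine Finset.sum_congr rfl fun k _ => ?_
    rw [map_smul]
    rfl
  rw [e]
  have hk : ∀ k ∈ Finset.univ, ContMDiffAt IN 𝓘(ℝ, E →L[ℝ] F) ∞
      (fun t => ContinuousLinearMap.smulRightL ℝ E F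
        (LinearMap.toContinuousLinearMap (b.coord k)) (f t (b k))) t₀ := fun k _ =>
    (contMDiffAt_const (c := ContinuousLinearMap.smulRightL ℝ E F
      (LinearMap.toContinuousLinearMap (b.coord k)))).clm_apply (h (b k))
  exact contMDiffAt_finsetSum hk

/-- A family of linear maps between tangent spaces is smooth if it carries the vectors with constant
components to smooth families. -/
lemma contMDiffAt_inTangentCoordinates [FiniteDimensional ℝ E] {f : N → M} {g : N → M'}
    {φ : ∀ t, TangentSpace I (f t) →L[ℝ] TangentSpace I' (g t)} {t₀ : N}
    (h : ∀ v : E, SmoothVec IN I' g (fun t => φ t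
      ((trivializationAt E (TangentSpace I) (f t₀)).symmL ℝ (f t) v)) t₀) :
    ContMDiffAt IN 𝓘(ℝ, E →L[ℝ] E') ∞ (inTangentCoordinates I I' f g φ t₀) t₀ := by
  refine contMDiffAt_clm_of_apply fun v => ?_
  refine (contMDiffAt_totalSpace.mp (h v)).2.congr_of_eventuallyEq ?_
  filter_upwards [(h v).base.continuousAt.eventually ((trivializationAt E' (TangentSpace I' : M' →
    Type _) (g t₀)).open_baseSet.mem_nhds (mem_baseSet_trivializationAt E' (TangentSpace I') (g t₀)))]
    with t ht
  change (trivializationAt E' (TangentSpace I') (g t₀)).continuousLinearMapAt ℝ (g t) (φ t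
    ((trivializationAt E (TangentSpace I) (f t₀)).symmL ℝ (f t) v)) = _
  rw [Trivialization.continuousLinearMapAt_apply, Trivialization.linearMapAt_apply]
  exact if_pos ht

end families

/-! ### Tangent vectors of a vector bundle in a trivialization -/

section bundleTangent

variable {EB : Type*} [NormedAddCommGroup EB] [NormedSpace ℝ EB] {HB : Type*} [TopologicalSpace HB]
  {IB : ModelWithCorners ℝ EB HB} {B : Type*} [TopologicalSpace B] [ChartedSpace HB B]
  {F : Type*} [NormedAddCommGroup F] [NormedSpace ℝ F] {E : B → Type*}
  [TopologicalSpace (TotalSpace F E)] [∀ b, TopologicalSpace (E b)] [∀ b, AddCommMonoid (E b)]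
  [∀ b, Module ℝ (E b)] [FiberBundle F E] [VectorBundle ℝ F E]
  [IsManifold IB ∞ B] [ContMDiffVectorBundle ∞ F E IB]
  (e : Trivialization F (TotalSpace.proj : TotalSpace F E → B)) [MemTrivializationAtlas e]

lemma contMDiffAt_fibre {y : TotalSpace F E} (hy : y.proj ∈ e.baseSet) :
    ContMDiffAt (IB.prod 𝓘(ℝ, F)) 𝓘(ℝ, F) ∞ (fun p => (e p).2) y :=
  ((e.contMDiffAt_iff (IB := IB) (n := ∞) (f := id) (e.mem_source.mpr hy)).mp contMDiffAt_id).2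

lemma contMDiffAt_pair {y : TotalSpace F E} (hy : y.proj ∈ e.baseSet) :
    ContMDiffAt (IB.prod 𝓘(ℝ, F)) (IB.prod 𝓘(ℝ, F)) ∞
      (fun p : TotalSpace F E => (p.proj, (e p).2)) y :=
  (contMDiffAt_proj E).prodMk (contMDiffAt_fibre e hy)

lemma contMDiffAt_symm {y : TotalSpace F E} (hy : y.proj ∈ e.baseSet) :
    ContMDiffAt (IB.prod 𝓘(ℝ, F)) (IB.prod 𝓘(ℝ, F)) ∞ e.toOpenPartialHomeomorph.symm
      (y.proj, (e y).2) :=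
  (e.contMDiffOn_symm (n := ∞)).contMDiffAt (e.open_target.mem_nhds (e.mem_target.mpr hy))

lemma symm_pair {y : TotalSpace F E} (hy : y.proj ∈ e.baseSet) :
    e.toOpenPartialHomeomorph.symm (y.proj, (e y).2) = y := by
  rw [e.mk_proj_snd (e.mem_source.mpr hy)]
  exact e.symm_apply_apply (e.mem_source.mpr hy)

variable (IB) in
/-- The differential `dy^A` of the fibre coordinate of a trivialization. -/
abbrev dFibre (y : TotalSpace F E) : TangentSpace (IB.prod 𝓘(ℝ, F)) y →L[ℝ] F :=
  mfderiv (IB.prod 𝓘(ℝ, F)) 𝓘(ℝ, F) (fun p => (e p).2) y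

variable (IB F E) in
/-- The tangent map of the projection of a vector bundle. -/
abbrev dProj (y : TotalSpace F E) :
    TangentSpace (IB.prod 𝓘(ℝ, F)) y →L[ℝ] TangentSpace IB y.proj :=
  mfderiv (IB.prod 𝓘(ℝ, F)) IB (TotalSpace.proj : TotalSpace F E → B) y

lemma mfderiv_pair {y : TotalSpace F E} (hy : y.proj ∈ e.baseSet)
    (w : TangentSpace (IB.prod 𝓘(ℝ, F)) y) :
    (mfderiv (IB.prod 𝓘(ℝ, F)) (IB.prod 𝓘(ℝ, F)) (fun p : TotalSpace F E => (p.proj, (e p).2)) y w :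
      EB × F) = (dProj IB F E y w, dFibre IB e y w) := by
  have h1 : MDifferentiableAt (IB.prod 𝓘(ℝ, F)) IB (TotalSpace.proj : TotalSpace F E → B) y :=
    (contMDiffAt_proj E (n := 1)).mdifferentiableAt one_ne_zero
  have h2 := (contMDiffAt_fibre (IB := IB) e hy).mdifferentiableAt (by simp)
  rw [mfderiv_prodMk h1 h2]
  rfl

/-- Tangent vectors of a vector bundle with the same projection and the same fibre component in a
trivialization coincide. -/
lemma tangent_ext {y : TotalSpace F E} (hy : y.proj ∈ e.baseSet)
    {w w' : TangentSpace (IB.prod 𝓘(ℝ, F)) y} (h1 : dProj IB F E y w = dProj IB F E y w')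
    (h2 : dFibre IB e y w = dFibre IB e y w') : w = w' := by
  have hP := (contMDiffAt_pair (IB := IB) e hy).mdifferentiableAt (by simp)
  have hS := (contMDiffAt_symm (IB := IB) e hy).mdifferentiableAt (by simp)
  have hc := mfderiv_comp y hS hP
  have hid : e.toOpenPartialHomeomorph.symm ∘ (fun p : TotalSpace F E => (p.proj, (e p).2))
      =ᶠ[𝓝 y] id := by
    filter_upwards [e.open_source.mem_nhds (e.mem_source.mpr hy)] with p hp
    exact symm_pair e (e.mem_source.mp hp)
  have key : ∀ w : TangentSpace (IB.prod 𝓘(ℝ, F)) y, (w : EB × F) =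
      (mfderiv (IB.prod 𝓘(ℝ, F)) (IB.prod 𝓘(ℝ, F)) e.toOpenPartialHomeomorph.symm
        (y.proj, (e y).2) (dProj IB F E y w, dFibre IB e y w) : EB × F) := by
    intro w
    have h3 := congrArg (fun T => (T w : EB × F)) (hid.mfderiv_eq (I := IB.prod 𝓘(ℝ, F))
      (I' := IB.prod 𝓘(ℝ, F)))
    rw [hc, mfderiv_id] at h3
    refine h3.symm.trans ?_
    exact congrArg (fun z : EB × F => (mfderiv (IB.prod 𝓘(ℝ, F)) (IB.prod 𝓘(ℝ, F))
      e.toOpenPartialHomeomorph.symm (y.proj, (e y).2) z : EB × F)) (mfderiv_pair e hy w)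
  have e1 := key w
  rw [h1, h2] at e1
  exact e1.trans (key w').symm

/-- The tangent vector with given projection and given fibre component in a trivialization. -/
def tangentLift (y : TotalSpace F E) :
    TangentSpace IB y.proj × F →L[ℝ] TangentSpace (IB.prod 𝓘(ℝ, F)) y :=
  mfderiv (IB.prod 𝓘(ℝ, F)) (IB.prod 𝓘(ℝ, F)) e.toOpenPartialHomeomorph.symm (y.proj, (e y).2)

lemma pair_tangentLift {y : TotalSpace F E} (hy : y.proj ∈ e.baseSet)
    (z : TangentSpace IB y.proj × F) :
    dProj IB F E y (tangentLift e y z) = z.1 ∧ dFibre IB e y (tangentLift e y z) = z.2 := by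
  have hP := (contMDiffAt_pair (IB := IB) e hy).mdifferentiableAt (by simp)
  have hS := (contMDiffAt_symm (IB := IB) e hy).mdifferentiableAt (by simp)
  have hP' := hP
  rw [← symm_pair e hy] at hP'
  have hc := mfderiv_comp (y.proj, (e y).2) hP' hS
  have hid : (fun p : TotalSpace F E => (p.proj, (e p).2)) ∘ e.toOpenPartialHomeomorph.symm
      =ᶠ[𝓝 (y.proj, (e y).2)] id := by
    filter_upwards [e.open_target.mem_nhds (e.mem_target.mpr hy)] with p hp
    have h1 : (e.toOpenPartialHomeomorph.symm p).proj = p.1 := e.proj_symm_apply hp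
    have h2 : e (e.toOpenPartialHomeomorph.symm p) = p := e.apply_symm_apply hp
    change ((e.toOpenPartialHomeomorph.symm p).proj, (e (e.toOpenPartialHomeomorph.symm p)).2) = p
    rw [h1, h2]
  have h3 := congrArg (fun T => (T z : EB × F)) (hid.mfderiv_eq (I := IB.prod 𝓘(ℝ, F))
      (I' := IB.prod 𝓘(ℝ, F)))
  rw [hc, mfderiv_id, symm_pair e hy] at h3
  have h4 := (mfderiv_pair e hy (tangentLift e y z)).symm.trans h3
  exact ⟨congrArg Prod.fst h4, congrArg Prod.snd h4⟩

lemma fibre_add {b : B} (hb : b ∈ e.baseSet) (u v : E b) :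
    (e ⟨b, u + v⟩).2 = (e ⟨b, u⟩).2 + (e ⟨b, v⟩).2 := (e.linear ℝ hb).map_add u v

lemma fibre_smul {b : B} (hb : b ∈ e.baseSet) (r : ℝ) (u : E b) :
    (e ⟨b, r • u⟩).2 = r • (e ⟨b, u⟩).2 := (e.linear ℝ hb).map_smul r u

lemma fibre_sum {b : B} (hb : b ∈ e.baseSet) {κ : Type*} (s : Finset κ) (u : κ → E b) :
    (e ⟨b, ∑ k ∈ s, u k⟩).2 = ∑ k ∈ s, (e ⟨b, u k⟩).2 :=
  map_sum (IsLinearMap.mk' _ (e.linear ℝ hb)) u s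

lemma dProj_vert {y : TotalSpace F E}
    (w : Vert IB (IB.prod 𝓘(ℝ, F)) (TotalSpace.proj : TotalSpace F E → B) y) :
    dProj IB F E y w.1 = 0 := w.2

/-- The vertical lift in a trivialization. -/
lemma dFibre_vertLift {y : TotalSpace F E} (hy : y.proj ∈ e.baseSet) (u : E y.proj) :
    dFibre IB e y (vertLift IB y u).1 = (e ⟨y.proj, u⟩).2 := by
  set c := fun t : ℝ => (⟨y.proj, y.2 + t • u⟩ : TotalSpace F E) with hc
  have hc0 : c 0 = y := by simp [hc]
  have hfib : ∀ t, (e (c t)).2 = (e y).2 + t • (e ⟨y.proj, u⟩).2 := fun t => by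
    rw [hc]
    dsimp only
    rw [fibre_add e hy, fibre_smul e hy]
  have hd : MDifferentiableAt 𝓘(ℝ, ℝ) (IB.prod 𝓘(ℝ, F)) c 0 := by
    refine ContMDiffAt.mdifferentiableAt (n := ∞) ?_ (by simp)
    rw [e.contMDiffAt_iff (e.mem_source.mpr (by rw [hc0]; exact hy))]
    refine ⟨contMDiffAt_const, ?_⟩
    simp only [hfib]
    exact contMDiffAt_const.add (contMDiffAt_id.smul contMDiffAt_const)
  have hF := (contMDiffAt_fibre (IB := IB) e hy).mdifferentiableAt (by simp)
  have hF' := hF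
  rw [← hc0] at hF'
  have h := mfderiv_comp (0 : ℝ) hF' hd
  rw [hc0] at h
  have h2 : (fun p => (e p).2) ∘ c = fun t => (e y).2 + t • (e ⟨y.proj, u⟩).2 := funext hfib
  rw [h2] at h
  have h3 : HasDerivAt (fun t : ℝ => (e y).2 + t • (e ⟨y.proj, u⟩).2) (e ⟨y.proj, u⟩).2 0 := by
    simpa using ((hasDerivAt_id (0 : ℝ)).smul_const (e ⟨y.proj, u⟩).2).const_add (e y).2
  have h4 := congrArg (fun T => (T (1 : ℝ) : F)) h
  rw [mfderiv_eq_fderiv, h3.hasFDerivAt.fderiv] at h4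
  refine Eq.trans h4.symm ?_
  exact one_smul ℝ _

lemma vertLift_vertCoord (y : TotalSpace F E)
    (w : Vert IB (IB.prod 𝓘(ℝ, F)) (TotalSpace.proj : TotalSpace F E → B) y) :
    vertLift IB y (vertCoord IB y w) = w := by
  have hy : y.proj ∈ (trivializationAt F E y.proj).baseSet := mem_baseSet_trivializationAt F E _
  refine Subtype.ext (tangent_ext (trivializationAt F E y.proj) hy ?_ ?_)
  · rw [dProj_vert, dProj_vert]
  · rw [dFibre_vertLift _ hy]
    exact congrArg Prod.snd (Trivialization.apply_mk_symm (trivializationAt F E y.proj) hy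
      (dFibre IB (trivializationAt F E y.proj) y w.1))

lemma fibre_vertCoord {y : TotalSpace F E} (hy : y.proj ∈ e.baseSet)
    (w : Vert IB (IB.prod 𝓘(ℝ, F)) (TotalSpace.proj : TotalSpace F E → B) y) :
    (e ⟨y.proj, vertCoord IB y w⟩).2 = dFibre IB e y w.1 := by
  rw [← dFibre_vertLift (IB := IB) e hy, vertLift_vertCoord]

lemma dFibre_gammaVert {y : TotalSpace F E} (hy : y.proj ∈ e.baseSet)
    (γ : (E4 →L[ℝ] ℝ) → E y.proj → E y.proj)
    (Φ : E4 →ₗ[ℝ] Vert IB (IB.prod 𝓘(ℝ, F)) (TotalSpace.proj : TotalSpace F E → B) y) :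
    dFibre IB e y (gammaVert IB y γ Φ).1 = ∑ μ, (e ⟨y.proj, γ (EuclideanSpace.proj μ)
      (vertCoord IB y (Φ (EuclideanSpace.single μ 1)))⟩).2 := by
  rw [gammaVert, dFibre_vertLift e hy, fibre_sum e hy]

/-- The components of a tangent vector of a vector bundle in the coordinates centred at `y₀`. -/
lemma tangent_coord {y₀ y : TotalSpace F E}
    (hy : y.proj ∈ (chartAt HB y₀.proj).source)
    (hy' : y.proj ∈ (trivializationAt F E y₀.proj).baseSet)
    (w : TangentSpace (IB.prod 𝓘(ℝ, F)) y) :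
    ((trivializationAt (EB × F) (TangentSpace (IB.prod 𝓘(ℝ, F))) y₀).continuousLinearMapAt ℝ y w :
      EB × F) =
    ((trivializationAt EB (TangentSpace IB) y₀.proj).continuousLinearMapAt ℝ y.proj
      (dProj IB F E y w), dFibre IB (trivializationAt F E y₀.proj) y w) := by
  have hsrc : y ∈ (chartAt (ModelProd HB F) y₀).source := by
    rw [FiberBundle.chartedSpace_chartAt]
    have h1 : y ∈ (trivializationAt F E y₀.proj).source := Trivialization.mem_source _ |>.mpr hy'
    simp only [mfld_simps]
    exact ⟨h1, by rw [Trivialization.coe_fst' _ hy']; exact hy⟩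
  rw [TangentBundle.continuousLinearMapAt_trivializationAt hsrc,
    TangentBundle.continuousLinearMapAt_trivializationAt hy]
  have hd : MDifferentiableAt (IB.prod 𝓘(ℝ, F)) 𝓘(ℝ, EB × F) (extChartAt (IB.prod 𝓘(ℝ, F)) y₀) y :=
    mdifferentiableAt_extChartAt hsrc
  have hdB : MDifferentiableAt IB 𝓘(ℝ, EB) (extChartAt IB y₀.proj) y.proj :=
    mdifferentiableAt_extChartAt hy
  have hev : ∀ᶠ p in 𝓝 y, extChartAt (IB.prod 𝓘(ℝ, F)) y₀ p =
      (extChartAt IB y₀.proj p.proj, (trivializationAt F E y₀.proj p).2) := by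
    filter_upwards [(trivializationAt F E y₀.proj).open_source.mem_nhds
      ((Trivialization.mem_source _).mpr hy')] with p hp
    rw [FiberBundle.extChartAt]
    simp only [mfld_simps]
    rw [Trivialization.coe_fst _ hp]
  have h1 := mfderiv_comp y
    (g := (ContinuousLinearMap.fst ℝ EB F)) (ContinuousLinearMap.mdifferentiableAt _) hd
  have h2 := mfderiv_comp y
    (g := (ContinuousLinearMap.snd ℝ EB F)) (ContinuousLinearMap.mdifferentiableAt _) hd
  rw [ContinuousLinearMap.mfderiv_eq] at h1 h2
  have e1 : (ContinuousLinearMap.fst ℝ EB F) ∘ (extChartAt (IB.prod 𝓘(ℝ, F)) y₀) =ᶠ[𝓝 y]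
      (extChartAt IB y₀.proj) ∘ (TotalSpace.proj : TotalSpace F E → B) := by
    filter_upwards [hev] with p hp
    simp only [Function.comp, hp]
    rfl
  have e2 : (ContinuousLinearMap.snd ℝ EB F) ∘ (extChartAt (IB.prod 𝓘(ℝ, F)) y₀) =ᶠ[𝓝 y]
      (fun p => (trivializationAt F E y₀.proj p).2) := by
    filter_upwards [hev] with p hp
    simp only [Function.comp, hp]
    rfl
  rw [e1.mfderiv_eq, mfderiv_comp y hdB
    ((contMDiffAt_proj E (n := 1)).mdifferentiableAt one_ne_zero)] at h1
  rw [e2.mfderiv_eq] at h2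
  exact Prod.ext (congrArg (fun T => (T w : EB)) h1).symm (congrArg (fun T => (T w : F)) h2).symm

/-- A family of tangent vectors of a vector bundle is smooth if its projection and its fibre
component are. -/
lemma smoothVec_of_proj_of_fibre {EN : Type*} [NormedAddCommGroup EN] [NormedSpace ℝ EN]
    {HN : Type*} [TopologicalSpace HN] {IN : ModelWithCorners ℝ EN HN} {N : Type*}
    [TopologicalSpace N] [ChartedSpace HN N] {g : N → TotalSpace F E}
    {w : ∀ t, TangentSpace (IB.prod 𝓘(ℝ, F)) (g t)} {t₀ : N}
    (hg : ContMDiffAt IN (IB.prod 𝓘(ℝ, F)) ∞ g t₀)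
    (h1 : SmoothVec IN IB (fun t => (g t).proj) (fun t => dProj IB F E (g t) (w t)) t₀)
    (h2 : ContMDiffAt IN 𝓘(ℝ, F) ∞
      (fun t => dFibre IB (trivializationAt F E (g t₀).proj) (g t) (w t)) t₀) :
    SmoothVec IN (IB.prod 𝓘(ℝ, F)) g w t₀ := by
  refine contMDiffAt_totalSpace.mpr ⟨hg, ?_⟩
  have h3 := (contMDiffAt_totalSpace.mp h1).2
  refine (h3.prodMk_space h2).congr_of_eventuallyEq ?_
  have c := h1.base.continuousAt
  filter_upwards [c.eventually ((chartAt HB (g t₀).proj).open_source.mem_nhds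
    (mem_chart_source HB (g t₀).proj)), c.eventually ((trivializationAt F E
      (g t₀).proj).open_baseSet.mem_nhds (mem_baseSet_trivializationAt F E (g t₀).proj))]
    with t ht ht'
  have hb : g t ∈ (trivializationAt (EB × F) (TangentSpace (IB.prod 𝓘(ℝ, F))) (g t₀)).baseSet := by
    rw [TangentBundle.trivializationAt_baseSet, FiberBundle.chartedSpace_chartAt]
    simp only [mfld_simps]
    exact ⟨(Trivialization.mem_source _).mpr ht', by rw [Trivialization.coe_fst' _ ht']; exact ht⟩
  have hb' : (g t).proj ∈ (trivializationAt EB (TangentSpace IB) (g t₀).proj).baseSet := by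
    rw [TangentBundle.trivializationAt_baseSet]; exact ht
  have := tangent_coord (IB := IB) ht ht' (w t)
  rw [Trivialization.continuousLinearMapAt_apply,
    Trivialization.continuousLinearMapAt_apply,
    Trivialization.linearMapAt_apply, if_pos hb, Trivialization.linearMapAt_apply,
    if_pos hb'] at this
  exact this

/-- A connection on a vector bundle is smooth if its fibre components are. -/
lemma conn_smooth [FiniteDimensional ℝ EB]
    (jet : ∀ y, Jet1 IB (IB.prod 𝓘(ℝ, F)) (TotalSpace.proj : TotalSpace F E → B) y)
    {y₀ : TotalSpace F E}
    (h : ∀ w : ∀ y : TotalSpace F E, TangentSpace IB y.proj,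
      SmoothVec (IB.prod 𝓘(ℝ, F)) IB (fun y => y.proj) w y₀ →
      ContMDiffAt (IB.prod 𝓘(ℝ, F)) 𝓘(ℝ, F) ∞
        (fun y => dFibre IB (trivializationAt F E y₀.proj) y ((jet y).1 (w y))) y₀) :
    ContMDiffAt (IB.prod 𝓘(ℝ, F)) 𝓘(ℝ, EB →L[ℝ] (EB × F)) ∞
      (inTangentCoordinates IB (IB.prod 𝓘(ℝ, F)) (TotalSpace.proj : TotalSpace F E → B) id
        (fun y => (jet y).1) y₀) y₀ := by
  refine contMDiffAt_inTangentCoordinates fun v => ?_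
  have hw := smoothVec_symmL (IN := IB.prod 𝓘(ℝ, F)) (I := IB)
    (g := (TotalSpace.proj : TotalSpace F E → B)) (t₀ := y₀) (contMDiffAt_proj E) v
  refine smoothVec_of_proj_of_fibre contMDiffAt_id ?_ (h _ hw)
  have hj : ∀ y : TotalSpace F E, ∀ v : TangentSpace IB y.proj, dProj IB F E y ((jet y).1 v) = v :=
    fun y v => congrArg (fun T => T v) (jet y).2
  simp only [id, hj]
  exact hw

end bundleTangent

/-! ### Matrix valued functions -/

section matrices

variable {E : Type*} [NormedAddCommGroup E] [NormedSpace ℝ E] {H : Type*} [TopologicalSpace H]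
  {I : ModelWithCorners ℝ E H} {M : Type*} [TopologicalSpace M] [ChartedSpace H M]

lemma contMDiffAt_matrix_mul {f g : M → Mat4} {x : M}
    (hf : ∀ i j, ContMDiffAt I 𝓘(ℝ, ℝ) ∞ (fun y => f y i j) x)
    (hg : ∀ i j, ContMDiffAt I 𝓘(ℝ, ℝ) ∞ (fun y => g y i j) x) (i j : Fin 4) :
    ContMDiffAt I 𝓘(ℝ, ℝ) ∞ (fun y => (f y * g y) i j) x := by
  simp only [Matrix.mul_apply]
  exact contMDiffAt_finsetSum fun k _ => (hf i k).mul (hg k j)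

lemma contMDiffAt_matrix_det {f : M → Mat4} {x : M}
    (hf : ∀ i j, ContMDiffAt I 𝓘(ℝ, ℝ) ∞ (fun y => f y i j) x) :
    ContMDiffAt I 𝓘(ℝ, ℝ) ∞ (fun y => (f y).det) x := by
  simp only [Matrix.det_apply]
  refine contMDiffAt_finsetSum fun σ _ => ?_
  have hp : ContMDiffAt I 𝓘(ℝ, ℝ) ∞ (fun y => ∏ i, f y (σ i) i) x :=
    contMDiffAt_finsetProd (t := Finset.univ) (f := fun i y => f y (σ i) i) fun i _ => hf (σ i) i
  have hc : ContMDiffAt I 𝓘(ℝ, ℝ) ∞ (fun _ : M => ((Equiv.Perm.sign σ : ℤ) : ℝ)) x :=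
    contMDiffAt_const
  refine (hc.mul hp).congr_of_eventuallyEq (Filter.Eventually.of_forall fun y => ?_)
  simp [Units.smul_def]

lemma contMDiffAt_matrix_inv {f : M → Mat4} {x : M}
    (hf : ∀ i j, ContMDiffAt I 𝓘(ℝ, ℝ) ∞ (fun y => f y i j) x) (hx : (f x).det ≠ 0)
    (i j : Fin 4) : ContMDiffAt I 𝓘(ℝ, ℝ) ∞ (fun y => (f y)⁻¹ i j) x := by
  have h1 : ∀ y, (f y)⁻¹ i j = ((f y).det)⁻¹ * ((f y).updateRow j (Pi.single i 1)).det := by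
    intro y
    rw [Matrix.inv_def, Matrix.smul_apply, Matrix.adjugate_apply, Ring.inverse_eq_inv', smul_eq_mul]
  simp only [h1]
  refine ((contMDiffAt_matrix_det hf).inv₀ hx).mul (contMDiffAt_matrix_det fun k l => ?_)
  by_cases hk : k = j
  · subst hk
    simp only [Matrix.updateRow_self]
    exact contMDiffAt_const
  · simp only [Matrix.updateRow_ne hk]
    exact hf k l

variable (I) in
/-- The differential of a matrix valued function, evaluated on a tangent vector. -/
def dMat (f : M → Mat4) (x : M) (w : TangentSpace I x) : Mat4 :=
  Matrix.of fun i j => mvfderiv I (fun y => f y i j) x w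

lemma dMat_apply (f : M → Mat4) (x : M) (w : TangentSpace I x) (i j : Fin 4) :
    dMat I f x w i j = mvfderiv I (fun y => f y i j) x w := rfl

lemma mvfderiv_sum_apply {F : Type*} [NormedAddCommGroup F] [NormedSpace ℝ F] {κ : Type}
    (s : Finset κ) {f : κ → M → F} {x : M}
    (hf : ∀ k ∈ s, MDifferentiableAt I 𝓘(ℝ, F) (f k) x) (w : TangentSpace I x) :
    mvfderiv I (fun y => ∑ k ∈ s, f k y) x w = ∑ k ∈ s, mvfderiv I (f k) x w := by
  classical
  induction s using Finset.induction_on with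
  | empty =>
    simp only [Finset.sum_empty]
    rw [mvfderiv_const]
    rfl
  | insert k s hk ih =>
    simp only [Finset.sum_insert hk]
    have hs : MDifferentiableAt I 𝓘(ℝ, F) (fun y => ∑ k ∈ s, f k y) x := by
      have e : (fun y => ∑ k ∈ s, f k y) = ∑ k ∈ s, f k := funext fun y => by
        rw [Finset.sum_apply]
      rw [e]
      exact MDifferentiableAt.sum fun k hk => hf k (Finset.mem_insert_of_mem hk)
    rw [mvfderiv_fun_add (hf k (Finset.mem_insert_self k s)) hs, add_apply,
      ih fun k hk => hf k (Finset.mem_insert_of_mem hk)]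

lemma mvfderiv_mul_apply {f g : M → ℝ} {x : M} (hf : MDifferentiableAt I 𝓘(ℝ, ℝ) f x)
    (hg : MDifferentiableAt I 𝓘(ℝ, ℝ) g x) (w : TangentSpace I x) :
    mvfderiv I (fun y => f y * g y) x w =
      mvfderiv I f x w * g x + f x * mvfderiv I g x w := by
  rw [mvfderiv_fun_mul hf hg, add_apply, smul_apply, smul_apply, smul_eq_mul, smul_eq_mul]
  ring

lemma dMat_mul {f g : M → Mat4} {x : M}
    (hf : ∀ i j, MDifferentiableAt I 𝓘(ℝ, ℝ) (fun y => f y i j) x)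
    (hg : ∀ i j, MDifferentiableAt I 𝓘(ℝ, ℝ) (fun y => g y i j) x) (w : TangentSpace I x) :
    dMat I (fun y => f y * g y) x w = dMat I f x w * g x + f x * dMat I g x w := by
  ext i j
  rw [Matrix.add_apply, Matrix.mul_apply, Matrix.mul_apply, ← Finset.sum_add_distrib]
  refine (mvfderiv_sum_apply Finset.univ (f := fun k y => f y i k * g y k j)
    (fun k _ => (hf i k).mul (hg k j)) w).trans ?_
  exact Finset.sum_congr rfl fun k _ => mvfderiv_mul_apply (hf i k) (hg k j) w

lemma mvfderiv_congr {F : Type*} [NormedAddCommGroup F] [NormedSpace ℝ F] {f g : M → F} {x : M}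
    (h : f =ᶠ[𝓝 x] g) :
    mvfderiv I f x = mvfderiv I g x := by
  ext w
  exact congrArg (fun T => (T w : F)) (h.mfderiv_eq (I := I) (I' := 𝓘(ℝ, F)))

lemma dMat_congr {f g : M → Mat4} {x : M} (h : f =ᶠ[𝓝 x] g) (w : TangentSpace I x) :
    dMat I f x w = dMat I g x w := by
  ext i j
  have : (fun y => f y i j) =ᶠ[𝓝 x] fun y => g y i j := h.mono fun y hy => by simp only [hy]
  rw [dMat_apply, dMat_apply, mvfderiv_congr this]

lemma dMat_const (m : Mat4) (x : M) (w : TangentSpace I x) : dMat I (fun _ => m) x w = 0 := by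
  ext i j
  rw [dMat_apply, mvfderiv_const]
  rfl

lemma dMat_transpose (f : M → Mat4) (x : M) (w : TangentSpace I x) :
    dMat I (fun y => (f y)ᵀ) x w = (dMat I f x w)ᵀ := rfl

lemma dMat_comp {E' : Type*} [NormedAddCommGroup E'] [NormedSpace ℝ E'] {H' : Type*}
    [TopologicalSpace H'] {I' : ModelWithCorners ℝ E' H'} {M' : Type*} [TopologicalSpace M']
    [ChartedSpace H' M'] {f : M' → Mat4} {g : M → M'} {x : M}
    (hf : ∀ i j, MDifferentiableAt I' 𝓘(ℝ, ℝ) (fun y => f y i j) (g x))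
    (hg : MDifferentiableAt I I' g x) (w : TangentSpace I x) :
    dMat I (fun y => f (g y)) x w = dMat I' f (g x) (mfderiv I I' g x w) := by
  ext i j
  exact congrArg (fun T => (T w : ℝ)) (mfderiv_comp x (hf i j) hg)

end matrices

/-! ### Frames in the charts of the base manifold -/

section frames

variable {X : Type*} [TopologicalSpace X] [ChartedSpace E4 X] [IsManifold 𝓘(ℝ, E4) ∞ X]

lemma mfderiv_atlas (c : atlas E4 X) {x : X} (hx : x ∈ c.1.source)
    (v : TangentSpace 𝓘(ℝ, E4) x) : (mfderiv 𝓘(ℝ, E4) 𝓘(ℝ, E4) c.1 x v : E4) =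
      (tangentBundleCore 𝓘(ℝ, E4) X).coordChange (achart E4 x) c x v := by
  have h := mdifferentiableAt_atlas (I := 𝓘(ℝ, E4)) c.2 hx
  rw [tangentBundleCore_coordChange, h.mfderiv]
  rfl

lemma contMDiffAt_atlas (c : atlas E4 X) {x : X} (hx : x ∈ c.1.source) :
    ContMDiffAt 𝓘(ℝ, E4) 𝓘(ℝ, E4) ∞ c.1 x :=
  (contMDiffOn_of_mem_maximalAtlas (IsManifold.subset_maximalAtlas c.2)).contMDiffAt
    (c.1.open_source.mem_nhds hx)

lemma contMDiffAt_atlas_symm (c : atlas E4 X) {x : X} (hx : x ∈ c.1.source) :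
    ContMDiffAt 𝓘(ℝ, E4) 𝓘(ℝ, E4) ∞ c.1.symm (c.1 x) :=
  (contMDiffOn_symm_of_mem_maximalAtlas (IsManifold.subset_maximalAtlas c.2)).contMDiffAt
    (c.1.open_target.mem_nhds (c.1.map_source hx))

lemma contMDiffAt_atlas_coord (c : atlas E4 X) {x : X} (hx : x ∈ c.1.source) (μ : Fin 4) :
    ContMDiffAt 𝓘(ℝ, E4) 𝓘(ℝ, ℝ) ∞ (fun x' => c.1 x' μ) x :=
  (EuclideanSpace.proj μ : E4 →L[ℝ] ℝ).contMDiff.contMDiffAt.comp x (contMDiffAt_atlas c hx)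

lemma dcoord_apply (c : atlas E4 X) {x : X} (hx : x ∈ c.1.source) (μ : Fin 4)
    (v : TangentSpace 𝓘(ℝ, E4) x) : dcoord c μ x v =
      (tangentBundleCore 𝓘(ℝ, E4) X).coordChange (achart E4 x) c x v μ := by
  have h := mdifferentiableAt_atlas (I := 𝓘(ℝ, E4)) c.2 hx
  have hc := mfderiv_comp x (g := (EuclideanSpace.proj μ : E4 →L[ℝ] ℝ))
    (ContinuousLinearMap.mdifferentiableAt _) h
  rw [ContinuousLinearMap.mfderiv_eq] at hc
  refine (congrArg (fun T => (T v : ℝ)) hc).trans ?_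
  exact congrArg (fun u : E4 => u μ) (mfderiv_atlas c hx v)

lemma dcoord_eq_sum (c : atlas E4 X) {x : X} (hx : x ∈ c.1.source) (μ : Fin 4)
    (v : TangentSpace 𝓘(ℝ, E4) x) :
    dcoord c μ x v = ∑ ν, jacMat (achart E4 x) c x μ ν * (v : E4).ofLp ν := by
  rw [dcoord_apply c hx]
  exact matOf_apply_vec _ _ _

lemma coordField_apply (c : atlas E4 X) (lam : Fin 4) (x : X) (μ : Fin 4) :
    (coordField c lam x : E4).ofLp μ = jacMat c (achart E4 x) x μ lam := rfl

lemma dcoord_coordField (c : atlas E4 X) {x : X} (hx : x ∈ c.1.source) (μ lam : Fin 4) :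
    dcoord c μ x (coordField c lam x) = if μ = lam then 1 else 0 := by
  rw [dcoord_eq_sum c hx]
  simp only [coordField_apply]
  rw [← Matrix.mul_apply, jacMat_mul _ _ _ hx (mem_chart_source E4 x) hx, jacMat_self _ hx,
    Matrix.one_apply]

/-- A tangent vector is determined by its components in a chart. -/
lemma dcoord_ext (c : atlas E4 X) {x : X} (hx : x ∈ c.1.source) {v w : TangentSpace 𝓘(ℝ, E4) x}
    (h : ∀ μ, dcoord c μ x v = dcoord c μ x w) : v = w := by
  have hx' := mem_chart_source E4 x
  have e : ∀ u : TangentSpace 𝓘(ℝ, E4) x, (tangentBundleCore 𝓘(ℝ, E4) X).coordChange c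
      (achart E4 x) x ((tangentBundleCore 𝓘(ℝ, E4) X).coordChange (achart E4 x) c x u) = u :=
    fun u => ((tangentBundleCore 𝓘(ℝ, E4) X).coordChange_comp (achart E4 x) c (achart E4 x) x
      ⟨⟨hx', hx⟩, hx'⟩ u).trans ((tangentBundleCore 𝓘(ℝ, E4) X).coordChange_self (achart E4 x) x hx' u)
  have h2 : (tangentBundleCore 𝓘(ℝ, E4) X).coordChange (achart E4 x) c x v =
      (tangentBundleCore 𝓘(ℝ, E4) X).coordChange (achart E4 x) c x w := by
    refine (WithLp.ofLp_injective 2) (funext fun μ => ?_)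
    exact (dcoord_apply c hx μ v).symm.trans ((h μ).trans (dcoord_apply c hx μ w))
  rw [← e v, h2, e w]

lemma eq_sum_coordField (c : atlas E4 X) {x : X} (hx : x ∈ c.1.source)
    (v : TangentSpace 𝓘(ℝ, E4) x) : v = ∑ μ, dcoord c μ x v • coordField c μ x := by
  refine dcoord_ext c hx fun μ => ?_
  rw [map_sum]
  simp only [map_smul, dcoord_coordField c hx, smul_eq_mul]
  simp

/-- Linear functions of a tangent vector in the coordinates of a chart. -/
lemma clm_eq_sum (c : atlas E4 X) {x : X} (hx : x ∈ c.1.source)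
    {W : Type*} [NormedAddCommGroup W] [NormedSpace ℝ W] (T : TangentSpace 𝓘(ℝ, E4) x →L[ℝ] W)
    (v : TangentSpace 𝓘(ℝ, E4) x) : T v = ∑ μ, dcoord c μ x v • T (coordField c μ x) := by
  conv_lhs => rw [eq_sum_coordField c hx v, map_sum]
  simp only [map_smul]

lemma coordField_eq_mfderiv (c : atlas E4 X) (lam : Fin 4) {x : X} (hx : x ∈ c.1.source) :
    coordField c lam x =
      mfderiv 𝓘(ℝ, E4) 𝓘(ℝ, E4) c.1.symm (c.1 x) (EuclideanSpace.single lam (1 : ℝ)) := by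
  have hs : MDifferentiableAt 𝓘(ℝ, E4) 𝓘(ℝ, E4) c.1.symm (c.1 x) :=
    (contMDiffAt_atlas_symm c hx).mdifferentiableAt (by simp)
  refine dcoord_ext c hx fun μ => ?_
  have hμ : MDifferentiableAt 𝓘(ℝ, E4) 𝓘(ℝ, ℝ) (fun x' => c.1 x' μ) x :=
    (contMDiffAt_atlas_coord c hx μ).mdifferentiableAt (by simp)
  have hc := mvfderiv_comp_apply_of_eq (c.1 x) hμ hs (c.1.left_inv hx)
    (EuclideanSpace.single lam (1 : ℝ))
  have he : (fun x' => c.1 x' μ) ∘ c.1.symm =ᶠ[𝓝 (c.1 x)] (EuclideanSpace.proj μ : E4 →L[ℝ] ℝ) := by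
    filter_upwards [c.1.open_target.mem_nhds (c.1.map_source hx)] with u hu
    exact congrArg (fun z : E4 => z μ) (c.1.right_inv hu)
  rw [mvfderiv_congr he] at hc
  rw [dcoord_coordField c hx]
  refine Eq.trans ?_ hc
  have h2 := congrArg (fun T => (T (EuclideanSpace.single lam (1 : ℝ)) : ℝ))
    ((EuclideanSpace.proj μ : E4 →L[ℝ] ℝ).mfderiv_eq (x := c.1 x))
  refine Eq.trans ?_ h2.symm
  exact (PiLp.single_apply 2 ℝ lam (1 : ℝ) μ).symm

lemma smooth_coordField (c : atlas E4 X) (lam : Fin 4) {x : X} (hx : x ∈ c.1.source) :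
    SmoothVec 𝓘(ℝ, E4) 𝓘(ℝ, E4) (fun x' : X => x') (coordField c lam) x := by
  have h0 : SmoothVec 𝓘(ℝ, E4) 𝓘(ℝ, E4) (fun u : E4 => u)
      (fun _ => (EuclideanSpace.single lam (1 : ℝ) : E4)) (c.1 x) := by
    refine (contMDiffAt_totalSpace (IB := 𝓘(ℝ, E4)) (F := E4)).mpr ⟨contMDiffAt_id, ?_⟩
    refine (contMDiffAt_const (c := (EuclideanSpace.single lam (1 : ℝ) : E4))).congr_of_eventuallyEq
      (Filter.Eventually.of_forall fun u => ?_)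
    simp
  have h1 := SmoothVec.comp (k := c.1) (SmoothVec.map (contMDiffAt_atlas_symm c hx) h0)
    (contMDiffAt_atlas c hx)
  refine ContMDiffAt.congr_of_eventuallyEq h1 ?_
  filter_upwards [c.1.open_source.mem_nhds hx] with x' hx'
  have := coordField_eq_mfderiv c lam hx'
  have h2 : ∀ (z : X), z = x' → ∀ (v : E4), (⟨x', v⟩ : TangentBundle 𝓘(ℝ, E4) X) = ⟨z, v⟩ := by
    rintro z rfl v; rfl
  refine (congrArg (fun v : E4 => (⟨x', v⟩ : TangentBundle 𝓘(ℝ, E4) X)) this).trans ?_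
  exact h2 _ (c.1.left_inv hx') _

lemma Frame.matIn_apply {x : X} (c : atlas E4 X) (f : Frame x) (μ a : Fin 4) :
    f.matIn c μ a =
      (tangentBundleCore 𝓘(ℝ, E4) X).coordChange (achart E4 x) c x (f.vec a) μ :=
  (congrFun (congrFun (frameMat_map ((tangentBundleCore 𝓘(ℝ, E4) X).coordChange
    (achart E4 x) c x) f.vec) μ) a).symm

lemma Frame.matIn_eq_dcoord {x : X} (c : atlas E4 X) (hx : x ∈ c.1.source) (f : Frame x)
    (μ a : Fin 4) : f.matIn c μ a = dcoord c μ x (f.vec a) :=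
  (f.matIn_apply c μ a).trans (dcoord_apply c hx μ _).symm

lemma Frame.vec_eq_sum {x : X} (c : atlas E4 X) (hx : x ∈ c.1.source) (f : Frame x) (a : Fin 4) :
    f.vec a = ∑ μ, f.matIn c μ a • coordField c μ x := by
  simp only [f.matIn_eq_dcoord c hx]
  exact eq_sum_coordField c hx _

variable [OrientedAtlas X]

lemma Frame.det_matIn_pos {x : X} (c : atlas E4 X) (hx : x ∈ c.1.source) (f : Frame x) :
    0 < (f.matIn c).det := by
  rw [Frame.matIn, Matrix.det_mul]
  exact mul_pos (OrientedAtlas.det_pos _ _ _ (mem_chart_source E4 x) hx) f.pos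

lemma contMDiff_pt : ContMDiff 𝓘(ℝ, E4 × LowTri) 𝓘(ℝ, E4) ∞ (Tetrads.pt : Tetrads X → X) := by
  intro σ
  have h1 : ContMDiffAt 𝓘(ℝ, E4 × LowTri) 𝓘(ℝ, E4 × LowTri) ∞
      (chartAt (E4 × LowTri) σ) σ := contMDiffOn_chart.contMDiffAt
        ((chartAt (E4 × LowTri) σ).open_source.mem_nhds (mem_chart_source _ σ))
  have h2 : ContMDiffAt 𝓘(ℝ, E4 × LowTri) 𝓘(ℝ, E4) ∞ (Prod.fst : E4 × LowTri → E4)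
      (chartAt (E4 × LowTri) σ σ) := contDiff_fst.contMDiff.contMDiffAt
  have h3 : ContMDiffAt 𝓘(ℝ, E4) 𝓘(ℝ, E4) ∞ (chartAt E4 σ.pt).symm
      (chartAt (E4 × LowTri) σ σ).1 :=
    contMDiffOn_chart_symm.contMDiffAt ((chartAt E4 σ.pt).open_target.mem_nhds
      ((chartAt E4 σ.pt).map_source (mem_chart_source E4 σ.pt)))
  refine (h3.comp σ (h2.comp σ h1)).congr_of_eventuallyEq ?_
  filter_upwards [(chartAt (E4 × LowTri) σ).open_source.mem_nhds (mem_chart_source _ σ)] with τ hτ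
  exact ((chartAt E4 σ.pt).left_inv hτ.1).symm

lemma contMDiffAt_pt (σ : Tetrads X) :
    ContMDiffAt 𝓘(ℝ, E4 × LowTri) 𝓘(ℝ, E4) ∞ (Tetrads.pt : Tetrads X → X) σ := contMDiff_pt σ

lemma dcoordTet_apply (c : atlas E4 X) {σ : Tetrads X} (hσ : σ.pt ∈ c.1.source) (μ : Fin 4)
    (w : TangentSpace 𝓘(ℝ, E4 × LowTri) σ) : dcoordTet c μ σ w =
      dcoord c μ σ.pt (mfderiv 𝓘(ℝ, E4 × LowTri) 𝓘(ℝ, E4) Tetrads.pt σ w) :=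
  congrArg (fun T => (T w : ℝ)) (mfderiv_comp σ
    ((contMDiffAt_atlas_coord c hσ μ).mdifferentiableAt (by simp))
    ((contMDiffAt_pt σ).mdifferentiableAt (by simp)))

variable {ι : Type*} (P : SpinLift X ι)

/-- The points of `U_i` over the domain of the chart `c` form a neighbourhood of each of them. -/
lemma eventually_mem_base {i : ι} {c : atlas E4 X} {σ : Tetrads X} (hi : σ ∈ P.baseSet i)
    (hc : σ.pt ∈ c.1.source) : ∀ᶠ τ in 𝓝 σ, τ ∈ P.baseSet i ∧ τ.pt ∈ c.1.source :=
  ((P.isOpen_baseSet i).mem_nhds hi |> Filter.Eventually.and <|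
    (contMDiffAt_pt σ).continuousAt.eventually (c.1.open_source.mem_nhds hc) :)

/-- The matrix `(σ^μ_a)` of the coordinates on `Σ`. -/
def SpinLift.sigMat (i : ι) (c : atlas E4 X) (σ : Tetrads X) : Mat4 := (P.frame i σ).matIn c

lemma det_sigMat_pos (i : ι) {c : atlas E4 X} {σ : Tetrads X} (hc : σ.pt ∈ c.1.source) :
    0 < (P.sigMat i c σ).det := (P.frame i σ).det_matIn_pos c hc

lemma isUnit_sigMat (i : ι) {c : atlas E4 X} {σ : Tetrads X} (hc : σ.pt ∈ c.1.source) :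
    IsUnit (P.sigMat i c σ).det := (det_sigMat_pos P i hc).ne'.isUnit

lemma smooth_sigMat {i : ι} {c : atlas E4 X} {σ : Tetrads X} (hi : σ ∈ P.baseSet i)
    (hc : σ.pt ∈ c.1.source) (μ a : Fin 4) :
    ContMDiffAt 𝓘(ℝ, E4 × LowTri) 𝓘(ℝ, ℝ) ∞ (fun τ => P.sigMat i c τ μ a) σ := by
  have h : SmoothVec 𝓘(ℝ, E4 × LowTri) 𝓘(ℝ, E4) (fun τ : Tetrads X => τ.pt)
      (fun τ => (P.frame i τ).vec a) σ :=
    (P.frame_smooth i a).contMDiffAt ((P.isOpen_baseSet i).mem_nhds hi)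
  refine (h.map_apply (contMDiffAt_atlas_coord c hc μ)).congr_of_eventuallyEq ?_
  filter_upwards [(contMDiffAt_pt σ).continuousAt.eventually (c.1.open_source.mem_nhds hc)]
    with τ hτ
  exact (P.frame i τ).matIn_eq_dcoord c hτ μ a

lemma smooth_sigMat_inv {i : ι} {c : atlas E4 X} {σ : Tetrads X} (hi : σ ∈ P.baseSet i)
    (hc : σ.pt ∈ c.1.source) (a μ : Fin 4) :
    ContMDiffAt 𝓘(ℝ, E4 × LowTri) 𝓘(ℝ, ℝ) ∞ (fun τ => (P.sigMat i c τ)⁻¹ a μ) σ :=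
  contMDiffAt_matrix_inv (smooth_sigMat P hi hc) (det_sigMat_pos P i hc).ne' a μ

/-- The matrix of the transition functions `z_j⁻¹ z_i`. -/
def SpinLift.lorMat (i j : ι) (σ : Tetrads X) : Mat4 :=
  (P.frame j σ).mat⁻¹ * (P.frame i σ).mat

lemma det_frame_mat {x : X} (f : Frame x) : IsUnit f.mat.det := f.pos.ne'.isUnit

lemma frame_mat_eq (i j : ι) (σ : Tetrads X) :
    (P.frame i σ).mat = (P.frame j σ).mat * P.lorMat i j σ := by
  rw [SpinLift.lorMat, Matrix.mul_nonsing_inv_cancel_left _ _ (det_frame_mat _)]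

lemma sigMat_eq (i j : ι) (c : atlas E4 X) (σ : Tetrads X) :
    P.sigMat i c σ = P.sigMat j c σ * P.lorMat i j σ :=
  Frame.matIn_of_rel c (frame_mat_eq P i j σ)

lemma lorMat_eq (i j : ι) {c : atlas E4 X} {σ : Tetrads X} (hc : σ.pt ∈ c.1.source) :
    P.lorMat i j σ = (P.sigMat j c σ)⁻¹ * P.sigMat i c σ := by
  rw [sigMat_eq P i j c, Matrix.nonsing_inv_mul_cancel_left _ _ (isUnit_sigMat P j hc)]

lemma isLorentz_lorMat {i j : ι} {σ : Tetrads X} (hi : σ ∈ P.baseSet i) (hj : σ ∈ P.baseSet j) :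
    IsLorentz (P.lorMat i j σ) := by
  have h : (P.frame i σ).toTetrads = (P.frame j σ).toTetrads :=
    (P.frame_section i σ hi).trans (P.frame_section j σ hj).symm
  have h2 : Quotient.mk (frameSetoid σ.pt) (P.frame j σ) = Quotient.mk _ (P.frame i σ) := by
    simp only [Frame.toTetrads, Tetrads.mk.injEq, heq_eq_eq, true_and] at h
    exact h.symm
  obtain ⟨l, hl, e⟩ := Quotient.exact h2
  rw [SpinLift.lorMat, e, Matrix.nonsing_inv_mul_cancel_left _ _ (det_frame_mat _)]
  exact hl

lemma smooth_lorMat {i j : ι} {σ : Tetrads X} (hi : σ ∈ P.baseSet i) (hj : σ ∈ P.baseSet j)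
    (a b : Fin 4) :
    ContMDiffAt 𝓘(ℝ, E4 × LowTri) 𝓘(ℝ, ℝ) ∞ (fun τ => P.lorMat i j τ a b) σ := by
  have hc : σ.pt ∈ (achart E4 σ.pt).1.source := mem_chart_source E4 σ.pt
  refine (contMDiffAt_matrix_mul (smooth_sigMat_inv P hj hc) (smooth_sigMat P hi hc)
    a b).congr_of_eventuallyEq ?_
  filter_upwards [eventually_mem_base P hi hc] with τ hτ
  rw [lorMat_eq P i j hτ.2]

end frames

/-! ### The composite spinor bundle in its trivializations -/

section spinorBundle

variable {X : Type*} [TopologicalSpace X] [ChartedSpace E4 X] [IsManifold 𝓘(ℝ, E4) ∞ X]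
  [OrientedAtlas X] {ι : Type*} (P : SpinLift X ι)
  {V : Type*} [NormedAddCommGroup V] [NormedSpace ℂ V] [FiniteDimensional ℂ V]
  (𝒮 : SpinorSpace V)

instance (i : ι) : MemTrivializationAtlas ((P.core 𝒮).localTriv i) := ⟨⟨i, rfl⟩⟩

lemma fib_change {i j : ι} {y : P.S 𝒮} (hi : y.proj ∈ P.baseSet i) (hj : y.proj ∈ P.baseSet j) :
    P.fib 𝒮 j y = 𝒮.act (P.trans i j y.proj) (P.fib 𝒮 i y) := by
  have h := P.trans_comp (P.indexAt y.proj) i j y.proj ⟨⟨P.mem_baseSet_at _, hi⟩, hj⟩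
  exact (congrArg (fun t => 𝒮.act t y.2) h.symm).trans (𝒮.act_mul _ _ _)

lemma sum_gamma (r : Fin 4 → ℝ) (u : V) :
    ∑ a, r a • 𝒮.gamma a u = 𝒮.act (CliffordAlgebra.ι minkQ r) u := by
  rw [ι_eq_sum, act_sum]
  exact Finset.sum_congr rfl fun a _ => (act_smul 𝒮 _ _ _).symm

/-- In the trivialization over `U_i`, a covector acts by Clifford multiplication with its components
in the frame `z_i`; the spin cocycle covers the change of frames, so this does not depend on `i`. -/
lemma fib_gammaSigma {i : ι} {σ : Tetrads X} (hi : σ ∈ P.baseSet i)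
    (α : TangentSpace 𝓘(ℝ, E4) σ.pt →L[ℝ] ℝ) (u : (P.core 𝒮).Fiber σ) :
    P.fib 𝒮 i ⟨σ, P.gammaSigma 𝒮 σ α u⟩ =
      ∑ a, α ((P.frame i σ).vec a) • 𝒮.gamma a (P.fib 𝒮 i ⟨σ, u⟩) := by
  have hk := P.mem_baseSet_at σ
  have h1 : P.fib 𝒮 (P.indexAt σ) ⟨σ, P.gammaSigma 𝒮 σ α u⟩ =
      ∑ a, α ((P.frame (P.indexAt σ) σ).vec a) • 𝒮.gamma a (P.fib 𝒮 (P.indexAt σ) ⟨σ, u⟩) :=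
    congrArg Prod.snd (((P.core 𝒮).localTriv (P.indexAt σ)).apply_mk_symm hk _)
  have e1 := fib_change P 𝒮 (y := ⟨σ, P.gammaSigma 𝒮 σ α u⟩) hk hi
  have e2 := fib_change P 𝒮 (y := ⟨σ, u⟩) hk hi
  rw [e1, e2, h1, sum_gamma 𝒮 (fun a => α ((P.frame (P.indexAt σ) σ).vec a)),
    sum_gamma 𝒮 (fun a => α ((P.frame i σ).vec a)), ← 𝒮.act_mul, ← 𝒮.act_mul]
  exact congrArg (fun t => 𝒮.act t (P.fib 𝒮 (P.indexAt σ) ⟨σ, u⟩))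
    (P.trans_covers (P.indexAt σ) i σ ⟨hk, hi⟩ α)

lemma vec_eq_sum_sig (i : ι) (c : atlas E4 X) {σ : Tetrads X} (hc : σ.pt ∈ c.1.source)
    (a : Fin 4) : (P.frame i σ).vec a = ∑ lam, P.sig i c lam a σ • coordField c lam σ.pt :=
  (P.frame i σ).vec_eq_sum c hc a

/-- The total Dirac operator in the frame `z_i`. -/
lemma dfib_totalDirac_frame (A : P.ConnS 𝒮) (y : P.S 𝒮) (φ : P.JetS 𝒮 y) {i : ι}
    (hi : y.proj ∈ P.baseSet i) : P.dfib 𝒮 i y (P.totalDirac 𝒮 A y φ).1 =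
      ∑ a, 𝒮.gamma a (P.dfib 𝒮 i y (vertCovDiff A Tetrads.pt φ ((P.frame i y.proj).vec a)).1) := by
  have h := dFibre_gammaVert (IB := 𝓘(ℝ, E4 × LowTri)) ((P.core 𝒮).localTriv i) (y := y) hi
    (P.gammaSigma 𝒮 y.proj) (vertCovDiff A Tetrads.pt φ)
  refine h.trans ?_
  have h2 : ∀ μ, (((P.core 𝒮).localTriv i) ⟨y.proj, P.gammaSigma 𝒮 y.proj (EuclideanSpace.proj μ)
      (vertCoord 𝓘(ℝ, E4 × LowTri) y (vertCovDiff A Tetrads.pt φ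
        (EuclideanSpace.single μ 1)))⟩).2 = ∑ a, ((P.frame i y.proj).vec a : E4).ofLp μ •
          𝒮.gamma a (P.dfib 𝒮 i y (vertCovDiff A Tetrads.pt φ (EuclideanSpace.single μ (1 : ℝ))).1) := by
    intro μ
    refine (fib_gammaSigma P 𝒮 hi _ _).trans (Finset.sum_congr rfl fun a _ => ?_)
    have := fibre_vertCoord (IB := 𝓘(ℝ, E4 × LowTri)) ((P.core 𝒮).localTriv i) (y := y) hi
      (vertCovDiff A Tetrads.pt φ (EuclideanSpace.single μ (1 : ℝ)))
    exact congrArg (fun u => ((P.frame i y.proj).vec a : E4).ofLp μ • 𝒮.gamma a u) this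
  refine (Finset.sum_congr rfl fun μ _ => h2 μ).trans ?_
  rw [Finset.sum_comm]
  refine Finset.sum_congr rfl fun a _ => ?_
  let T : E4 →ₗ[ℝ] V := (𝒮.gamma a).toLinearMap ∘ₗ (P.dfib 𝒮 i y).toLinearMap ∘ₗ
    (Submodule.subtype _) ∘ₗ (vertCovDiff A Tetrads.pt φ)
  have h3 := congrArg T (E4_eq_sum ((P.frame i y.proj).vec a))
  rw [map_sum] at h3
  refine Eq.trans ?_ h3.symm
  exact Finset.sum_congr rfl fun μ _ => (map_smul T _ _).symm

lemma dfib_totalDirac (A : P.ConnS 𝒮) (y : P.S 𝒮) (φ : P.JetS 𝒮 y) {i : ι} {c : atlas E4 X}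
    (hi : y.proj ∈ P.baseSet i) (hc : y.proj.pt ∈ c.1.source) :
    P.dfib 𝒮 i y (P.totalDirac 𝒮 A y φ).1 =
      ∑ lam, ∑ a, P.sig i c lam a y.proj • 𝒮.gamma a
        (P.dfib 𝒮 i y (φ.1 (coordField c lam y.proj.pt)) -
          P.dfib 𝒮 i y ((A.jet y).1
            (mfderiv (𝓘(ℝ, E4 × LowTri).prod 𝓘(ℝ, V)) 𝓘(ℝ, E4 × LowTri) (P.projS 𝒮) y
              (φ.1 (coordField c lam y.proj.pt))))) := by
  rw [dfib_totalDirac_frame P 𝒮 A y φ hi, Finset.sum_comm]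
  refine Finset.sum_congr rfl fun a _ => ?_
  let T : E4 →ₗ[ℝ] V := (𝒮.gamma a).toLinearMap ∘ₗ (P.dfib 𝒮 i y).toLinearMap ∘ₗ
    (Submodule.subtype _) ∘ₗ (vertCovDiff A Tetrads.pt φ)
  have h3 := congrArg T (vec_eq_sum_sig P i c hc a)
  refine h3.trans ((map_sum T _ _).trans (Finset.sum_congr rfl fun lam _ => ?_))
  refine (map_smul T _ _).trans (congrArg (fun u => P.sig i c lam a y.proj • 𝒮.gamma a u) ?_)
  exact map_sub (P.dfib 𝒮 i y) _ _

/-! ### Composite connections and smoothness of the total Dirac operator -/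

lemma mfderiv_projX (y : P.S 𝒮) :
    mfderiv (𝓘(ℝ, E4 × LowTri).prod 𝓘(ℝ, V)) 𝓘(ℝ, E4) (P.projX 𝒮) y =
      (mfderiv 𝓘(ℝ, E4 × LowTri) 𝓘(ℝ, E4) Tetrads.pt y.proj).comp
        (dProj 𝓘(ℝ, E4 × LowTri) V (P.core 𝒮).Fiber y) :=
  mfderiv_comp y ((contMDiffAt_pt y.proj).mdifferentiableAt (by simp))
    ((contMDiffAt_proj (P.core 𝒮).Fiber (n := 1)).mdifferentiableAt one_ne_zero)

/-- Horizontal lifts of smooth families of vectors are smooth. -/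
lemma SmoothVec.horizontal {EN : Type*} [NormedAddCommGroup EN] [NormedSpace ℝ EN]
    {HN : Type*} [TopologicalSpace HN] {IN : ModelWithCorners ℝ EN HN} {N : Type*}
    [TopologicalSpace N] [ChartedSpace HN N]
    {EX : Type*} [NormedAddCommGroup EX] [NormedSpace ℝ EX] {HX : Type*} [TopologicalSpace HX]
    {IX : ModelWithCorners ℝ EX HX} {X : Type*} [TopologicalSpace X] [ChartedSpace HX X]
    {EY : Type*} [NormedAddCommGroup EY] [NormedSpace ℝ EY] {HY : Type*} [TopologicalSpace HY]
    {IY : ModelWithCorners ℝ EY HY} {Y : Type*} [TopologicalSpace Y] [ChartedSpace HY Y]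
    [IsManifold IX 1 X] [IsManifold IY 1 Y] {p : Y → X} (Γ : Conn IX IY p) {g : N → Y} {t₀ : N}
    (hg : ContMDiffAt IN IY ∞ g t₀) {w : ∀ t, TangentSpace IX (p (g t))}
    (hw : SmoothVec IN IX (fun t => p (g t)) w t₀) :
    SmoothVec IN IY g (fun t => (Γ.jet (g t)).1 (w t)) t₀ :=
  SmoothVec.clm_apply (φ := fun t => (Γ.jet (g t)).1)
    (ContMDiffAt.comp (g := inTangentCoordinates IX IY p id (fun y => (Γ.jet y).1) (g t₀)) t₀
      (Γ.smooth (g t₀)) hg) hg hw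

/-- The composition of a connection on `Σ → X` with a connection on `S → Σ`. -/
def compConn (A : P.ConnS 𝒮) (Γ : Conn 𝓘(ℝ, E4) 𝓘(ℝ, E4 × LowTri) (Tetrads.pt : Tetrads X → X)) :
    Conn 𝓘(ℝ, E4) (𝓘(ℝ, E4 × LowTri).prod 𝓘(ℝ, V)) (P.projX 𝒮) where
  jet y := ⟨(A.jet y).1.comp (Γ.jet y.proj).1, by
    ext1 v
    rw [mfderiv_projX]
    have h1 := congrArg (fun T => T ((Γ.jet y.proj).1 v)) (A.jet y).2
    have h2 := congrArg (fun T => T v) (Γ.jet y.proj).2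
    exact (congrArg (mfderiv 𝓘(ℝ, E4 × LowTri) 𝓘(ℝ, E4) Tetrads.pt y.proj) h1).trans h2⟩
  smooth y₀ := by
    have hp := contMDiffAt_proj (IB := 𝓘(ℝ, E4 × LowTri)) (n := ∞) (P.core 𝒮).Fiber (p := y₀)
    refine contMDiffAt_inTangentCoordinates fun v => ?_
    exact SmoothVec.horizontal A contMDiffAt_id (SmoothVec.horizontal Γ hp
      (smoothVec_symmL (g := fun y : P.S 𝒮 => y.proj.pt) ((contMDiffAt_pt _).comp y₀ hp) v))

lemma vertCovDiff_eq (A : P.ConnS 𝒮)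
    (Γ : Conn 𝓘(ℝ, E4) 𝓘(ℝ, E4 × LowTri) (Tetrads.pt : Tetrads X → X)) (y : P.S 𝒮)
    (φ : P.JetS 𝒮 y) (v : TangentSpace 𝓘(ℝ, E4) y.proj.pt) :
    vertCovDiff A Tetrads.pt φ v = vertProj A y (covDiff (compConn P 𝒮 A Γ) φ v).1 := by
  have h0 : vertProj A y ((A.jet y).1 ((Γ.jet y.proj).1 v)) = 0 := by
    refine Subtype.ext ?_
    have h1 := congrArg (fun T => T ((Γ.jet y.proj).1 v)) (A.jet y).2
    exact sub_eq_zero.mpr (congrArg (A.jet y).1 h1).symm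
  have h2 : vertProj A y (φ.1 v - (A.jet y).1 ((Γ.jet y.proj).1 v)) =
      vertProj A y (φ.1 v) - vertProj A y ((A.jet y).1 ((Γ.jet y.proj).1 v)) := map_sub _ _ _
  rw [h0, sub_zero] at h2
  exact h2.symm

lemma smoothVec_zero {EN : Type*} [NormedAddCommGroup EN] [NormedSpace ℝ EN]
    {HN : Type*} [TopologicalSpace HN] {IN : ModelWithCorners ℝ EN HN} {N : Type*}
    [TopologicalSpace N] [ChartedSpace HN N]
    {E : Type*} [NormedAddCommGroup E] [NormedSpace ℝ E] {H : Type*} [TopologicalSpace H]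
    {I : ModelWithCorners ℝ E H} {M : Type*} [TopologicalSpace M] [ChartedSpace H M]
    [IsManifold I ∞ M] {g : N → M} {t₀ : N} (hg : ContMDiffAt IN I ∞ g t₀) :
    SmoothVec IN I g (fun _ => 0) t₀ :=
  ((contMDiff_zeroSection ℝ (TangentSpace I : M → Type _)).contMDiffAt (x := g t₀)).comp t₀ hg

lemma isSmoothOperator_totalDirac (A : P.ConnS 𝒮) :
    P.IsSmoothOperator 𝒮 (P.totalDirac 𝒮 A) := by
  intro n y φ t₀ hy hφ
  have hp : ContMDiffAt 𝓘(ℝ, EuclideanSpace ℝ (Fin n)) 𝓘(ℝ, E4 × LowTri) ∞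
      (fun t => (y t).proj) t₀ := (contMDiffAt_proj (P.core 𝒮).Fiber).comp t₀ hy
  have hx : ContMDiffAt 𝓘(ℝ, EuclideanSpace ℝ (Fin n)) 𝓘(ℝ, E4) ∞ (fun t => (y t).proj.pt) t₀ :=
    (contMDiffAt_pt _).comp t₀ hp
  set i := P.indexAt (y t₀).proj with hi
  have hmi : (y t₀).proj ∈ P.baseSet i := P.mem_baseSet_at _
  set c : atlas E4 X := achart E4 (y t₀).proj.pt
  have hc : (y t₀).proj.pt ∈ c.1.source := mem_chart_source E4 _
  refine smoothVec_of_proj_of_fibre (IB := 𝓘(ℝ, E4 × LowTri))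
    (w := fun t => (P.totalDirac 𝒮 A (y t) (φ t)).1) hy ?_ ?_
  · simp only [dProj_vert]
    exact smoothVec_zero hp
  · have hv : ∀ lam, SmoothVec 𝓘(ℝ, EuclideanSpace ℝ (Fin n)) (𝓘(ℝ, E4 × LowTri).prod 𝓘(ℝ, V)) y
        (fun t => (φ t).1 (coordField c lam (y t).proj.pt)) t₀ := fun lam =>
      SmoothVec.clm_apply (φ := fun t => (φ t).1) hφ hy
        (SmoothVec.comp (k := fun t => (y t).proj.pt) (smooth_coordField c lam hc) hx)
    have hF := contMDiffAt_fibre (IB := 𝓘(ℝ, E4 × LowTri)) ((P.core 𝒮).localTriv i) (y := y t₀) hmi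
    have hq : ∀ lam, SmoothVec 𝓘(ℝ, EuclideanSpace ℝ (Fin n)) 𝓘(ℝ, E4 × LowTri)
        (fun t => (y t).proj) (fun t => dProj 𝓘(ℝ, E4 × LowTri) V (P.core 𝒮).Fiber (y t)
          ((φ t).1 (coordField c lam (y t).proj.pt))) t₀ := fun lam =>
      SmoothVec.map (contMDiffAt_proj (P.core 𝒮).Fiber) (hv lam)
    have hs : ∀ lam a, ContMDiffAt 𝓘(ℝ, EuclideanSpace ℝ (Fin n)) 𝓘(ℝ, ℝ) ∞
        (fun t => P.sig i c lam a (y t).proj) t₀ := fun lam a =>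
      ContMDiffAt.comp t₀ (smooth_sigMat P hmi hc lam a) hp
    have main : ContMDiffAt 𝓘(ℝ, EuclideanSpace ℝ (Fin n)) 𝓘(ℝ, V) ∞ (fun t =>
        ∑ lam, ∑ a, P.sig i c lam a (y t).proj • 𝒮.gamma a
          (P.dfib 𝒮 i (y t) ((φ t).1 (coordField c lam (y t).proj.pt)) -
            P.dfib 𝒮 i (y t) ((A.jet (y t)).1 (dProj 𝓘(ℝ, E4 × LowTri) V (P.core 𝒮).Fiber (y t)
                ((φ t).1 (coordField c lam (y t).proj.pt)))))) t₀ :=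
      contMDiffAt_finsetSum fun lam _ => contMDiffAt_finsetSum fun a _ =>
        (hs lam a).smul (((𝒮.gamma a).contMDiff.contMDiffAt).comp t₀
          (((hv lam).map_apply hF).sub ((SmoothVec.horizontal A hy (hq lam)).map_apply hF)))
    refine main.congr_of_eventuallyEq ?_
    filter_upwards [hp.continuousAt.eventually ((P.isOpen_baseSet i).mem_nhds hmi),
      hx.continuousAt.eventually (c.1.open_source.mem_nhds hc)] with t ht1 ht2
    exact dfib_totalDirac P 𝒮 A (y t) (φ t) ht1 ht2

end spinorBundle

/-! ### Restriction to a tetrad field -/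

section restriction

variable {X : Type*} [TopologicalSpace X] [ChartedSpace E4 X] [IsManifold 𝓘(ℝ, E4) ∞ X]
  [OrientedAtlas X] {ι : Type*} (P : SpinLift X ι)
  {V : Type*} [NormedAddCommGroup V] [NormedSpace ℂ V] [FiniteDimensional ℂ V]
  (𝒮 : SpinorSpace V) (h : TetradMap X)

/-- The trivialization of `S_h` over `h⁻¹(U_i)`. -/
abbrev trivH (i : ι) : Trivialization V (TotalSpace.proj : P.SH 𝒮 h → X) :=
  ((P.core 𝒮).localTriv i).pullback h

instance (i : ι) : MemTrivializationAtlas (trivH P 𝒮 h i) :=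
  ⟨⟨(P.core 𝒮).localTriv i, inferInstance, rfl⟩⟩

lemma contMDiffAt_incl (y : P.SH 𝒮 h) :
    ContMDiffAt (𝓘(ℝ, E4).prod 𝓘(ℝ, V)) (𝓘(ℝ, E4 × LowTri).prod 𝓘(ℝ, V)) ∞ (P.incl 𝒮 h) y := by
  have hi : h y.proj ∈ P.baseSet (P.indexAt (h y.proj)) := P.mem_baseSet_at _
  refine (((P.core 𝒮).localTriv (P.indexAt (h y.proj))).contMDiffAt_iff
    (f := P.incl 𝒮 h) (((P.core 𝒮).localTriv (P.indexAt (h y.proj))).mem_source.mpr hi)).mpr ⟨?_, ?_⟩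
  · exact h.contMDiff.contMDiffAt.comp y (contMDiffAt_proj (P.FibH 𝒮 h))
  · exact contMDiffAt_fibre (IB := 𝓘(ℝ, E4)) (trivH P 𝒮 h (P.indexAt (h y.proj))) (y := y) hi

lemma dProj_tincl (y : P.SH 𝒮 h) (w : TangentSpace (𝓘(ℝ, E4).prod 𝓘(ℝ, V)) y) :
    dProj 𝓘(ℝ, E4 × LowTri) V (P.core 𝒮).Fiber (P.incl 𝒮 h y) (P.tincl 𝒮 h y w) =
      mfderiv 𝓘(ℝ, E4) 𝓘(ℝ, E4 × LowTri) h y.proj (dProj 𝓘(ℝ, E4) V (P.FibH 𝒮 h) y w) := by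
  have h1 := mfderiv_comp y (f := P.incl 𝒮 h) (g := P.projS 𝒮)
    ((contMDiffAt_proj (P.core 𝒮).Fiber (n := 1)).mdifferentiableAt one_ne_zero)
    ((contMDiffAt_incl P 𝒮 h y).mdifferentiableAt (by simp))
  have h2 := mfderiv_comp y (f := P.projH 𝒮 h) (g := h)
    (h.contMDiff.contMDiffAt.mdifferentiableAt (by simp))
    ((contMDiffAt_proj (P.FibH 𝒮 h) (n := 1)).mdifferentiableAt one_ne_zero)
  exact congrArg (fun T => T w) (h1.symm.trans h2)

lemma dfib_tincl {i : ι} {y : P.SH 𝒮 h} (hi : h y.proj ∈ P.baseSet i)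
    (w : TangentSpace (𝓘(ℝ, E4).prod 𝓘(ℝ, V)) y) :
    P.dfib 𝒮 i (P.incl 𝒮 h y) (P.tincl 𝒮 h y w) = dFibre 𝓘(ℝ, E4) (trivH P 𝒮 h i) y w := by
  have h1 := mfderiv_comp y (f := P.incl 𝒮 h) (g := P.fib 𝒮 i)
    ((contMDiffAt_fibre (IB := 𝓘(ℝ, E4 × LowTri)) ((P.core 𝒮).localTriv i)
      (y := P.incl 𝒮 h y) hi).mdifferentiableAt (by simp))
    ((contMDiffAt_incl P 𝒮 h y).mdifferentiableAt (by simp))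
  exact (congrArg (fun T => T w) h1).symm

/-- The tangent map of `i_h` is injective. -/
lemma tincl_injective (y : P.SH 𝒮 h) {w w' : TangentSpace (𝓘(ℝ, E4).prod 𝓘(ℝ, V)) y}
    (h1 : dProj 𝓘(ℝ, E4) V (P.FibH 𝒮 h) y w = dProj 𝓘(ℝ, E4) V (P.FibH 𝒮 h) y w')
    (h2 : P.tincl 𝒮 h y w = P.tincl 𝒮 h y w') : w = w' := by
  have hi : h y.proj ∈ P.baseSet (P.indexAt (h y.proj)) := P.mem_baseSet_at _
  refine tangent_ext (IB := 𝓘(ℝ, E4)) (trivH P 𝒮 h (P.indexAt (h y.proj))) hi h1 ?_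
  rw [← dfib_tincl P 𝒮 h hi, ← dfib_tincl P 𝒮 h hi, h2]

lemma dProj_jetH {y : P.SH 𝒮 h} (ψ : P.JetH 𝒮 h y) (v : TangentSpace 𝓘(ℝ, E4) y.proj) :
    dProj 𝓘(ℝ, E4) V (P.FibH 𝒮 h) y (ψ.1 v) = v := congrArg (fun T => T v) ψ.2

lemma dProj_connS (A : P.ConnS 𝒮) (y : P.S 𝒮) (w : TangentSpace 𝓘(ℝ, E4 × LowTri) y.proj) :
    dProj 𝓘(ℝ, E4 × LowTri) V (P.core 𝒮).Fiber y ((A.jet y).1 w) = w :=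
  congrArg (fun T => T w) (A.jet y).2

/-- The horizontal lift at `y` of the connection on `S_h` induced by a connection on `S → Σ`: in a
trivialization it has the fibre components of the lift of the vectors tangent to `h(X)`. -/
def inducedJet (A : P.ConnS 𝒮) (y : P.SH 𝒮 h) : P.JetH 𝒮 h y :=
  ⟨(tangentLift (IB := 𝓘(ℝ, E4)) (trivH P 𝒮 h (P.indexAt (h y.proj))) y).comp
    ((ContinuousLinearMap.id ℝ (TangentSpace 𝓘(ℝ, E4) y.proj)).prod
      ((P.dfib 𝒮 (P.indexAt (h y.proj)) (P.incl 𝒮 h y)).comp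
        ((A.jet (P.incl 𝒮 h y)).1.comp (mfderiv 𝓘(ℝ, E4) 𝓘(ℝ, E4 × LowTri) h y.proj)))), by
    ext1 v
    exact (pair_tangentLift (IB := 𝓘(ℝ, E4)) (trivH P 𝒮 h (P.indexAt (h y.proj))) (y := y)
      (P.mem_baseSet_at _) _).1⟩

lemma tincl_inducedJet (A : P.ConnS 𝒮) (y : P.SH 𝒮 h) (v : TangentSpace 𝓘(ℝ, E4) y.proj) :
    P.tincl 𝒮 h y ((inducedJet P 𝒮 h A y).1 v) =
      (A.jet (P.incl 𝒮 h y)).1 (mfderiv 𝓘(ℝ, E4) 𝓘(ℝ, E4 × LowTri) h y.proj v) := by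
  have hi : h y.proj ∈ P.baseSet (P.indexAt (h y.proj)) := P.mem_baseSet_at _
  refine tangent_ext (IB := 𝓘(ℝ, E4 × LowTri)) ((P.core 𝒮).localTriv (P.indexAt (h y.proj)))
    (y := P.incl 𝒮 h y) hi ?_ ?_
  · rw [dProj_tincl, dProj_jetH]
    exact (dProj_connS P 𝒮 A (P.incl 𝒮 h y) _).symm
  · exact (dfib_tincl P 𝒮 h hi _).trans (pair_tangentLift (IB := 𝓘(ℝ, E4))
      (trivH P 𝒮 h (P.indexAt (h y.proj))) (y := y) hi _).2

/-- The connection on `S_h` induced by a connection on `S → Σ`. -/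
def inducedConn (A : P.ConnS 𝒮) : P.ConnH 𝒮 h where
  jet := inducedJet P 𝒮 h A
  smooth y₀ := by
    refine conn_smooth (inducedJet P 𝒮 h A) fun w hw => ?_
    have hi : h y₀.proj ∈ P.baseSet (P.indexAt (h y₀.proj)) := P.mem_baseSet_at _
    have h1 : SmoothVec (𝓘(ℝ, E4).prod 𝓘(ℝ, V)) 𝓘(ℝ, E4 × LowTri) (fun y : P.SH 𝒮 h => h y.proj)
        (fun y => mfderiv 𝓘(ℝ, E4) 𝓘(ℝ, E4 × LowTri) h y.proj (w y)) y₀ :=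
      SmoothVec.map h.contMDiff.contMDiffAt hw
    have h2 := SmoothVec.horizontal A (g := P.incl 𝒮 h) (contMDiffAt_incl P 𝒮 h y₀) h1
    have h3 := h2.map_apply (contMDiffAt_fibre (IB := 𝓘(ℝ, E4 × LowTri))
      ((P.core 𝒮).localTriv (P.indexAt (h y₀.proj))) (y := P.incl 𝒮 h y₀) hi)
    refine h3.congr_of_eventuallyEq ?_
    filter_upwards [h1.base.continuousAt.eventually ((P.isOpen_baseSet _).mem_nhds hi)] with y hy
    refine (dfib_tincl P 𝒮 h hy _).symm.trans ?_
    exact congrArg (P.dfib 𝒮 _ (P.incl 𝒮 h y)) (tincl_inducedJet P 𝒮 h A y (w y))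

lemma existsUnique_induced (A : P.ConnS 𝒮) : ∃! B : P.ConnH 𝒮 h, P.IsInduced 𝒮 A h B := by
  refine ⟨inducedConn P 𝒮 h A, fun y v => tincl_inducedJet P 𝒮 h A y v, fun B hB => ?_⟩
  have e : B.jet = (inducedConn P 𝒮 h A).jet := by
    funext y
    refine Subtype.ext (ContinuousLinearMap.ext fun v => ?_)
    refine tincl_injective P 𝒮 h y ?_ ((hB y v).trans (tincl_inducedJet P 𝒮 h A y v).symm)
    rw [dProj_jetH, dProj_jetH]
  cases B
  congr

/-- A section of `Σ → X` is a right inverse of the projection on tangent vectors. -/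
lemma mfderiv_pt_section (hsec : ∀ x, (h x).pt = x) (x : X) (v : TangentSpace 𝓘(ℝ, E4) x) :
    mfderiv 𝓘(ℝ, E4 × LowTri) 𝓘(ℝ, E4) Tetrads.pt (h x)
      (mfderiv 𝓘(ℝ, E4) 𝓘(ℝ, E4 × LowTri) h x v) = v := by
  have h1 := mfderiv_comp x (f := h) ((contMDiffAt_pt (h x)).mdifferentiableAt (by simp))
    (h.contMDiff.contMDiffAt.mdifferentiableAt (by simp))
  have h2 : Tetrads.pt ∘ h = id := funext hsec
  have h3 := congrArg (fun T => (T v : E4)) h1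
  rw [h2, mfderiv_id] at h3
  exact h3.symm

/-- The jet `Ti_h ∘ ψ` of `S → X`. -/
def jetIncl (hsec : ∀ x, (h x).pt = x) {y : P.SH 𝒮 h} (ψ : P.JetH 𝒮 h y) :
    P.JetS 𝒮 (P.incl 𝒮 h y) :=
  ⟨(P.tincl 𝒮 h y).comp ψ.1, by
    ext1 v
    rw [mfderiv_projX]
    refine (congrArg (mfderiv 𝓘(ℝ, E4 × LowTri) 𝓘(ℝ, E4) Tetrads.pt (h y.proj))
      ((dProj_tincl P 𝒮 h y (ψ.1 v)).trans
        (congrArg (mfderiv 𝓘(ℝ, E4) 𝓘(ℝ, E4 × LowTri) h y.proj) (dProj_jetH P 𝒮 h ψ v)))).trans ?_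
    exact mfderiv_pt_section h hsec y.proj v⟩

/-- The total Dirac operator restricts to the Dirac operator of the induced connection. -/
lemma tincl_diracH (hsec : ∀ x, (h x).pt = x) (A : P.ConnS 𝒮) {B : P.ConnH 𝒮 h}
    (hB : P.IsInduced 𝒮 A h B) (y : P.SH 𝒮 h) (ψ : P.JetH 𝒮 h y) :
    P.tincl 𝒮 h y (P.diracH 𝒮 h B y ψ).1 =
      (P.totalDirac 𝒮 A (P.incl 𝒮 h y) (jetIncl P 𝒮 h hsec ψ)).1 := by
  set i := P.indexAt (h y.proj)
  have hi : h y.proj ∈ P.baseSet i := P.mem_baseSet_at _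
  refine tangent_ext (IB := 𝓘(ℝ, E4 × LowTri)) ((P.core 𝒮).localTriv i)
    (y := P.incl 𝒮 h y) hi ?_ ?_
  · rw [dProj_tincl, dProj_vert, dProj_vert]
    exact map_zero _
  · refine (dfib_tincl P 𝒮 h hi _).trans ?_
    refine (dFibre_gammaVert (IB := 𝓘(ℝ, E4)) (trivH P 𝒮 h i) (y := y) hi _ _).trans ?_
    refine Eq.trans ?_ (dFibre_gammaVert (IB := 𝓘(ℝ, E4 × LowTri)) ((P.core 𝒮).localTriv i)
      (y := P.incl 𝒮 h y) hi _ _).symm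
    refine Finset.sum_congr rfl fun μ _ => ?_
    refine (fib_gammaSigma P 𝒮 hi _ _).trans ?_
    refine Eq.trans ?_ (fib_gammaSigma P 𝒮 hi _ _).symm
    refine Finset.sum_congr rfl fun a _ => ?_
    refine congrArg (fun u : V => _ • 𝒮.gamma a u) ?_
    have e1 := fibre_vertCoord (IB := 𝓘(ℝ, E4)) (trivH P 𝒮 h i) (y := y) hi
      (covDiff B ψ (EuclideanSpace.single μ (1 : ℝ)))
    have e2 := fibre_vertCoord (IB := 𝓘(ℝ, E4 × LowTri)) ((P.core 𝒮).localTriv i)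
      (y := P.incl 𝒮 h y) hi
      (vertCovDiff A Tetrads.pt (jetIncl P 𝒮 h hsec ψ) (EuclideanSpace.single μ (1 : ℝ)))
    refine e1.trans (Eq.trans ?_ e2.symm)
    refine (dfib_tincl P 𝒮 h hi _).symm.trans (congrArg (P.dfib 𝒮 i (P.incl 𝒮 h y)) ?_)
    have e3 : P.tincl 𝒮 h y (covDiff B ψ (EuclideanSpace.single μ (1 : ℝ))).1 =
        P.tincl 𝒮 h y (ψ.1 (EuclideanSpace.single μ (1 : ℝ))) -
          P.tincl 𝒮 h y ((B.jet y).1 (EuclideanSpace.single μ (1 : ℝ))) :=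
      map_sub (P.tincl 𝒮 h y) _ _
    refine e3.trans (congrArg (fun u => P.tincl 𝒮 h y (ψ.1 (EuclideanSpace.single μ (1 : ℝ))) - u) ?_)
    refine (hB y _).trans (congrArg (A.jet (P.incl 𝒮 h y)).1 ?_)
    exact ((dProj_tincl P 𝒮 h y _).trans
        (congrArg (mfderiv 𝓘(ℝ, E4) 𝓘(ℝ, E4 × LowTri) h y.proj) (dProj_jetH P 𝒮 h ψ _))).symm

end restriction

/-! ### Connections on the tangent bundle in charts -/

section christoffel

variable {X : Type*} [TopologicalSpace X] [ChartedSpace E4 X] [IsManifold 𝓘(ℝ, E4) ∞ X]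

/-- The connection matrix `K^ν_{λμ} v^μ` of a connection on `TX` in a chart, evaluated on a tangent
vector `v`. -/
def connMat (K : WorldConn X) (c : atlas E4 X) (x : X) (v : TangentSpace 𝓘(ℝ, E4) x) : Mat4 :=
  Matrix.of fun ν lam => dcoord c ν x (K (coordField c lam) x v)

lemma connMat_apply (K : WorldConn X) (c : atlas E4 X) {x : X} (hx : x ∈ c.1.source)
    (v : TangentSpace 𝓘(ℝ, E4) x) (ν lam : Fin 4) :
    connMat K c x v ν lam = ∑ μ, christoffel K c x ν lam μ * dcoord c μ x v := by
  have h := clm_eq_sum c hx ((dcoord c ν x).comp (K (coordField c lam) x)) v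
  refine h.trans (Finset.sum_congr rfl fun μ _ => ?_)
  rw [smul_eq_mul, mul_comm]
  rfl

lemma mdiff_dcoord (c : atlas E4 X) {x : X} (hx : x ∈ c.1.source) (ν : Fin 4)
    {Y : ∀ x : X, TangentSpace 𝓘(ℝ, E4) x} (hY : MDiffField Y x) :
    MDifferentiableAt 𝓘(ℝ, E4) 𝓘(ℝ, ℝ) (fun x' => dcoord c ν x' (Y x')) x := by
  have hf := contMDiffAt_atlas_coord c hx ν
  have h1 : MDifferentiableAt 𝓘(ℝ, E4) 𝓘(ℝ, E4 →L[ℝ] ℝ) (inTangentCoordinates 𝓘(ℝ, E4) 𝓘(ℝ, ℝ)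
      id (fun x' => c.1 x' ν) (mfderiv 𝓘(ℝ, E4) 𝓘(ℝ, ℝ) (fun x' => c.1 x' ν)) x) x :=
    (hf.mfderiv_const (m := ∞) le_rfl).mdifferentiableAt (by simp)
  have h2 := MDifferentiableAt.clm_apply_of_inCoordinates (F₁ := E4) (F₂ := ℝ)
    (E₁ := (TangentSpace 𝓘(ℝ, E4) : X → Type _)) (E₂ := (TangentSpace 𝓘(ℝ, ℝ) : ℝ → Type _))
    (b₁ := fun x' => x') (b₂ := fun x' => c.1 x' ν)
    (ϕ := fun x' => mfderiv 𝓘(ℝ, E4) 𝓘(ℝ, ℝ) (fun x' => c.1 x' ν) x') (v := Y) h1 hY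
    (hf.mdifferentiableAt (by simp))
  have h3 : MDifferentiableAt 𝓘(ℝ, ℝ).tangent 𝓘(ℝ, ℝ) (fun p : TangentBundle 𝓘(ℝ, ℝ) ℝ => p.2)
      ⟨c.1 x ν, mfderiv 𝓘(ℝ, E4) 𝓘(ℝ, ℝ) (fun x' => c.1 x' ν) x (Y x)⟩ :=
    ((contMDiff_snd_tangentBundle_modelSpace ℝ 𝓘(ℝ, ℝ) (n := ∞)).contMDiffAt).mdifferentiableAt
      (by simp)
  exact h3.comp x h2

lemma mdiffField_coordField (c : atlas E4 X) {x : X} (hx : x ∈ c.1.source) (lam : Fin 4) :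
    MDiffField (coordField c lam) x :=
  ContMDiffAt.mdifferentiableAt (smooth_coordField c lam hx) (by simp)

lemma cov_sum (K : WorldConn X) {x : X} {κ : Type*} (s : Finset κ)
    {Y : κ → ∀ x : X, TangentSpace 𝓘(ℝ, E4) x} (hY : ∀ k, MDiffField (Y k) x) :
    K (fun x' => ∑ k ∈ s, Y k x') x = ∑ k ∈ s, K (Y k) x := by
  classical
  induction s using Finset.induction_on with
  | empty =>
    simp only [Finset.sum_empty]
    exact K.isCovariantDerivativeOnUniv.zero
  | insert k s hk ih =>
    simp only [Finset.sum_insert hk]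
    rw [← ih]
    exact K.isCovariantDerivativeOnUniv.add (hY k)
      (MDifferentiableAt.sum_section (I := 𝓘(ℝ, E4)) (F := E4) fun k _ => hY k)

/-- The covariant derivative of a vector field in a chart:
`(∇_v Y)^ν = dY^ν(v) + K^ν_{λμ} Y^λ v^μ`. -/
lemma dcoord_cov (K : WorldConn X) (c : atlas E4 X) {x : X} (hx : x ∈ c.1.source)
    {Y : ∀ x : X, TangentSpace 𝓘(ℝ, E4) x} (hY : MDiffField Y x) (ν : Fin 4)
    (v : TangentSpace 𝓘(ℝ, E4) x) :
    dcoord c ν x (K Y x v) = mvfderiv 𝓘(ℝ, E4) (fun x' => dcoord c ν x' (Y x')) x v +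
      ∑ lam, connMat K c x v ν lam * dcoord c lam x (Y x) := by
  set Z : Fin 4 → ∀ x : X, TangentSpace 𝓘(ℝ, E4) x :=
    fun lam => (fun x' => dcoord c lam x' (Y x')) • coordField c lam with hZdef
  have hd : ∀ lam, MDifferentiableAt 𝓘(ℝ, E4) 𝓘(ℝ, ℝ) (fun x' => dcoord c lam x' (Y x')) x :=
    fun lam => mdiff_dcoord c hx lam hY
  have hZ : ∀ lam, MDiffField (Z lam) x := fun lam =>
    MDifferentiableAt.smul_section (hd lam) (mdiffField_coordField c hx lam)
  have h1 : K Y x = K (fun x' => ∑ lam, Z lam x') x := by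
    refine K.isCovariantDerivativeOnUniv.congr_of_eventuallyEq hY
      (MDifferentiableAt.sum_section (I := 𝓘(ℝ, E4)) (F := E4) fun k _ => hZ k) Filter.univ_mem ?_
    filter_upwards [c.1.open_source.mem_nhds hx] with x' hx'
    exact eq_sum_coordField c hx' (Y x')
  have h2 : ∀ lam, K (Z lam) x v = dcoord c lam x (Y x) • K (coordField c lam) x v +
      mvfderiv 𝓘(ℝ, E4) (fun x' => dcoord c lam x' (Y x')) x v • coordField c lam x := by
    intro lam
    have := K.isCovariantDerivativeOnUniv.leibniz (mdiffField_coordField c hx lam) (hd lam)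
    exact congrArg (fun T => T v) this
  rw [h1, cov_sum K Finset.univ hZ, sum_apply, map_sum]
  simp only [h2, map_add, map_smul, dcoord_coordField c hx, smul_eq_mul, Finset.sum_add_distrib]
  rw [add_comm]
  refine congrArg₂ (· + ·) (by simp) (Finset.sum_congr rfl fun lam _ => mul_comm _ _)

/-- The Jacobian matrix `∂x^ρ/∂x'^λ` of two charts. -/
def chartMat (c c' : atlas E4 X) (x : X) : Mat4 :=
  Matrix.of fun ρ lam => dcoord c ρ x (coordField c' lam x)

lemma smooth_chartMat (c c' : atlas E4 X) {x : X} (hx : x ∈ c.1.source) (hx' : x ∈ c'.1.source)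
    (ρ lam : Fin 4) : ContMDiffAt 𝓘(ℝ, E4) 𝓘(ℝ, ℝ) ∞ (fun y => chartMat c c' y ρ lam) x :=
  (smooth_coordField c' lam hx').map_apply (contMDiffAt_atlas_coord c hx ρ)

lemma dcoord_change (c c' : atlas E4 X) {x : X} (hx' : x ∈ c'.1.source) (ρ : Fin 4)
    (v : TangentSpace 𝓘(ℝ, E4) x) :
    dcoord c ρ x v = ∑ lam, chartMat c c' x ρ lam * dcoord c' lam x v :=
  (clm_eq_sum c' hx' (dcoord c ρ x) v).trans (Finset.sum_congr rfl fun _ _ => mul_comm _ _)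

lemma chartMat_mul (c c' : atlas E4 X) {x : X} (hx : x ∈ c.1.source) (hx' : x ∈ c'.1.source) :
    chartMat c' c x * chartMat c c' x = 1 := by
  ext ρ lam
  rw [Matrix.mul_apply, Matrix.one_apply, ← dcoord_coordField c' hx' ρ lam,
    dcoord_change c' c hx ρ]
  rfl

/-- The inhomogeneous transformation law of the connection matrix under a change of charts. -/
lemma connMat_change (K : WorldConn X) (c c' : atlas E4 X) {x : X} (hx : x ∈ c.1.source)
    (hx' : x ∈ c'.1.source) (v : TangentSpace 𝓘(ℝ, E4) x) :
    chartMat c c' x * connMat K c' x v =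
      dMat 𝓘(ℝ, E4) (chartMat c c') x v + connMat K c x v * chartMat c c' x := by
  ext ν lam
  rw [Matrix.mul_apply, Matrix.add_apply, Matrix.mul_apply]
  refine (dcoord_change c c' hx' ν (K (coordField c' lam) x v)).symm.trans ?_
  exact dcoord_cov K c hx (mdiffField_coordField c' hx' lam) ν v

end christoffel

/-! ### The local connection forms on the bundle of tetrads -/

/-- The antisymmetrization `½ (θ η - η θᵀ)` of a matrix with the Minkowski metric. -/
def antisymEta (θ : Mat4) : Mat4 := (1 / 2 : ℝ) • (θ * eta - eta * θᵀ)

lemma antisymEta_antisymm (θ : Mat4) (a b : Fin 4) : antisymEta θ b a = -antisymEta θ a b := by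
  have h : (antisymEta θ)ᵀ = -antisymEta θ := by
    simp only [antisymEta, Matrix.transpose_smul, Matrix.transpose_sub, Matrix.transpose_mul,
      Matrix.transpose_transpose, eta_transpose, ← smul_neg, neg_sub]
  exact congrFun (congrFun h a) b

lemma mul_eta_apply (S D C s : Mat4) (a b : Fin 4) : (S * (D + C * s) * eta) a b =
    (∑ ν, ∑ lam, ∑ d, C ν lam * s lam d * (eta d b * S a ν)) +
      ∑ ν, ∑ d, D ν d * (eta d b * S a ν) := by
  have h : S * (D + C * s) * eta = S * (C * (s * eta)) + S * (D * eta) := by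
    rw [mul_add, add_mul, mul_assoc, mul_assoc, mul_assoc, add_comm]
  rw [h, Matrix.add_apply, Matrix.mul_apply, Matrix.mul_apply]
  simp only [Matrix.mul_apply, Finset.mul_sum]
  refine congrArg₂ (· + ·) ?_ ?_
  · exact Finset.sum_congr rfl fun ν _ => Finset.sum_congr rfl fun lam _ =>
      Finset.sum_congr rfl fun d _ => by ring
  · exact Finset.sum_congr rfl fun ν _ => Finset.sum_congr rfl fun d _ => by ring

lemma antisymEta_apply (S D C s : Mat4) (a b : Fin 4) : antisymEta (S * (D + C * s)) a b =
    1 / 2 * ((∑ ν, ∑ lam, ∑ d, C ν lam * s lam d * (eta d b * S a ν - eta d a * S b ν)) +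
      ∑ ν, ∑ d, D ν d * (eta d b * S a ν - eta d a * S b ν)) := by
  have h : ∀ θ : Mat4, (eta * θᵀ) a b = (θ * eta) b a := fun θ => by
    rw [← Matrix.transpose_apply (θ * eta), Matrix.transpose_mul, eta_transpose]
  rw [antisymEta, Matrix.smul_apply, Matrix.sub_apply, h, mul_eta_apply, mul_eta_apply, smul_eq_mul]
  simp only [mul_sub, Finset.sum_sub_distrib]
  ring

/-- The transformation of the mixed components under a Lorentz gauge transformation. -/
lemma antisymEta_gauge {l l' θ θ' : Mat4} (hl : IsLorentz l)
    (hl' : l' * eta * lᵀ + l * eta * l'ᵀ = 0) (h : l * θ = θ' * l + l') :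
    l * (antisymEta θ * eta) = antisymEta θ' * eta * l + l' := by
  have hinv : (eta * lᵀ * eta) * l = 1 := hl.inv_mul
  have hinv' : l * (eta * lᵀ * eta) = 1 := mul_eq_one_comm.mp hinv
  have hT : θᵀ * lᵀ = lᵀ * θ'ᵀ + l'ᵀ := by
    rw [← Matrix.transpose_mul, h, Matrix.transpose_add, Matrix.transpose_mul]
  -- the transposed term is computed by inserting `lᵀ (η l η) = 1`
  have hone : lᵀ * (eta * l * eta) = 1 := by
    rw [← mul_assoc, ← mul_assoc, hl.preserves', eta_mul_eta]
  have e1 : l * eta * θᵀ = eta * θ'ᵀ * (eta * l * eta) + l * eta * l'ᵀ * (eta * l * eta) := by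
    calc l * eta * θᵀ = l * eta * θᵀ * (lᵀ * (eta * l * eta)) := by rw [hone, mul_one]
      _ = l * eta * (θᵀ * lᵀ) * (eta * l * eta) := by simp only [mul_assoc]
      _ = (l * eta * lᵀ) * θ'ᵀ * (eta * l * eta) + l * eta * l'ᵀ * (eta * l * eta) := by
        rw [hT]; simp only [mul_assoc, mul_add, add_mul]
      _ = _ := by rw [hl.preserves]
  have e2 : l * eta * l'ᵀ * (eta * l * eta) = -(l' * eta) := by
    have h3 : l * eta * l'ᵀ = -(l' * eta * lᵀ) := (neg_eq_of_add_eq_zero_right hl').symm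
    rw [h3, neg_mul]
    calc -(l' * eta * lᵀ * (eta * l * eta)) = -(l' * eta * (lᵀ * (eta * l * eta))) := by
          simp only [mul_assoc]
      _ = -(l' * eta) := by rw [hone, mul_one]
  have e3 : l * eta * θᵀ * eta = eta * θ'ᵀ * eta * l - l' := by
    rw [e1, e2, add_mul, neg_mul, mul_assoc l', eta_mul_eta, mul_one]
    simp only [mul_assoc, eta_mul_eta, mul_one, sub_eq_add_neg]
  have e4 : l * (θ * eta * eta) = θ' * eta * eta * l + l' := by
    rw [mul_assoc, mul_assoc θ', eta_mul_eta, mul_one, mul_one, h]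
  rw [antisymEta, antisymEta, smul_mul_assoc, mul_smul_comm, smul_mul_assoc, smul_mul_assoc,
    sub_mul, mul_sub, sub_mul, sub_mul, e4]
  have e5 : l * (eta * θᵀ * eta) = l * eta * θᵀ * eta := by simp only [mul_assoc]
  rw [e5, e3]
  have e6 : θ' * eta * eta * l + l' - (eta * θ'ᵀ * eta * l - l') =
      (θ' * eta * eta * l - eta * θ'ᵀ * eta * l) + (2 : ℝ) • l' := by
    rw [two_smul]; abel
  rw [e6, smul_add, smul_smul]
  norm_num

section forms

variable {X : Type*} [TopologicalSpace X] [ChartedSpace E4 X] [IsManifold 𝓘(ℝ, E4) ∞ X]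
  [OrientedAtlas X] {ι : Type*} (P : SpinLift X ι)

/-- The matrix `σ^a_ν (dσ^ν_b + K^ν_{λμ} σ^λ_b dx^μ)`, the pull-back to `U_i` of the connection form
of the linear connection `K` along the frame `z_i`. -/
def frameForm (K : WorldConn X) (i : ι) (c : atlas E4 X) (σ : Tetrads X)
    (w : TangentSpace 𝓘(ℝ, E4 × LowTri) σ) : Mat4 :=
  (P.sigMat i c σ)⁻¹ * (dMat 𝓘(ℝ, E4 × LowTri) (P.sigMat i c) σ w +
    connMat K c σ.pt (mfderiv 𝓘(ℝ, E4 × LowTri) 𝓘(ℝ, E4) Tetrads.pt σ w) * P.sigMat i c σ)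

/-- The local connection forms are the antisymmetric parts of the linear connection form. -/
lemma tetradForm_eq (K : WorldConn X) (i : ι) {c : atlas E4 X} {σ : Tetrads X}
    (hc : σ.pt ∈ c.1.source) (w : TangentSpace 𝓘(ℝ, E4 × LowTri) σ) (a b : Fin 4) :
    P.tetradForm K i c a b σ w = antisymEta (frameForm P K i c σ w) a b := by
  rw [frameForm, antisymEta_apply, SpinLift.tetradForm]
  simp only [connMat_apply K c hc, ← dcoordTet_apply c hc]
  rw [mul_add]
  refine congrArg₂ (· + ·) ?_ ?_
  · simp only [Finset.mul_sum, Finset.sum_mul]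
    rw [Finset.sum_comm]
    refine Finset.sum_congr rfl fun ν _ => ?_
    rw [Finset.sum_comm]
    refine Finset.sum_congr rfl fun lam _ => ?_
    rw [Finset.sum_comm]
    refine Finset.sum_congr rfl fun d _ => Finset.sum_congr rfl fun μ _ => ?_
    change _ = 1 / 2 * (christoffel K c σ.pt ν lam μ * dcoordTet c μ σ w * P.sig i c lam d σ *
      (eta d b * P.sigInv i c a ν σ - eta d a * P.sigInv i c b ν σ))
    ring
  · rw [Finset.mul_sum]
    refine Finset.sum_congr rfl fun ν _ => ?_
    rw [Finset.mul_sum]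
    refine Finset.sum_congr rfl fun d _ => ?_
    change _ = 1 / 2 * (P.dsig i c ν d σ w *
      (eta d b * P.sigInv i c a ν σ - eta d a * P.sigInv i c b ν σ))
    ring

lemma tetradFormMixed_eq (K : WorldConn X) (i : ι) {c : atlas E4 X} {σ : Tetrads X}
    (hc : σ.pt ∈ c.1.source) (w : TangentSpace 𝓘(ℝ, E4 × LowTri) σ) (a b : Fin 4) :
    P.tetradFormMixed K i c a b σ w = (antisymEta (frameForm P K i c σ w) * eta) a b := by
  rw [Matrix.mul_apply, SpinLift.tetradFormMixed]
  simp only [tetradForm_eq P K i hc]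

lemma sigMat_chart (i : ι) (c c' : atlas E4 X) {σ : Tetrads X} (hc : σ.pt ∈ c.1.source)
    (hc' : σ.pt ∈ c'.1.source) :
    P.sigMat i c σ = chartMat c c' σ.pt * P.sigMat i c' σ := by
  ext μ a
  rw [Matrix.mul_apply]
  refine ((P.frame i σ).matIn_eq_dcoord c hc μ a).trans ?_
  refine (dcoord_change c c' hc' μ _).trans (Finset.sum_congr rfl fun lam _ => ?_)
  exact congrArg (chartMat c c' σ.pt μ lam * ·) ((P.frame i σ).matIn_eq_dcoord c' hc' lam a).symm

lemma mdiff_sigMat {i : ι} {c : atlas E4 X} {σ : Tetrads X} (hi : σ ∈ P.baseSet i)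
    (hc : σ.pt ∈ c.1.source) (μ a : Fin 4) :
    MDifferentiableAt 𝓘(ℝ, E4 × LowTri) 𝓘(ℝ, ℝ) (fun τ => P.sigMat i c τ μ a) σ :=
  (smooth_sigMat P hi hc μ a).mdifferentiableAt (by simp)

lemma mdiff_lorMat {i j : ι} {σ : Tetrads X} (hi : σ ∈ P.baseSet i) (hj : σ ∈ P.baseSet j)
    (a b : Fin 4) :
    MDifferentiableAt 𝓘(ℝ, E4 × LowTri) 𝓘(ℝ, ℝ) (fun τ => P.lorMat i j τ a b) σ :=
  (smooth_lorMat P hi hj a b).mdifferentiableAt (by simp)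

/-- The linear connection form does not depend on the chart. -/
lemma frameForm_chart (K : WorldConn X) {i : ι} {c c' : atlas E4 X} {σ : Tetrads X}
    (hi : σ ∈ P.baseSet i) (hc : σ.pt ∈ c.1.source) (hc' : σ.pt ∈ c'.1.source)
    (w : TangentSpace 𝓘(ℝ, E4 × LowTri) σ) :
    frameForm P K i c σ w = frameForm P K i c' σ w := by
  have hJ : ∀ ρ lam, MDifferentiableAt 𝓘(ℝ, E4) 𝓘(ℝ, ℝ) (fun y => chartMat c c' y ρ lam) σ.pt :=
    fun ρ lam => (smooth_chartMat c c' hc hc' ρ lam).mdifferentiableAt (by simp)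
  have hpt := (contMDiffAt_pt σ).mdifferentiableAt (n := ∞) (by simp)
  have hev : P.sigMat i c =ᶠ[𝓝 σ] fun τ => chartMat c c' τ.pt * P.sigMat i c' τ := by
    filter_upwards [eventually_mem_base P hi hc, eventually_mem_base P hi hc'] with τ h1 h2
    exact sigMat_chart P i c c' h1.2 h2.2
  have hd : dMat 𝓘(ℝ, E4 × LowTri) (P.sigMat i c) σ w =
      dMat 𝓘(ℝ, E4) (chartMat c c') σ.pt (mfderiv 𝓘(ℝ, E4 × LowTri) 𝓘(ℝ, E4) Tetrads.pt σ w) *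
        P.sigMat i c' σ + chartMat c c' σ.pt * dMat 𝓘(ℝ, E4 × LowTri) (P.sigMat i c') σ w := by
    rw [dMat_congr hev, dMat_mul (f := fun τ : Tetrads X => chartMat c c' τ.pt)
      (fun ρ lam => (hJ ρ lam).comp σ hpt) (mdiff_sigMat P hi hc'), dMat_comp hJ hpt]
  have hdet : IsUnit (chartMat c c' σ.pt).det :=
    (Matrix.isUnit_iff_isUnit_det _).mp (IsUnit.of_mul_eq_one_right _ (chartMat_mul c c' hc hc'))
  have hcm := connMat_change K c c' hc hc' (mfderiv 𝓘(ℝ, E4 × LowTri) 𝓘(ℝ, E4) Tetrads.pt σ w)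
  rw [frameForm, frameForm, hd, sigMat_chart P i c c' hc hc', Matrix.mul_inv_rev]
  have e : ∀ D D' C s J C' : Mat4, IsUnit J.det → J * C' = D + C * J →
      s⁻¹ * J⁻¹ * (D * s + J * D' + C * (J * s)) = s⁻¹ * (D' + C' * s) := by
    intro D D' C s J C' hJ h
    have h2 : D * s + J * D' + C * (J * s) = J * (D' + C' * s) := by
      rw [mul_add, ← mul_assoc J, h, add_mul, mul_assoc]; abel
    rw [h2, mul_assoc, Matrix.nonsing_inv_mul_cancel_left _ _ hJ]
  exact e _ _ _ _ _ _ hdet hcm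

/-- The gauge transformation of the linear connection form under a change of frames. -/
lemma frameForm_gauge (K : WorldConn X) {i j : ι} {c : atlas E4 X} {σ : Tetrads X}
    (hi : σ ∈ P.baseSet i) (hj : σ ∈ P.baseSet j) (hc : σ.pt ∈ c.1.source)
    (w : TangentSpace 𝓘(ℝ, E4 × LowTri) σ) :
    P.lorMat i j σ * frameForm P K i c σ w = frameForm P K j c σ w * P.lorMat i j σ +
      dMat 𝓘(ℝ, E4 × LowTri) (P.lorMat i j) σ w := by
  have hd : dMat 𝓘(ℝ, E4 × LowTri) (P.sigMat i c) σ w =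
      dMat 𝓘(ℝ, E4 × LowTri) (P.sigMat j c) σ w * P.lorMat i j σ +
        P.sigMat j c σ * dMat 𝓘(ℝ, E4 × LowTri) (P.lorMat i j) σ w := by
    rw [← dMat_mul (mdiff_sigMat P hj hc) (mdiff_lorMat P hi hj)]
    exact congrArg (fun f => dMat 𝓘(ℝ, E4 × LowTri) f σ w) (funext fun τ => sigMat_eq P i j c τ)
  have e : ∀ D C s l l' : Mat4, IsUnit s.det → IsUnit l.det →
      l * ((s * l)⁻¹ * (D * l + s * l' + C * (s * l))) = s⁻¹ * (D + C * s) * l + l' := by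
    intro D C s l l' hs hl
    rw [Matrix.mul_inv_rev, mul_assoc, Matrix.mul_nonsing_inv_cancel_left _ _ hl, mul_add, mul_add,
      Matrix.nonsing_inv_mul_cancel_left _ _ hs, mul_add, add_mul]
    simp only [mul_assoc]
    abel
  have hl : IsUnit (P.lorMat i j σ).det := by
    rw [(isLorentz_lorMat P hi hj).det_eq]; exact isUnit_one
  rw [frameForm, hd, sigMat_eq P i j c]
  exact e _ _ _ _ _ (isUnit_sigMat P j hc) hl

/-- The differential of the transition functions is tangent to the Lorentz group. -/
lemma dMat_lorMat {i j : ι} {σ : Tetrads X} (hi : σ ∈ P.baseSet i) (hj : σ ∈ P.baseSet j)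
    (w : TangentSpace 𝓘(ℝ, E4 × LowTri) σ) :
    dMat 𝓘(ℝ, E4 × LowTri) (P.lorMat i j) σ w * eta * (P.lorMat i j σ)ᵀ +
      P.lorMat i j σ * eta * (dMat 𝓘(ℝ, E4 × LowTri) (P.lorMat i j) σ w)ᵀ = 0 := by
  have hm := mdiff_lorMat P hi hj
  have he : ∀ a b, MDifferentiableAt 𝓘(ℝ, E4 × LowTri) 𝓘(ℝ, ℝ)
      (fun τ : Tetrads X => (fun _ : Tetrads X => eta) τ a b) σ := fun a b => mdifferentiableAt_const
  have hle : ∀ a b, MDifferentiableAt 𝓘(ℝ, E4 × LowTri) 𝓘(ℝ, ℝ)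
      (fun τ => (P.lorMat i j τ * eta) a b) σ := fun a b =>
    (contMDiffAt_matrix_mul (g := fun _ => eta) (smooth_lorMat P hi hj)
      (fun _ _ => contMDiffAt_const) a b).mdifferentiableAt (by simp)
  have h1 : (fun τ => P.lorMat i j τ * eta * (P.lorMat i j τ)ᵀ) =ᶠ[𝓝 σ] fun _ => eta := by
    filter_upwards [(P.isOpen_baseSet i).mem_nhds hi, (P.isOpen_baseSet j).mem_nhds hj] with τ h1 h2
    exact (isLorentz_lorMat P h1 h2).preserves
  have h2 := dMat_mul (f := fun τ => P.lorMat i j τ * eta) (g := fun τ => (P.lorMat i j τ)ᵀ) hle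
    (fun a b => hm b a) w
  rw [dMat_congr h1, dMat_const, dMat_mul (g := fun _ => eta) hm he, dMat_const, mul_zero, add_zero,
    dMat_transpose] at h2
  exact h2.symm

/-- The forms `A^a_b` on `U_i` and `U_j` are related by `l A_i = A_j l + dl`. -/
lemma antisymEta_frameForm (K : WorldConn X) {i j : ι} {c c' : atlas E4 X} {σ : Tetrads X}
    (hi : σ ∈ P.baseSet i) (hj : σ ∈ P.baseSet j) (hc : σ.pt ∈ c.1.source)
    (hc' : σ.pt ∈ c'.1.source) (w : TangentSpace 𝓘(ℝ, E4 × LowTri) σ) :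
    P.lorMat i j σ * (antisymEta (frameForm P K i c σ w) * eta) =
      antisymEta (frameForm P K j c' σ w) * eta * P.lorMat i j σ +
        dMat 𝓘(ℝ, E4 × LowTri) (P.lorMat i j) σ w :=
  antisymEta_gauge (isLorentz_lorMat P hi hj) (dMat_lorMat P hi hj w)
    (by rw [frameForm_chart P K hj hc' hc]; exact frameForm_gauge P K hi hj hc w)

lemma tetradFormMixed_gauge (K : WorldConn X) {i j : ι} {c c' : atlas E4 X} {σ : Tetrads X}
    (hi : σ ∈ P.baseSet i) (hj : σ ∈ P.baseSet j) (hc : σ.pt ∈ c.1.source)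
    (hc' : σ.pt ∈ c'.1.source) (w : TangentSpace 𝓘(ℝ, E4 × LowTri) σ) (a b : Fin 4) :
    ∑ e, P.lor i j a e σ * P.tetradFormMixed K i c e b σ w =
      ∑ e, P.tetradFormMixed K j c' a e σ w * P.lor i j e b σ + dfunTet (P.lor i j a b) σ w := by
  have h := congrFun (congrFun (antisymEta_frameForm P K hi hj hc hc' w) a) b
  rw [Matrix.add_apply, Matrix.mul_apply, Matrix.mul_apply] at h
  simp only [tetradFormMixed_eq P K i hc, tetradFormMixed_eq P K j hc']
  exact h

end forms

/-! ### Differentials of functions with values in the Clifford algebra -/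

section cliffordValued

variable {E : Type*} [NormedAddCommGroup E] [NormedSpace ℝ E] {H : Type*} [TopologicalSpace H]
  {I : ModelWithCorners ℝ E H} {M : Type*} [TopologicalSpace M] [ChartedSpace H M]

/-- Differentiability of a Clifford algebra valued function, through its linear functionals. -/
def MDiffCl (I : ModelWithCorners ℝ E H) (f : M → Cl) (x : M) : Prop :=
  ∀ φ : Cl →ₗ[ℝ] ℝ, MDifferentiableAt I 𝓘(ℝ, ℝ) (fun y => φ (f y)) x

/-- The differential of a Clifford algebra valued function, computed in a basis. -/
def dCl (I : ModelWithCorners ℝ E H) (f : M → Cl) (x : M) (w : TangentSpace I x) : Cl :=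
  ∑ k, mvfderiv I (fun y => (Module.finBasis ℝ Cl).coord k (f y)) x w • Module.finBasis ℝ Cl k

lemma cl_ext {x y : Cl} (h : ∀ φ : Cl →ₗ[ℝ] ℝ, φ x = φ y) : x = y :=
  (Module.finBasis ℝ Cl).ext_elem fun k => h ((Module.finBasis ℝ Cl).coord k)

lemma cl_eq_sum (x : Cl) : x = ∑ k, (Module.finBasis ℝ Cl).coord k x • Module.finBasis ℝ Cl k :=
  ((Module.finBasis ℝ Cl).sum_repr x).symm

lemma mdiff_const_mul (r : ℝ) {f : M → ℝ} {x : M} (hf : MDifferentiableAt I 𝓘(ℝ, ℝ) f x) :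
    MDifferentiableAt I 𝓘(ℝ, ℝ) (fun y => f y * r) x :=
  hf.mul (mdifferentiableAt_const (c := r))

lemma mvfderiv_mul_const_apply (r : ℝ) {f : M → ℝ} {x : M} (hf : MDifferentiableAt I 𝓘(ℝ, ℝ) f x)
    (w : TangentSpace I x) : mvfderiv I (fun y => f y * r) x w = mvfderiv I f x w * r := by
  rw [mvfderiv_mul_apply hf mdifferentiableAt_const, mvfderiv_const]
  simp

lemma map_dCl {f : M → Cl} {x : M} (hf : MDiffCl I f x) (φ : Cl →ₗ[ℝ] ℝ) (w : TangentSpace I x) :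
    φ (dCl I f x w) = mvfderiv I (fun y => φ (f y)) x w := by
  have e : (fun y => φ (f y)) =
      fun y => ∑ k, (Module.finBasis ℝ Cl).coord k (f y) * φ (Module.finBasis ℝ Cl k) := by
    funext y
    conv_lhs => rw [cl_eq_sum (f y), map_sum]
    simp only [map_smul, smul_eq_mul]
  rw [e, mvfderiv_sum_apply _ fun k _ => mdiff_const_mul _ (hf _), dCl, map_sum]
  refine Finset.sum_congr rfl fun k _ => ?_
  rw [map_smul, smul_eq_mul, mvfderiv_mul_const_apply _ (hf _)]

lemma MDiffCl.linear {f : M → Cl} {x : M} (hf : MDiffCl I f x) (T : Cl →ₗ[ℝ] Cl) :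
    MDiffCl I (fun y => T (f y)) x := fun φ => hf (φ ∘ₗ T)

lemma dCl_linear {f : M → Cl} {x : M} (hf : MDiffCl I f x) (T : Cl →ₗ[ℝ] Cl)
    (w : TangentSpace I x) : dCl I (fun y => T (f y)) x w = T (dCl I f x w) :=
  cl_ext fun φ => (map_dCl (hf.linear T) φ w).trans (map_dCl hf (φ ∘ₗ T) w).symm

lemma map_mul_eq_sum (φ : Cl →ₗ[ℝ] ℝ) (x y : Cl) : φ (x * y) =
    ∑ k, (Module.finBasis ℝ Cl).coord k x * φ (Module.finBasis ℝ Cl k * y) := by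
  conv_lhs => rw [cl_eq_sum x, Finset.sum_mul, map_sum]
  simp only [smul_mul_assoc, map_smul, smul_eq_mul]

lemma MDiffCl.mul {f g : M → Cl} {x : M} (hf : MDiffCl I f x) (hg : MDiffCl I g x) :
    MDiffCl I (fun y => f y * g y) x := by
  intro φ
  have e : (fun y => φ (f y * g y)) = ∑ k, fun y => (Module.finBasis ℝ Cl).coord k (f y) *
      φ (Module.finBasis ℝ Cl k * g y) := by
    funext y
    rw [Finset.sum_apply]
    exact map_mul_eq_sum φ _ _
  rw [e]
  exact MDifferentiableAt.sum fun k _ =>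
    (hf _).mul (hg (φ ∘ₗ LinearMap.mulLeft ℝ (Module.finBasis ℝ Cl k)))

lemma dCl_mul {f g : M → Cl} {x : M} (hf : MDiffCl I f x) (hg : MDiffCl I g x)
    (w : TangentSpace I x) :
    dCl I (fun y => f y * g y) x w = dCl I f x w * g x + f x * dCl I g x w := by
  refine cl_ext fun φ => ?_
  rw [map_dCl (hf.mul hg), map_add, map_mul_eq_sum φ (dCl I f x w), map_mul_eq_sum φ (f x),
    ← Finset.sum_add_distrib]
  have e : (fun y => φ (f y * g y)) = fun y => ∑ k, (Module.finBasis ℝ Cl).coord k (f y) *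
      φ (Module.finBasis ℝ Cl k * g y) := funext fun y => map_mul_eq_sum φ _ _
  have hg' : ∀ k, MDifferentiableAt I 𝓘(ℝ, ℝ) (fun y => φ (Module.finBasis ℝ Cl k * g y)) x :=
    fun k => hg (φ ∘ₗ LinearMap.mulLeft ℝ (Module.finBasis ℝ Cl k))
  rw [e]
  refine (mvfderiv_sum_apply Finset.univ (f := fun k y => (Module.finBasis ℝ Cl).coord k (f y) *
    φ (Module.finBasis ℝ Cl k * g y)) (fun k _ => (hf _).mul (hg' k)) w).trans ?_
  refine Finset.sum_congr rfl fun k _ => ?_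
  rw [mvfderiv_mul_apply (hf _) (hg' k), map_dCl hf]
  exact congrArg (_ + _ * ·) (map_dCl hg (φ ∘ₗ LinearMap.mulLeft ℝ (Module.finBasis ℝ Cl k)) w).symm

lemma dCl_congr {f g : M → Cl} {x : M} (h : f =ᶠ[𝓝 x] g) (w : TangentSpace I x) :
    dCl I f x w = dCl I g x w := by
  refine Finset.sum_congr rfl fun k _ => ?_
  have : (fun y => (Module.finBasis ℝ Cl).coord k (f y)) =ᶠ[𝓝 x]
      fun y => (Module.finBasis ℝ Cl).coord k (g y) := h.mono fun y hy => by simp only [hy]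
  rw [mvfderiv_congr this]

lemma dCl_const (a : Cl) (x : M) (w : TangentSpace I x) : dCl I (fun _ => a) x w = 0 := by
  simp only [dCl, mvfderiv_const, zero_apply, zero_smul, Finset.sum_const_zero]

lemma MDiffCl.sum_smul {r : Fin 4 → M → ℝ} {x : M} (hr : ∀ a, MDifferentiableAt I 𝓘(ℝ, ℝ) (r a) x)
    (g : Fin 4 → Cl) : MDiffCl I (fun y => ∑ a, r a y • g a) x := by
  intro φ
  have e : (fun y => φ (∑ a, r a y • g a)) = ∑ a, fun y => r a y * φ (g a) := by
    funext y
    simp [map_sum, Finset.sum_apply]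
  rw [e]
  exact MDifferentiableAt.sum fun a _ => mdiff_const_mul _ (hr a)

lemma dCl_sum_smul {r : Fin 4 → M → ℝ} {x : M} (hr : ∀ a, MDifferentiableAt I 𝓘(ℝ, ℝ) (r a) x)
    (g : Fin 4 → Cl) (w : TangentSpace I x) :
    dCl I (fun y => ∑ a, r a y • g a) x w = ∑ a, mvfderiv I (r a) x w • g a := by
  refine cl_ext fun φ => ?_
  rw [map_dCl (MDiffCl.sum_smul hr g)]
  simp only [map_sum, map_smul, smul_eq_mul]
  rw [mvfderiv_sum_apply _ fun a _ => mdiff_const_mul _ (hr a)]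
  exact Finset.sum_congr rfl fun a _ => mvfderiv_mul_const_apply _ (hr a) w

variable {V : Type*} [NormedAddCommGroup V] [NormedSpace ℂ V] [FiniteDimensional ℂ V]
  (𝒮 : SpinorSpace V)

lemma act_eq_sum (x : Cl) (u : V) : 𝒮.act x u =
    ∑ k, (Module.finBasis ℝ Cl).coord k x • 𝒮.act (Module.finBasis ℝ Cl k) u := by
  conv_lhs => rw [cl_eq_sum x, act_sum]
  simp only [act_smul]

/-- The product rule for the action of the Clifford algebra on spinors. -/
lemma mvfderiv_act {f : M → Cl} {u : M → V} {x : M} (hf : MDiffCl I f x)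
    (hu : MDifferentiableAt I 𝓘(ℝ, V) u x) (w : TangentSpace I x) :
    mvfderiv I (fun y => 𝒮.act (f y) (u y)) x w =
      𝒮.act (dCl I f x w) (u x) + 𝒮.act (f x) (mvfderiv I u x w) := by
  have e : (fun y => 𝒮.act (f y) (u y)) = fun y => ∑ k, (Module.finBasis ℝ Cl).coord k (f y) •
      𝒮.act (Module.finBasis ℝ Cl k) (u y) := funext fun y => act_eq_sum 𝒮 _ _
  have hk : ∀ k, MDifferentiableAt I 𝓘(ℝ, V) (fun y => 𝒮.act (Module.finBasis ℝ Cl k) (u y)) x :=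
    fun k => ((𝒮.act (Module.finBasis ℝ Cl k)).mdifferentiableAt).comp x hu
  have hk' : ∀ k, mvfderiv I (fun y => 𝒮.act (Module.finBasis ℝ Cl k) (u y)) x w =
      𝒮.act (Module.finBasis ℝ Cl k) (mvfderiv I u x w) := by
    intro k
    have h := mfderiv_comp x (g := 𝒮.act (Module.finBasis ℝ Cl k))
      ((𝒮.act (Module.finBasis ℝ Cl k)).mdifferentiableAt) hu
    rw [ContinuousLinearMap.mfderiv_eq] at h
    exact congrArg (fun T => (T w : V)) h
  rw [e]
  refine (mvfderiv_sum_apply Finset.univ (f := fun k y => (Module.finBasis ℝ Cl).coord k (f y) •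
    𝒮.act (Module.finBasis ℝ Cl k) (u y)) (fun k _ => (hf _).smul (hk k)) w).trans ?_
  rw [act_eq_sum 𝒮 (dCl I f x w), act_eq_sum 𝒮 (f x), ← Finset.sum_add_distrib]
  refine Finset.sum_congr rfl fun k _ => ?_
  rw [mvfderiv_fun_smul (hf _) (hk k), add_apply, smul_apply, hk', map_dCl hf, add_comm]
  rfl

end cliffordValued

/-! ### The spinor connection of the local connection forms -/

section tetradConn

variable {X : Type*} [TopologicalSpace X] [ChartedSpace E4 X] [IsManifold 𝓘(ℝ, E4) ∞ X]
  [OrientedAtlas X] {ι : Type*} (P : SpinLift X ι)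
  {V : Type*} [NormedAddCommGroup V] [NormedSpace ℂ V] [FiniteDimensional ℂ V]
  (𝒮 : SpinorSpace V)

/-- The spin cocycle covers the transition functions of the frame bundle. -/
lemma trans_covers_lorMat {i j : ι} {σ : Tetrads X} (hi : σ ∈ P.baseSet i) (hj : σ ∈ P.baseSet j)
    (b : Fin 4) : P.trans i j σ * ∑ a, P.lorMat i j σ b a • cliffGen a =
      cliffGen b * P.trans i j σ := by
  -- the covector dual to the `b`-th vector of the frame `z_j`
  let α : E4 →L[ℝ] ℝ := ∑ ν, (P.frame j σ).mat⁻¹ b ν • (EuclideanSpace.proj ν : E4 →L[ℝ] ℝ)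
  have hα : ∀ v : E4, α v = ∑ ν, (P.frame j σ).mat⁻¹ b ν * v ν := fun v => by
    rw [sum_apply]
    rfl
  have h1 : (fun a => α ((P.frame i σ).vec a)) = fun a => P.lorMat i j σ b a :=
    funext fun a => hα _
  have h2 : (fun a => α ((P.frame j σ).vec a)) = Pi.single b 1 := by
    funext a
    refine (hα _).trans ?_
    have := congrFun (congrFun (Matrix.nonsing_inv_mul _ (det_frame_mat (P.frame j σ))) b) a
    rw [Matrix.one_apply] at this
    rw [Pi.single_apply]
    simp only [eq_comm (a := a)]
    exact this
  have h := P.trans_covers i j σ ⟨hi, hj⟩ α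
  rw [h1, h2, ι_eq_sum] at h
  exact h

lemma mdiffCl_trans {i j : ι} {σ : Tetrads X} (hi : σ ∈ P.baseSet i) (hj : σ ∈ P.baseSet j) :
    MDiffCl 𝓘(ℝ, E4 × LowTri) (P.trans i j) σ := fun φ =>
  ((P.trans_smooth i j φ).contMDiffAt (((P.isOpen_baseSet i).inter (P.isOpen_baseSet j)).mem_nhds
    ⟨hi, hj⟩)).mdifferentiableAt (by simp)

/-- The differential of the spin cocycle is the lift of the differential of the Lorentz cocycle. -/
lemma dCl_trans {i j : ι} {σ : Tetrads X} (hi : σ ∈ P.baseSet i) (hj : σ ∈ P.baseSet j)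
    (w : TangentSpace 𝓘(ℝ, E4 × LowTri) σ) :
    dCl 𝓘(ℝ, E4 × LowTri) (P.trans i j) σ w =
      bivec (dMat 𝓘(ℝ, E4 × LowTri) (P.lorMat i j) σ w * eta * (P.lorMat i j σ)ᵀ) *
        P.trans i j σ := by
  have hev : ∀ᶠ τ in 𝓝 σ, τ ∈ P.baseSet i ∧ τ ∈ P.baseSet j :=
    ((P.isOpen_baseSet i).mem_nhds hi |> Filter.Eventually.and <|
      (P.isOpen_baseSet j).mem_nhds hj :)
  have ht := mdiffCl_trans P hi hj
  let starL : Cl →ₗ[ℝ] Cl := CliffordAlgebra.reverse ∘ₗ CliffordAlgebra.involute.toLinearMap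
  have hstar : ∀ x : Cl, starL x = star x := fun x => rfl
  refine spin_tangent (isLorentz_lorMat P hi hj)
    (spinGroup.star_mul_self_of_mem (P.trans_mem i j σ ⟨hi, hj⟩))
    (spinGroup.mul_star_self_of_mem (P.trans_mem i j σ ⟨hi, hj⟩)) ?_ (dMat_lorMat P hi hj w)
    (trans_covers_lorMat P hi hj) fun b => ?_
  · have h1 : (fun τ => P.trans i j τ * starL (P.trans i j τ)) =ᶠ[𝓝 σ] fun _ => 1 :=
      hev.mono fun τ hτ => spinGroup.mul_star_self_of_mem (P.trans_mem i j τ hτ)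
    have h2 := dCl_mul ht (ht.linear starL) w
    rw [dCl_congr h1, dCl_const, dCl_linear ht, hstar, hstar, add_comm] at h2
    exact h2.symm
  · have hr : ∀ a, MDifferentiableAt 𝓘(ℝ, E4 × LowTri) 𝓘(ℝ, ℝ) (fun τ => P.lorMat i j τ b a) σ :=
      fun a => mdiff_lorMat P hi hj b a
    have h1 : (fun τ => P.trans i j τ * ∑ a, P.lorMat i j τ b a • cliffGen a) =ᶠ[𝓝 σ]
        fun τ => cliffGen b * P.trans i j τ :=
      hev.mono fun τ hτ => trans_covers_lorMat P hτ.1 hτ.2 b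
    have h2 := dCl_congr (I := 𝓘(ℝ, E4 × LowTri)) h1 w
    rw [dCl_mul ht (MDiffCl.sum_smul hr cliffGen), dCl_sum_smul hr] at h2
    exact h2.trans (dCl_linear ht (LinearMap.mulLeft ℝ (cliffGen b)) w)

lemma mdiff_fib {i : ι} {y : P.S 𝒮} (hi : y.proj ∈ P.baseSet i) :
    MDifferentiableAt (𝓘(ℝ, E4 × LowTri).prod 𝓘(ℝ, V)) 𝓘(ℝ, V) (P.fib 𝒮 i) y :=
  (contMDiffAt_fibre (IB := 𝓘(ℝ, E4 × LowTri)) ((P.core 𝒮).localTriv i) hi).mdifferentiableAt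
    (by simp)

/-- The differentials of the fibre coordinates of two trivializations. -/
lemma dfib_change {i j : ι} {y : P.S 𝒮} (hi : y.proj ∈ P.baseSet i) (hj : y.proj ∈ P.baseSet j)
    (w : TangentSpace (𝓘(ℝ, E4 × LowTri).prod 𝓘(ℝ, V)) y) :
    P.dfib 𝒮 j y w = 𝒮.act (dCl 𝓘(ℝ, E4 × LowTri) (P.trans i j) y.proj
        (dProj 𝓘(ℝ, E4 × LowTri) V (P.core 𝒮).Fiber y w)) (P.fib 𝒮 i y) +
      𝒮.act (P.trans i j y.proj) (P.dfib 𝒮 i y w) := by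
  have hq : MDifferentiableAt (𝓘(ℝ, E4 × LowTri).prod 𝓘(ℝ, V)) 𝓘(ℝ, E4 × LowTri) (P.projS 𝒮) y :=
    (contMDiffAt_proj (P.core 𝒮).Fiber (n := 1)).mdifferentiableAt one_ne_zero
  have ht := mdiffCl_trans P hi hj
  have ht' : MDiffCl (𝓘(ℝ, E4 × LowTri).prod 𝓘(ℝ, V)) (fun p : P.S 𝒮 => P.trans i j p.proj) y :=
    fun φ => (ht φ).comp y hq
  have hev : P.fib 𝒮 j =ᶠ[𝓝 y] fun p => 𝒮.act (P.trans i j p.proj) (P.fib 𝒮 i p) := by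
    filter_upwards [hq.continuousAt.eventually ((P.isOpen_baseSet i).mem_nhds hi),
      hq.continuousAt.eventually ((P.isOpen_baseSet j).mem_nhds hj)] with p h1 h2
    exact fib_change P 𝒮 h1 h2
  have hd : dCl (𝓘(ℝ, E4 × LowTri).prod 𝓘(ℝ, V)) (fun p : P.S 𝒮 => P.trans i j p.proj) y w =
      dCl 𝓘(ℝ, E4 × LowTri) (P.trans i j) y.proj
        (dProj 𝓘(ℝ, E4 × LowTri) V (P.core 𝒮).Fiber y w) := by
    refine cl_ext fun φ => ?_
    rw [map_dCl ht', map_dCl ht]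
    exact mvfderiv_comp_apply y (ht φ) hq w
  have h := mvfderiv_act 𝒮 ht' (mdiff_fib P 𝒮 hi) w
  rw [← mvfderiv_congr hev, hd] at h
  exact h

lemma neg_half_sum_gen (Ω : Mat4) (u : V) :
    -(1 / 2 : ℝ) • ∑ a, ∑ b, Ω a b • 𝒮.gen a b u = -𝒮.act (bivec Ω) u := by
  rw [act_bivec, neg_smul]

lemma neg_half_tetradForm (K : WorldConn X) (i : ι) {c : atlas E4 X} {σ : Tetrads X}
    (hc : σ.pt ∈ c.1.source) (w : TangentSpace 𝓘(ℝ, E4 × LowTri) σ) (u : V) :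
    -(1 / 2 : ℝ) • ∑ a, ∑ b, P.tetradForm K i c a b σ w • 𝒮.gen a b u =
      -𝒮.act (bivec (antisymEta (frameForm P K i c σ w))) u := by
  rw [← neg_half_sum_gen]
  simp only [tetradForm_eq P K i hc]

/-- The local conditions on horizontal vectors in two trivializations agree. -/
lemma horizontal_change (K : WorldConn X) {i j : ι} {c c' : atlas E4 X} {y : P.S 𝒮}
    (hi : y.proj ∈ P.baseSet i) (hj : y.proj ∈ P.baseSet j) (hc : y.proj.pt ∈ c.1.source)
    (hc' : y.proj.pt ∈ c'.1.source) (w : TangentSpace (𝓘(ℝ, E4 × LowTri).prod 𝓘(ℝ, V)) y)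
    (h : P.dfib 𝒮 i y w = -𝒮.act (bivec (antisymEta (frameForm P K i c y.proj
      (dProj 𝓘(ℝ, E4 × LowTri) V (P.core 𝒮).Fiber y w)))) (P.fib 𝒮 i y)) :
    P.dfib 𝒮 j y w = -𝒮.act (bivec (antisymEta (frameForm P K j c' y.proj
      (dProj 𝓘(ℝ, E4 × LowTri) V (P.core 𝒮).Fiber y w)))) (P.fib 𝒮 j y) := by
  set v := dProj 𝓘(ℝ, E4 × LowTri) V (P.core 𝒮).Fiber y w
  set l := P.lorMat i j y.proj
  have hl := isLorentz_lorMat P hi hj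
  have hg := antisymEta_frameForm P K hi hj hc hc' v
  set Ai := antisymEta (frameForm P K i c y.proj v)
  set Aj := antisymEta (frameForm P K j c' y.proj v)
  set l' := dMat 𝓘(ℝ, E4 × LowTri) (P.lorMat i j) y.proj v
  have hA : l * Ai * lᵀ = Aj + l' * eta * lᵀ := by
    have h1 := congrArg (fun m => m * eta * lᵀ) hg
    have h2 : l * (Ai * eta) * eta * lᵀ = l * Ai * lᵀ := by
      rw [← mul_assoc l, mul_assoc (l * Ai), eta_mul_eta, mul_one]
    have h3 : (Aj * eta * l + l') * eta * lᵀ = Aj + l' * eta * lᵀ := by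
      have h4 : Aj * eta * l * eta * lᵀ = Aj * (eta * (l * eta * lᵀ)) := by
        simp only [Matrix.mul_assoc]
      rw [add_mul, add_mul, h4, hl.preserves, eta_mul_eta, mul_one]
    exact h2.symm.trans (h1.trans h3)
  rw [dfib_change P 𝒮 hi hj, h, dCl_trans P hi hj, fib_change P 𝒮 hi hj, map_neg, ← 𝒮.act_mul,
    ← 𝒮.act_mul, spin_mul_bivec hl (trans_covers_lorMat P hi hj), hA, bivec_add, add_mul, act_add]
  abel

/-- The local connection form as a linear form. -/
def tetradFormL (K : WorldConn X) (i : ι) (c : atlas E4 X) (a b : Fin 4) (σ : Tetrads X) :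
    TangentSpace 𝓘(ℝ, E4 × LowTri) σ →L[ℝ] ℝ :=
  (∑ μ, (1 / 2 * ∑ ν, ∑ lam, ∑ d, christoffel K c σ.pt ν lam μ * P.sig i c lam d σ *
      (eta d b * P.sigInv i c a ν σ - eta d a * P.sigInv i c b ν σ)) • dcoordTet c μ σ) +
  ∑ μ, ∑ d, (1 / 2 * (eta d b * P.sigInv i c a μ σ - eta d a * P.sigInv i c b μ σ)) •
    P.dsig i c μ d σ

lemma tetradFormL_apply (K : WorldConn X) (i : ι) (c : atlas E4 X) (a b : Fin 4) (σ : Tetrads X)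
    (w : TangentSpace 𝓘(ℝ, E4 × LowTri) σ) :
    tetradFormL P K i c a b σ w = P.tetradForm K i c a b σ w := by
  simp only [tetradFormL, SpinLift.tetradForm, add_apply, sum_apply, smul_apply, smul_eq_mul]

/-- The horizontal lift at `y` with fibre components `-½ A^{ab} I_{ab} y`. -/
def tetradJet (K : WorldConn X) (y : P.S 𝒮) :
    Jet1 𝓘(ℝ, E4 × LowTri) (𝓘(ℝ, E4 × LowTri).prod 𝓘(ℝ, V)) (P.projS 𝒮) y :=
  ⟨(tangentLift (IB := 𝓘(ℝ, E4 × LowTri)) ((P.core 𝒮).localTriv (P.indexAt y.proj)) y).comp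
    ((ContinuousLinearMap.id ℝ (TangentSpace 𝓘(ℝ, E4 × LowTri) y.proj)).prod
      (-(1 / 2 : ℝ) • ∑ a, ∑ b, (tetradFormL P K (P.indexAt y.proj) (achart E4 y.proj.pt)
        a b y.proj).smulRight (𝒮.gen a b (P.fib 𝒮 (P.indexAt y.proj) y)))), by
    ext1 w
    exact (pair_tangentLift (IB := 𝓘(ℝ, E4 × LowTri)) ((P.core 𝒮).localTriv (P.indexAt y.proj))
      (y := y) (P.mem_baseSet_at _) _).1⟩

lemma dfib_tetradJet_at (K : WorldConn X) (y : P.S 𝒮) (w : TangentSpace 𝓘(ℝ, E4 × LowTri) y.proj) :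
    P.dfib 𝒮 (P.indexAt y.proj) y ((tetradJet P 𝒮 K y).1 w) =
      -𝒮.act (bivec (antisymEta (frameForm P K (P.indexAt y.proj) (achart E4 y.proj.pt)
        y.proj w))) (P.fib 𝒮 (P.indexAt y.proj) y) := by
  refine (pair_tangentLift (IB := 𝓘(ℝ, E4 × LowTri)) ((P.core 𝒮).localTriv (P.indexAt y.proj))
      (y := y) (P.mem_baseSet_at _) _).2.trans ?_
  rw [← neg_half_tetradForm P 𝒮 K _ (mem_chart_source E4 y.proj.pt)]
  change (-(1 / 2 : ℝ) • ∑ a, ∑ b, (tetradFormL P K (P.indexAt y.proj) (achart E4 y.proj.pt)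
    a b y.proj).smulRight (𝒮.gen a b (P.fib 𝒮 (P.indexAt y.proj) y))) w = _
  simp only [smul_apply, sum_apply, ContinuousLinearMap.smulRight_apply, tetradFormL_apply]

/-- The horizontal lifts have the required form in every trivialization and chart. -/
lemma dfib_tetradJet (K : WorldConn X) {i : ι} {c : atlas E4 X} {y : P.S 𝒮}
    (hi : y.proj ∈ P.baseSet i) (hc : y.proj.pt ∈ c.1.source)
    (w : TangentSpace 𝓘(ℝ, E4 × LowTri) y.proj) :
    P.dfib 𝒮 i y ((tetradJet P 𝒮 K y).1 w) =
      -(1 / 2 : ℝ) • ∑ a, ∑ b, P.tetradForm K i c a b y.proj w • 𝒮.gen a b (P.fib 𝒮 i y) := by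
  have hw : dProj 𝓘(ℝ, E4 × LowTri) V (P.core 𝒮).Fiber y ((tetradJet P 𝒮 K y).1 w) = w :=
    congrArg (fun T => T w) (tetradJet P 𝒮 K y).2
  have h := horizontal_change P 𝒮 K (P.mem_baseSet_at y.proj) hi (mem_chart_source E4 y.proj.pt) hc
    ((tetradJet P 𝒮 K y).1 w) (by rw [hw]; exact dfib_tetradJet_at P 𝒮 K y w)
  rw [hw] at h
  rw [h, neg_half_tetradForm P 𝒮 K i hc]

end tetradConn

/-! ### Smoothness and uniqueness of the spinor connection -/

section connMatSmooth

variable {X : Type*} [TopologicalSpace X] [T2Space X] [ChartedSpace E4 X]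
  [IsManifold 𝓘(ℝ, E4) ∞ X]
  {EN : Type*} [NormedAddCommGroup EN] [NormedSpace ℝ EN] {HN : Type*} [TopologicalSpace HN]
  {IN : ModelWithCorners ℝ EN HN} {N : Type*} [TopologicalSpace N] [ChartedSpace HN N]

/-- The connection matrix of a smooth connection is smooth. A smooth connection is only tested on
global sections, so that the coordinate fields are multiplied by a bump function. -/
lemma smooth_connMat {K : WorldConn X} (hK : K.ContMDiffCovariantDerivative ∞) {c : atlas E4 X}
    {g : N → X} {w : ∀ t, TangentSpace 𝓘(ℝ, E4) (g t)} {t₀ : N}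
    (hw : SmoothVec IN 𝓘(ℝ, E4) g w t₀) (hc : g t₀ ∈ c.1.source) (ν lam : Fin 4) :
    ContMDiffAt IN 𝓘(ℝ, ℝ) ∞ (fun t => connMat K c (g t) (w t) ν lam) t₀ := by
  obtain ⟨ψ, -, hψ⟩ := (SmoothBumpFunction.nhds_basis_tsupport (I := 𝓘(ℝ, E4)) (g t₀)).mem_iff.mp
    (c.1.open_source.mem_nhds hc)
  have hs : ContMDiffOn 𝓘(ℝ, E4) 𝓘(ℝ, E4).tangent ∞
      (fun x => (⟨x, coordField c lam x⟩ : TangentBundle 𝓘(ℝ, E4) X)) c.1.source := fun x hx =>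
    (show ContMDiffAt _ _ _ _ _ from smooth_coordField c lam hx).contMDiffWithinAt
  have hY := ContMDiffOn.smul_section_of_tsupport (V := (TangentSpace 𝓘(ℝ, E4) : X → Type _))
    (F := E4) (ψ.contMDiff.contMDiffOn (s := c.1.source)) c.1.open_source hψ hs
  have hKY := hK.contMDiff.contMDiff (σ := (ψ : X → ℝ) • coordField c lam) hY.contMDiffOn
  have h1 := (hKY.contMDiffAt (x := g t₀) Filter.univ_mem).comp t₀ hw.base
  have h2 : SmoothVec IN 𝓘(ℝ, E4) g
      (fun t => K ((ψ : X → ℝ) • coordField c lam) (g t) (w t)) t₀ :=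
    ContMDiffAt.clm_bundle_apply (F₁ := E4) (F₂ := E4)
      (E₁ := (TangentSpace 𝓘(ℝ, E4) : X → Type _)) (E₂ := (TangentSpace 𝓘(ℝ, E4) : X → Type _))
      (b := g) (ϕ := fun t => K ((ψ : X → ℝ) • coordField c lam) (g t)) (v := w) h1 hw
  refine (h2.map_apply (contMDiffAt_atlas_coord c hc ν)).congr_of_eventuallyEq ?_
  filter_upwards [hw.base.continuousAt.eventually ψ.eventuallyEq_one.eventually_nhds,
    hw.base.continuousAt.eventually (c.1.open_source.mem_nhds hc)] with t h3 h4
  have h5 : K ((ψ : X → ℝ) • coordField c lam) (g t) = K (coordField c lam) (g t) := by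
    refine K.isCovariantDerivativeOnUniv.congr_of_eventuallyEq
      ((hY (g t)).mdifferentiableAt (by simp)) (mdiffField_coordField c h4 lam)
      Filter.univ_mem ?_
    filter_upwards [h3] with x hx
    change ψ x • coordField c lam x = _
    rw [hx]
    exact one_smul ℝ _
  exact congrArg (fun T => dcoord c ν (g t) (T (w t))) h5.symm

end connMatSmooth

section smoothness

variable {X : Type*} [TopologicalSpace X] [T2Space X] [ChartedSpace E4 X]
  [IsManifold 𝓘(ℝ, E4) ∞ X] [OrientedAtlas X] {ι : Type*} (P : SpinLift X ι)
  {V : Type*} [NormedAddCommGroup V] [NormedSpace ℂ V] [FiniteDimensional ℂ V]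
  (𝒮 : SpinorSpace V)
  {EN : Type*} [NormedAddCommGroup EN] [NormedSpace ℝ EN] {HN : Type*} [TopologicalSpace HN]
  {IN : ModelWithCorners ℝ EN HN} {N : Type*} [TopologicalSpace N] [ChartedSpace HN N]

lemma smooth_tetradForm {K : WorldConn X} (hK : K.ContMDiffCovariantDerivative ∞) {i : ι}
    {c : atlas E4 X} {g : N → Tetrads X} {w : ∀ t, TangentSpace 𝓘(ℝ, E4 × LowTri) (g t)} {t₀ : N}
    (hw : SmoothVec IN 𝓘(ℝ, E4 × LowTri) g w t₀) (hi : g t₀ ∈ P.baseSet i)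
    (hc : (g t₀).pt ∈ c.1.source) (a b : Fin 4) :
    ContMDiffAt IN 𝓘(ℝ, ℝ) ∞ (fun t => P.tetradForm K i c a b (g t) (w t)) t₀ := by
  have hs : ∀ μ a, ContMDiffAt IN 𝓘(ℝ, ℝ) ∞ (fun t => P.sigMat i c (g t) μ a) t₀ := fun μ a =>
    ContMDiffAt.comp (g := fun τ => P.sigMat i c τ μ a) t₀ (smooth_sigMat P hi hc μ a) hw.base
  have hsi : ∀ a μ, ContMDiffAt IN 𝓘(ℝ, ℝ) ∞ (fun t => (P.sigMat i c (g t))⁻¹ a μ) t₀ := fun a μ =>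
    ContMDiffAt.comp (g := fun τ => (P.sigMat i c τ)⁻¹ a μ) t₀ (smooth_sigMat_inv P hi hc a μ)
      hw.base
  have hd : ∀ μ a, ContMDiffAt IN 𝓘(ℝ, ℝ) ∞
      (fun t => dMat 𝓘(ℝ, E4 × LowTri) (P.sigMat i c) (g t) (w t) μ a) t₀ := fun μ a =>
    hw.map_apply (smooth_sigMat P hi hc μ a)
  have hC : ∀ ν lam, ContMDiffAt IN 𝓘(ℝ, ℝ) ∞ (fun t => connMat K c (g t).pt
      (mfderiv 𝓘(ℝ, E4 × LowTri) 𝓘(ℝ, E4) Tetrads.pt (g t) (w t)) ν lam) t₀ := fun ν lam =>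
    smooth_connMat hK (SmoothVec.map (contMDiffAt_pt (g t₀)) hw) hc ν lam
  have hsum : ∀ μ a, ContMDiffAt IN 𝓘(ℝ, ℝ) ∞ (fun t =>
      (dMat 𝓘(ℝ, E4 × LowTri) (P.sigMat i c) (g t) (w t) + connMat K c (g t).pt
        (mfderiv 𝓘(ℝ, E4 × LowTri) 𝓘(ℝ, E4) Tetrads.pt (g t) (w t)) * P.sigMat i c (g t)) μ a)
      t₀ := fun μ a => (hd μ a).add (contMDiffAt_matrix_mul hC hs μ a)
  have hθ : ∀ a b, ContMDiffAt IN 𝓘(ℝ, ℝ) ∞ (fun t => frameForm P K i c (g t) (w t) a b) t₀ :=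
    contMDiffAt_matrix_mul hsi hsum
  have he : ∀ a b, ContMDiffAt IN 𝓘(ℝ, ℝ) ∞ (fun _ : N => eta a b) t₀ := fun a b =>
    contMDiffAt_const
  have hA : ContMDiffAt IN 𝓘(ℝ, ℝ) ∞
      (fun t => antisymEta (frameForm P K i c (g t) (w t)) a b) t₀ :=
    contMDiffAt_const.mul (ContMDiffAt.sub (contMDiffAt_matrix_mul hθ he a b)
      (contMDiffAt_matrix_mul (g := fun t => (frameForm P K i c (g t) (w t))ᵀ) he
        (fun a b => hθ b a) a b))
  refine hA.congr_of_eventuallyEq ?_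
  filter_upwards [((contMDiffAt_pt (g t₀)).comp t₀ hw.base).continuousAt.eventually
    (c.1.open_source.mem_nhds hc)] with t ht
  exact tetradForm_eq P K i ht (w t) a b

/-- The connection on `S → Σ` with `dy = -½ A^{ab} I_{ab} y`. -/
def tetradConn {K : WorldConn X} (hK : K.ContMDiffCovariantDerivative ∞) : P.ConnS 𝒮 where
  jet := tetradJet P 𝒮 K
  smooth y₀ := by
    refine conn_smooth (tetradJet P 𝒮 K) fun w hw => ?_
    have hi : y₀.proj ∈ P.baseSet (P.indexAt y₀.proj) := P.mem_baseSet_at _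
    have hc : y₀.proj.pt ∈ (achart E4 y₀.proj.pt).1.source := mem_chart_source E4 y₀.proj.pt
    have hfib := contMDiffAt_fibre (IB := 𝓘(ℝ, E4 × LowTri))
      ((P.core 𝒮).localTriv (P.indexAt y₀.proj)) hi
    have hsum : ContMDiffAt (𝓘(ℝ, E4 × LowTri).prod 𝓘(ℝ, V)) 𝓘(ℝ, V) ∞ (fun y : P.S 𝒮 =>
        -(1 / 2 : ℝ) • ∑ a, ∑ b, P.tetradForm K (P.indexAt y₀.proj) (achart E4 y₀.proj.pt) a b
          y.proj (w y) • 𝒮.gen a b (P.fib 𝒮 (P.indexAt y₀.proj) y)) y₀ := by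
      have hr : ContMDiffAt (𝓘(ℝ, E4 × LowTri).prod 𝓘(ℝ, V)) 𝓘(ℝ, ℝ) ∞
          (fun _ : P.S 𝒮 => -(1 / 2 : ℝ)) y₀ := contMDiffAt_const
      refine hr.smul (contMDiffAt_finsetSum fun a _ => contMDiffAt_finsetSum
        fun b _ => (smooth_tetradForm P hK hw hi hc a b).smul ?_)
      exact (𝒮.gen a b).contMDiff.contMDiffAt.comp y₀ hfib
    refine hsum.congr_of_eventuallyEq ?_
    filter_upwards [hw.base.continuousAt.eventually (eventually_mem_base P hi hc)] with y hy
    exact dfib_tetradJet P 𝒮 K hy.1 hy.2 (w y)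

lemma isTetradConn_tetradConn {K : WorldConn X} (hK : K.ContMDiffCovariantDerivative ∞) :
    P.IsTetradConn 𝒮 K (tetradConn P 𝒮 hK) := fun _ _ _ hi hc w => dfib_tetradJet P 𝒮 K hi hc w

lemma existsUnique_tetradConn {K : WorldConn X} (hK : K.ContMDiffCovariantDerivative ∞) :
    ∃! A : P.ConnS 𝒮, P.IsTetradConn 𝒮 K A := by
  refine ⟨tetradConn P 𝒮 hK, isTetradConn_tetradConn P 𝒮 hK, fun A hA => ?_⟩
  have e : A.jet = (tetradConn P 𝒮 hK).jet := by
    funext y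
    refine Subtype.ext (ContinuousLinearMap.ext fun w => ?_)
    have hi : y.proj ∈ P.baseSet (P.indexAt y.proj) := P.mem_baseSet_at _
    have hc : y.proj.pt ∈ (achart E4 y.proj.pt).1.source := mem_chart_source E4 y.proj.pt
    refine tangent_ext (IB := 𝓘(ℝ, E4 × LowTri)) ((P.core 𝒮).localTriv (P.indexAt y.proj)) hi ?_ ?_
    · rw [dProj_connS, dProj_connS]
    · exact (hA _ _ y hi hc w).trans (isTetradConn_tetradConn P 𝒮 hK _ _ y hi hc w).symm
  cases A
  congr

end smoothness

/-! ### Components in a frame and the metric of a tetrad field -/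

lemma antisymEta_entry (θ : Mat4) (a b : Fin 4) :
    antisymEta θ a b = 1 / 2 * (θ a b * sgn b - sgn a * θ b a) := by
  rw [antisymEta, Matrix.smul_apply, Matrix.sub_apply, eta, Matrix.mul_diagonal,
    Matrix.diagonal_mul, Matrix.transpose_apply, smul_eq_mul]

section frameCoeff

variable {X : Type*} [TopologicalSpace X] [ChartedSpace E4 X] [IsManifold 𝓘(ℝ, E4) ∞ X]

/-- The components of a vector in a frame. -/
def frameCoeff {x : X} (f : Frame x) (u : E4) : Fin 4 → ℝ := f.mat⁻¹ *ᵥ u.ofLp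

lemma frameCoeff_sub {x : X} (f : Frame x) (u v : E4) (a : Fin 4) :
    frameCoeff f (u - v) a = frameCoeff f u a - frameCoeff f v a :=
  congrFun (Matrix.mulVec_sub _ u.ofLp v.ofLp) a

variable [OrientedAtlas X]

lemma frameCoeff_vec {x : X} (f : Frame x) (a b : Fin 4) :
    frameCoeff f (f.vec b) a = if a = b then 1 else 0 := by
  have h := congrFun (congrFun (Matrix.nonsing_inv_mul _ (det_frame_mat f)) a) b
  rw [Matrix.one_apply] at h
  exact h

lemma eq_sum_frame {x : X} (f : Frame x) (u : E4) : u = ∑ a, frameCoeff f u a • (f.vec a : E4) := by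
  refine WithLp.ofLp_injective 2 (funext fun μ => ?_)
  have h : f.mat *ᵥ frameCoeff f u = u.ofLp := by
    rw [frameCoeff, Matrix.mulVec_mulVec, Matrix.mul_nonsing_inv _ (det_frame_mat f),
      Matrix.one_mulVec]
  have key : ∀ (r : Fin 4 → ℝ) (w : Fin 4 → E4),
      (∑ a, r a • w a : E4).ofLp μ = ∑ a, (w a).ofLp μ * r a := fun r w => by
    simp [Finset.sum_apply, mul_comm]
  exact (congrFun h μ).symm.trans (key _ f.vec).symm

lemma frameCoeff_eq {x : X} (f : Frame x) (c : atlas E4 X) (hx : x ∈ c.1.source)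
    (u : TangentSpace 𝓘(ℝ, E4) x) (a : Fin 4) :
    frameCoeff f u a = ∑ μ, (f.matIn c)⁻¹ a μ * dcoord c μ x u := by
  have hJ : IsUnit (jacMat (achart E4 x) c x).det :=
    (OrientedAtlas.det_pos _ _ _ (mem_chart_source E4 x) hx).ne'.isUnit
  have h : f.mat⁻¹ = (f.matIn c)⁻¹ * jacMat (achart E4 x) c x := by
    rw [Frame.matIn, Matrix.mul_inv_rev, Matrix.nonsing_inv_mul_cancel_right _ _ hJ]
  have h2 : frameCoeff f u = (f.matIn c)⁻¹ *ᵥ (jacMat (achart E4 x) c x *ᵥ (u : E4).ofLp) := by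
    rw [Matrix.mulVec_mulVec, ← h]
    rfl
  have h3 : (fun μ => dcoord c μ x u) = jacMat (achart E4 x) c x *ᵥ (u : E4).ofLp :=
    funext fun μ => dcoord_eq_sum c hx μ u
  change _ = ((f.matIn c)⁻¹ *ᵥ fun μ => dcoord c μ x u) a
  rw [h3]
  exact congrFun h2 a

end frameCoeff

section tetrads

variable {X : Type*} [TopologicalSpace X] [ChartedSpace E4 X] [IsManifold 𝓘(ℝ, E4) ∞ X]
  [OrientedAtlas X] {ι : Type*} (P : SpinLift X ι) (h : TetradMap X)

lemma lorentzForm_eq {i : ι} {σ : Tetrads X} (hi : σ ∈ P.baseSet i)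
    (u v : TangentSpace 𝓘(ℝ, E4) σ.pt) : lorentzForm σ u v =
      ∑ a, sgn a * frameCoeff (P.frame i σ) u a * frameCoeff (P.frame i σ) v a := by
  have h1 : Quotient.mk (frameSetoid σ.pt) (P.frame i σ) = σ.cls := by
    have h2 := P.frame_section i σ hi
    rw [Tetrads.mk.injEq] at h2
    exact eq_of_heq h2.2
  rw [lorentzForm, ← h1]
  rfl

variable {h}

lemma tetradMetric_eq {i : ι} {x : X} (hi : h x ∈ P.baseSet i) (u v : TangentSpace 𝓘(ℝ, E4) x) :
    tetradMetric h x u v =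
      ∑ a, sgn a * frameCoeff (P.frame i (h x)) u a * frameCoeff (P.frame i (h x)) v a :=
  lorentzForm_eq P hi u v

lemma tetradMetric_tetradField_left {i : ι} {x : X} (hi : h x ∈ P.baseSet i) (a : Fin 4)
    (u : TangentSpace 𝓘(ℝ, E4) x) : tetradMetric h x (P.tetradField h i a x) u =
      sgn a * frameCoeff (P.frame i (h x)) u a := by
  rw [tetradMetric_eq P hi]
  simp only [SpinLift.tetradField, frameCoeff_vec]
  simp

lemma tetradMetric_tetradField_right {i : ι} {x : X} (hi : h x ∈ P.baseSet i) (a : Fin 4)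
    (u : TangentSpace 𝓘(ℝ, E4) x) : tetradMetric h x u (P.tetradField h i a x) =
      sgn a * frameCoeff (P.frame i (h x)) u a := by
  rw [tetradMetric_eq P hi]
  simp only [SpinLift.tetradField, frameCoeff_vec]
  simp

lemma tetradMetric_sub_left {i : ι} {x : X} (hi : h x ∈ P.baseSet i)
    (u u' v : TangentSpace 𝓘(ℝ, E4) x) :
    tetradMetric h x (u - u') v = tetradMetric h x u v - tetradMetric h x u' v := by
  simp only [tetradMetric_eq P hi, ← Finset.sum_sub_distrib]
  refine Finset.sum_congr rfl fun a _ => ?_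
  have := frameCoeff_sub (P.frame i (h x)) u u' a
  rw [show frameCoeff (P.frame i (h x)) (u - u') a = _ from this]
  ring

lemma tetradMetric_sub_right {i : ι} {x : X} (hi : h x ∈ P.baseSet i)
    (u v v' : TangentSpace 𝓘(ℝ, E4) x) :
    tetradMetric h x u (v - v') = tetradMetric h x u v - tetradMetric h x u v' := by
  simp only [tetradMetric_eq P hi, ← Finset.sum_sub_distrib]
  refine Finset.sum_congr rfl fun a _ => ?_
  have := frameCoeff_sub (P.frame i (h x)) v v' a
  rw [show frameCoeff (P.frame i (h x)) (v - v') a = _ from this]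
  ring

lemma eq_sum_tetradField (i : ι) (x : X) (u : TangentSpace 𝓘(ℝ, E4) x) :
    u = ∑ a, frameCoeff (P.frame i (h x)) u a • P.tetradField h i a x :=
  eq_sum_frame (P.frame i (h x)) u

/-- An operator is symmetric for the metric of a tetrad field if its matrix elements in the
tetrad are symmetric. -/
lemma tetradMetric_symm_of_tetradField {i : ι} {x : X} (hi : h x ∈ P.baseSet i)
    (T : TangentSpace 𝓘(ℝ, E4) x →ₗ[ℝ] TangentSpace 𝓘(ℝ, E4) x)
    (hT : ∀ a b, tetradMetric h x (P.tetradField h i a x) (T (P.tetradField h i b x)) =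
      tetradMetric h x (P.tetradField h i b x) (T (P.tetradField h i a x)))
    (u v : TangentSpace 𝓘(ℝ, E4) x) :
    tetradMetric h x u (T v) = tetradMetric h x v (T u) := by
  have e : ∀ u v : TangentSpace 𝓘(ℝ, E4) x, tetradMetric h x u (T v) =
      ∑ a, ∑ b, frameCoeff (P.frame i (h x)) u a * frameCoeff (P.frame i (h x)) v b *
        tetradMetric h x (P.tetradField h i a x) (T (P.tetradField h i b x)) := by
    intro u v
    rw [tetradMetric_eq P hi]
    refine Finset.sum_congr rfl fun a _ => ?_
    have h1 : frameCoeff (P.frame i (h x)) (T v) a = ∑ b, frameCoeff (P.frame i (h x)) v b *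
        frameCoeff (P.frame i (h x)) (T (P.tetradField h i b x)) a := by
      let L : TangentSpace 𝓘(ℝ, E4) x →ₗ[ℝ] ℝ :=
        { toFun := fun u => frameCoeff (P.frame i (h x)) u a
          map_add' := fun u v => congrFun (Matrix.mulVec_add _ (WithLp.ofLp u) (WithLp.ofLp v)) a
          map_smul' := fun r v => congrFun (Matrix.mulVec_smul _ r (WithLp.ofLp v)) a }
      change L (T v) = ∑ b, frameCoeff (P.frame i (h x)) v b * L (T (P.tetradField h i b x))
      conv_lhs => rw [eq_sum_tetradField P (h := h) i x v]
      simp only [map_sum, map_smul, smul_eq_mul]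
    rw [h1, Finset.mul_sum]
    refine Finset.sum_congr rfl fun b _ => ?_
    rw [tetradMetric_tetradField_left P hi]
    ring
  rw [e u v, e v u, Finset.sum_comm]
  refine Finset.sum_congr rfl fun a _ => Finset.sum_congr rfl fun b _ => ?_
  rw [hT b a]
  ring

end tetrads

/-! ### Connection forms in a tetrad field -/

section pullback

variable {X : Type*} [TopologicalSpace X] [ChartedSpace E4 X] [IsManifold 𝓘(ℝ, E4) ∞ X]
  [OrientedAtlas X] {ι : Type*} (P : SpinLift X ι) {h : TetradMap X}

/-- Covectors at equal base points agree on the same components. -/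
lemma dcoord_congr (c : atlas E4 X) (μ : Fin 4) {z x : X} (hz : z = x) (v : E4) :
    dcoord c μ z v = dcoord c μ x v := by
  subst hz
  rfl

lemma connMat_congr (K : WorldConn X) (c : atlas E4 X) {z x : X} (hz : z = x) (v : E4) :
    connMat K c z v = connMat K c x v := by
  subst hz
  rfl

lemma sigMat_tetrad (hsec : ∀ x, (h x).pt = x) (i : ι) {c : atlas E4 X} {x : X}
    (hx : x ∈ c.1.source) (μ a : Fin 4) :
    P.sigMat i c (h x) μ a = dcoord c μ x (P.tetradField h i a x) :=
  ((P.frame i (h x)).matIn_eq_dcoord c (by rw [hsec]; exact hx) μ a).trans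
    (dcoord_congr c μ (hsec x) _)

lemma mdiffField_tetradField (hsec : ∀ x, (h x).pt = x) {i : ι} {x : X} (hi : h x ∈ P.baseSet i)
    (a : Fin 4) : MDiffField (P.tetradField h i a) x := by
  have h1 : ContMDiffAt 𝓘(ℝ, E4) 𝓘(ℝ, E4).tangent ∞ (fun x' => (⟨(h x').pt,
      (P.frame i (h x')).vec a⟩ : TangentBundle 𝓘(ℝ, E4) X)) x :=
    ((P.frame_smooth i a).contMDiffAt ((P.isOpen_baseSet i).mem_nhds hi)).comp x
      h.contMDiff.contMDiffAt
  have h2 : ∀ (z x' : X), z = x' → ∀ v : E4,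
      (⟨x', v⟩ : TangentBundle 𝓘(ℝ, E4) X) = ⟨z, v⟩ := by
    rintro z _ rfl v
    rfl
  refine (h1.congr_of_eventuallyEq (Filter.Eventually.of_forall fun x' => ?_)).mdifferentiableAt
    (by simp)
  exact h2 _ _ (hsec x') ((P.frame i (h x')).vec a)

variable (h) in
/-- The connection form `h^a_ν (dh^ν_b + K^ν_{λμ} h^λ_b dx^μ)` of a connection on `TX` in a
tetrad. -/
def tetradTheta (K : WorldConn X) (i : ι) (c : atlas E4 X) (x : X)
    (v : TangentSpace 𝓘(ℝ, E4) x) : Mat4 :=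
  (P.sigMat i c (h x))⁻¹ * (dMat 𝓘(ℝ, E4) (fun x' => P.sigMat i c (h x')) x v +
    connMat K c x v * P.sigMat i c (h x))

lemma frameForm_tetrad (hsec : ∀ x, (h x).pt = x) (K : WorldConn X) {i : ι} {c : atlas E4 X}
    {x : X} (hi : h x ∈ P.baseSet i) (hx : x ∈ c.1.source) (v : TangentSpace 𝓘(ℝ, E4) x) :
    frameForm P K i c (h x) (mfderiv 𝓘(ℝ, E4) 𝓘(ℝ, E4 × LowTri) h x v) =
      tetradTheta P h K i c x v := by
  have hc : (h x).pt ∈ c.1.source := by rw [hsec]; exact hx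
  have h1 := dMat_comp (mdiff_sigMat P hi hc)
    (h.contMDiff.contMDiffAt.mdifferentiableAt (x := x) (by simp)) v
  rw [frameForm, tetradTheta, h1]
  refine congrArg (fun m => (P.sigMat i c (h x))⁻¹ * (dMat 𝓘(ℝ, E4 × LowTri) (P.sigMat i c) (h x)
    (mfderiv 𝓘(ℝ, E4) 𝓘(ℝ, E4 × LowTri) h x v) + m * P.sigMat i c (h x))) ?_
  refine (congrArg (connMat K c (h x).pt) (mfderiv_pt_section h hsec x v)).trans ?_
  exact connMat_congr K c (hsec x) v

/-- The entries of the connection form are the frame components `h^a(∇_v h_d)`. -/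
lemma tetradTheta_apply (hsec : ∀ x, (h x).pt = x) (K : WorldConn X) {i : ι} {c : atlas E4 X}
    {x : X} (hi : h x ∈ P.baseSet i) (hx : x ∈ c.1.source) (v : TangentSpace 𝓘(ℝ, E4) x)
    (a d : Fin 4) : tetradTheta P h K i c x v a d =
      frameCoeff (P.frame i (h x)) (K (P.tetradField h i d) x v) a := by
  have hc : (h x).pt ∈ c.1.source := by rw [hsec]; exact hx
  have hev : (fun x' => P.sigMat i c (h x')) =ᶠ[𝓝 x] fun x' => Matrix.of fun μ a =>
      dcoord c μ x' (P.tetradField h i a x') := by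
    filter_upwards [c.1.open_source.mem_nhds hx] with x' hx'
    ext μ a
    exact sigMat_tetrad P hsec i hx' μ a
  rw [tetradTheta, Matrix.mul_apply]
  refine Eq.trans ?_ (frameCoeff_eq (P.frame i (h x)) c hc _ a).symm
  refine Finset.sum_congr rfl fun ν _ => congrArg ((P.sigMat i c (h x))⁻¹ a ν * ·) ?_
  refine Eq.trans ?_ (dcoord_congr c ν (hsec x) _).symm
  refine Eq.trans ?_ (dcoord_cov K c hx (mdiffField_tetradField P hsec hi d) ν v).symm
  rw [dMat_congr hev, Matrix.add_apply, Matrix.mul_apply]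
  simp only [sigMat_tetrad P hsec i hx]
  rfl

lemma spinForm_eq (hsec : ∀ x, (h x).pt = x) (N : WorldConn X) {i : ι} {c : atlas E4 X}
    {x : X} (hi : h x ∈ P.baseSet i) (hx : x ∈ c.1.source) (v : TangentSpace 𝓘(ℝ, E4) x)
    (a b : Fin 4) : P.spinForm N h i a b x v = tetradTheta P h N i c x v a b * sgn b := by
  rw [SpinLift.spinForm]
  have e : ∀ d, ((P.frame i (h x)).mat⁻¹ *ᵥ (N (P.tetradField h i d) x v : E4).ofLp) a =
      tetradTheta P h N i c x v a d := fun d => (tetradTheta_apply P hsec N hi hx v a d).symm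
  simp only [e, eta, Matrix.diagonal_apply, ite_mul, zero_mul, Finset.sum_ite_eq,
    Finset.mem_univ, if_true]
  exact mul_comm _ _

lemma tetradFormH_eq (K : WorldConn X) (i : ι) (c : atlas E4 X) (x : X) (a b μ : Fin 4) :
    P.tetradFormH K h i c a b μ x =
      antisymEta (tetradTheta P h K i c x (coordField c μ x)) a b := by
  rw [tetradTheta, antisymEta_apply]
  rfl

/-- The covariant derivative of the metric of a tetrad field in the tetrad. -/
lemma derivMetric_tetradField (hsec : ∀ x, (h x).pt = x) (K : WorldConn X) {i : ι} {c : atlas E4 X}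
    {x : X} (hi : h x ∈ P.baseSet i) (hx : x ∈ c.1.source) (v : TangentSpace 𝓘(ℝ, E4) x)
    (a b : Fin 4) :
    derivMetric K h (P.tetradField h i a) (P.tetradField h i b) x v =
      -(sgn b * tetradTheta P h K i c x v b a + sgn a * tetradTheta P h K i c x v a b) := by
  have hev : (fun x' => tetradMetric h x' (P.tetradField h i a x') (P.tetradField h i b x'))
      =ᶠ[𝓝 x] fun _ => sgn a * if a = b then 1 else 0 := by
    filter_upwards [h.contMDiff.continuous.continuousAt.eventually
      ((P.isOpen_baseSet i).mem_nhds hi)] with x' hx'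
    rw [tetradMetric_tetradField_left P hx']
    exact congrArg (sgn a * ·) (frameCoeff_vec (P.frame i (h x')) a b)
  have h0 : dfun (fun x' => tetradMetric h x' (P.tetradField h i a x') (P.tetradField h i b x'))
      x v = 0 := by
    have := congrArg (fun T => T v) (mvfderiv_congr (I := 𝓘(ℝ, E4)) hev)
    refine this.trans ?_
    rw [mvfderiv_const]
    rfl
  rw [derivMetric, h0, tetradMetric_tetradField_right P hi, tetradMetric_tetradField_left P hi,
    tetradTheta_apply P hsec K hi hx, tetradTheta_apply P hsec K hi hx]
  ring

/-- The connection form of a metric connection takes values in the Lorentz algebra. -/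
lemma antisymEta_tetradTheta_of_isMetric (hsec : ∀ x, (h x).pt = x) {K : WorldConn X}
    (hK : IsMetric K h) {i : ι} {c : atlas E4 X} {x : X} (hi : h x ∈ P.baseSet i)
    (hx : x ∈ c.1.source) (v : TangentSpace 𝓘(ℝ, E4) x) (a b : Fin 4) :
    antisymEta (tetradTheta P h K i c x v) a b = tetradTheta P h K i c x v a b * sgn b := by
  have h1 := hK x _ _ (mdiffField_tetradField P hsec hi a) (mdiffField_tetradField P hsec hi b) v
  rw [derivMetric_tetradField P hsec K hi hx] at h1
  rw [antisymEta_entry]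
  have ha := sgn_mul_self a
  have hb := sgn_mul_self b
  generalize tetradTheta P h K i c x v a b = p at *
  generalize tetradTheta P h K i c x v b a = q at *
  linear_combination (1 / 2 * sgn a * sgn b) * h1 + (1 / 2 * p * sgn b) * ha +
    1 / 2 * q * sgn a * hb

end pullback

section tetradSpinConn

variable {X : Type*} [TopologicalSpace X] [ChartedSpace E4 X] [IsManifold 𝓘(ℝ, E4) ∞ X]
  [OrientedAtlas X] {ι : Type*} (P : SpinLift X ι)
  {V : Type*} [NormedAddCommGroup V] [NormedSpace ℂ V] [FiniteDimensional ℂ V]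
  (𝒮 : SpinorSpace V) {h : TetradMap X}

/-- The horizontal lifts of the connection on `S_h` induced by the connection of `K`. -/
lemma dfib_induced (hsec : ∀ x, (h x).pt = x) {K : WorldConn X}
    {A : P.ConnS 𝒮} (hA : P.IsTetradConn 𝒮 K A) {B : P.ConnH 𝒮 h} (hB : P.IsInduced 𝒮 A h B)
    {i : ι} {c : atlas E4 X} {y : P.SH 𝒮 h} (hi : h y.proj ∈ P.baseSet i)
    (hx : y.proj ∈ c.1.source) (v : TangentSpace 𝓘(ℝ, E4) y.proj) :
    P.dfib 𝒮 i (P.incl 𝒮 h y) (P.tincl 𝒮 h y ((B.jet y).1 v)) =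
      -(1 / 2 : ℝ) • ∑ a, ∑ b, antisymEta (tetradTheta P h K i c y.proj v) a b •
        𝒮.gen a b (P.fib 𝒮 i (P.incl 𝒮 h y)) := by
  have hc : (h y.proj).pt ∈ c.1.source := by rw [hsec]; exact hx
  rw [hB y v]
  refine (hA i c (P.incl 𝒮 h y) hi hc _).trans ?_
  refine congrArg (-(1 / 2 : ℝ) • ·) (Finset.sum_congr rfl fun a _ => Finset.sum_congr rfl
    fun b _ => congrArg (· • 𝒮.gen a b (P.fib 𝒮 i (P.incl 𝒮 h y))) ?_)
  refine (tetradForm_eq P K i hc _ a b).trans ?_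
  exact congrArg (fun m => antisymEta m a b) (frameForm_tetrad P hsec K hi hx v)

lemma dfib_induced_coord (hsec : ∀ x, (h x).pt = x) {K : WorldConn X}
    {A : P.ConnS 𝒮} (hA : P.IsTetradConn 𝒮 K A) {B : P.ConnH 𝒮 h} (hB : P.IsInduced 𝒮 A h B)
    {i : ι} {c : atlas E4 X} {y : P.SH 𝒮 h} (hi : h y.proj ∈ P.baseSet i)
    (hx : y.proj ∈ c.1.source) (v : TangentSpace 𝓘(ℝ, E4) y.proj) :
    P.dfib 𝒮 i (P.incl 𝒮 h y) (P.tincl 𝒮 h y ((B.jet y).1 v)) =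
      -(1 / 2 : ℝ) • ∑ a, ∑ b,
        (∑ μ, P.tetradFormH K h i c a b μ y.proj * dcoord c μ y.proj v) •
          𝒮.gen a b (P.fib 𝒮 i (P.incl 𝒮 h y)) := by
  have h1 := clm_eq_sum c hx ((P.dfib 𝒮 i (P.incl 𝒮 h y)).comp
    ((P.tincl 𝒮 h y).comp (B.jet y).1)) v
  refine h1.trans ?_
  have h2 : ∀ μ, ((P.dfib 𝒮 i (P.incl 𝒮 h y)).comp ((P.tincl 𝒮 h y).comp (B.jet y).1))
      (coordField c μ y.proj) = -(1 / 2 : ℝ) • ∑ a, ∑ b, P.tetradFormH K h i c a b μ y.proj •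
        𝒮.gen a b (P.fib 𝒮 i (P.incl 𝒮 h y)) := fun μ => by
    simp only [tetradFormH_eq]
    exact dfib_induced P 𝒮 hsec hA hB hi hx (coordField c μ y.proj)
  simp only [h2]
  simp only [Finset.smul_sum, Finset.sum_smul, smul_smul]
  rw [Finset.sum_comm]
  refine Finset.sum_congr rfl fun a _ => ?_
  rw [Finset.sum_comm]
  refine Finset.sum_congr rfl fun b _ => Finset.sum_congr rfl fun μ _ => ?_
  congr 1
  ring

/-- The induced connection is the spin connection of a metric connection `N` if and only if the
connection forms agree. -/
lemma isSpinConn_iff (hsec : ∀ x, (h x).pt = x) {K : WorldConn X}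
    {A : P.ConnS 𝒮} (hA : P.IsTetradConn 𝒮 K A) {B : P.ConnH 𝒮 h} (hB : P.IsInduced 𝒮 A h B)
    (N : WorldConn X) (hN : IsMetric N h) :
    P.IsSpinConn 𝒮 N h B ↔ ∀ (i : ι) (c : atlas E4 X) (x : X), h x ∈ P.baseSet i →
      x ∈ c.1.source → ∀ (v : TangentSpace 𝓘(ℝ, E4) x),
        antisymEta (tetradTheta P h K i c x v) = antisymEta (tetradTheta P h N i c x v) := by
  constructor
  · intro hS i c x hi hx v
    refine sub_eq_zero.mp (eq_zero_of_gen_sum 𝒮 _ (fun a b => ?_) fun u => ?_)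
    · simp only [Matrix.sub_apply, antisymEta_antisymm _ a b]
      ring
    · -- every spinor is the coordinate of a point of the fibre
      let y : P.SH 𝒮 h := ⟨x, ((P.core 𝒮).localTriv i).symm (h x) u⟩
      have hy : P.fib 𝒮 i (P.incl 𝒮 h y) = u :=
        congrArg Prod.snd (((P.core 𝒮).localTriv i).apply_mk_symm hi u)
      have h1 := (dfib_induced P 𝒮 hsec hA hB (y := y) hi hx v).symm.trans (hS i y hi v)
      rw [hy] at h1
      have h2 := smul_right_injective V (by norm_num : -(1 / 2 : ℝ) ≠ 0) h1
      have h3 : ∀ a b, P.spinForm N h i a b y.proj v =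
          antisymEta (tetradTheta P h N i c x v) a b := fun a b =>
        (spinForm_eq P hsec N hi hx v a b).trans
          (antisymEta_tetradTheta_of_isMetric P hsec hN hi hx v a b).symm
      simp only [h3] at h2
      simp only [Matrix.sub_apply, sub_smul, Finset.sum_sub_distrib]
      exact sub_eq_zero.mpr h2
  · intro hθ i y hi v
    have hx : y.proj ∈ (achart E4 y.proj).1.source := mem_chart_source E4 y.proj
    refine (dfib_induced P 𝒮 hsec hA hB (c := achart E4 y.proj) hi hx v).trans ?_
    simp only [hθ i (achart E4 y.proj) y.proj hi hx v,
      antisymEta_tetradTheta_of_isMetric P hsec hN hi hx v, spinForm_eq P hsec N hi hx v]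

end tetradSpinConn

/-! ### Comparison of symmetric connections -/

section difference

variable {X : Type*} [TopologicalSpace X] [ChartedSpace E4 X] [IsManifold 𝓘(ℝ, E4) ∞ X]
  [OrientedAtlas X] {ι : Type*} (P : SpinLift X ι) {h : TetradMap X}

lemma difference_apply_field (K N : WorldConn X) {x : X} {Y : ∀ x : X, TangentSpace 𝓘(ℝ, E4) x}
    (hY : MDiffField Y x) : K.difference N x (Y x) = K Y x - N Y x :=
  IsCovariantDerivativeOn.difference_apply _ _ (Set.mem_univ x) hY

lemma exists_field {x : X} (u : TangentSpace 𝓘(ℝ, E4) x) :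
    ∃ U : ∀ x : X, TangentSpace 𝓘(ℝ, E4) x, MDiffField U x ∧ U x = u :=
  ⟨FiberBundle.extend E4 u, FiberBundle.mdifferentiableAt_extend 𝓘(ℝ, E4) E4 u,
    FiberBundle.extend_apply_self E4 u⟩

/-- The difference of two torsion-free connections is symmetric. -/
lemma difference_symm {K N : WorldConn X} (hK : K.torsion = 0) (hN : N.torsion = 0) (x : X)
    (u v : TangentSpace 𝓘(ℝ, E4) x) : K.difference N x u v = K.difference N x v u := by
  obtain ⟨U, hU, rfl⟩ := exists_field u
  obtain ⟨W, hW, rfl⟩ := exists_field v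
  have h1 := (K.torsion_eq_zero_iff.mp hK hU hW).trans (N.torsion_eq_zero_iff.mp hN hU hW).symm
  rw [difference_apply_field K N hU, difference_apply_field K N hW, sub_apply, sub_apply,
    ← sub_eq_zero]
  rw [← sub_eq_zero] at h1
  rw [← neg_eq_zero, ← h1]
  abel

/-- The covariant derivative of the metric with respect to a metric connection plus a difference
tensor. -/
lemma derivMetric_eq_difference (K : WorldConn X) {N : WorldConn X} (hN : IsMetric N h) {i : ι}
    {x : X} (hi : h x ∈ P.baseSet i) {Y Z : ∀ x : X, TangentSpace 𝓘(ℝ, E4) x}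
    (hY : MDiffField Y x) (hZ : MDiffField Z x) (v : TangentSpace 𝓘(ℝ, E4) x) :
    derivMetric K h Y Z x v = -(tetradMetric h x (K.difference N x (Y x) v) (Z x) +
      tetradMetric h x (Y x) (K.difference N x (Z x) v)) := by
  have h1 := hN x Y Z hY hZ v
  rw [derivMetric] at h1 ⊢
  rw [difference_apply_field K N hY, difference_apply_field K N hZ, sub_apply, sub_apply,
    tetradMetric_sub_left P hi, tetradMetric_sub_right P hi]
  linarith

/-- For a torsion-free metric connection `N`, the derivative `∇ g_h` is totally symmetric exactly if
the difference tensor of `K` and `N` is totally symmetric. -/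
lemma isCodazzi_iff (P : SpinLift X ι) {K N : WorldConn X} (hK : K.torsion = 0) (hN : N.torsion = 0)
    (hNh : IsMetric N h) : IsCodazzi K h ↔ ∀ (x : X) (u v w : TangentSpace 𝓘(ℝ, E4) x),
      tetradMetric h x u (K.difference N x v w) = tetradMetric h x v (K.difference N x u w) := by
  constructor
  · intro hC x u v w
    have hi : h x ∈ P.baseSet (P.indexAt (h x)) := P.mem_baseSet_at _
    obtain ⟨U, hU, rfl⟩ := exists_field u
    obtain ⟨W, hW, rfl⟩ := exists_field v
    obtain ⟨Z, hZ, rfl⟩ := exists_field w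
    have h1 := hC x _ _ _ hW hU hZ
    rw [derivMetric_eq_difference P K hNh hi hU hZ, derivMetric_eq_difference P K hNh hi hW hZ,
      difference_symm hK hN x (U x) (W x), difference_symm hK hN x (Z x) (W x),
      difference_symm hK hN x (Z x) (U x)] at h1
    linarith
  · intro hD x Y Y' Z hY hY' hZ
    have hi : h x ∈ P.baseSet (P.indexAt (h x)) := P.mem_baseSet_at _
    rw [derivMetric_eq_difference P K hNh hi hY' hZ, derivMetric_eq_difference P K hNh hi hY hZ,
      difference_symm hK hN x (Y' x) (Y x), difference_symm hK hN x (Z x) (Y x),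
      difference_symm hK hN x (Z x) (Y' x), hD x (Y' x) (Y x) (Z x)]

/-- The Lorentz parts of two torsion-free connections agree exactly if their difference tensor is
totally symmetric. -/
lemma antisymEta_tetradTheta_eq_iff (hsec : ∀ x, (h x).pt = x) (K N : WorldConn X) {i : ι}
    {c : atlas E4 X} {x : X} (hi : h x ∈ P.baseSet i) (hx : x ∈ c.1.source)
    (w : TangentSpace 𝓘(ℝ, E4) x) :
    antisymEta (tetradTheta P h K i c x w) = antisymEta (tetradTheta P h N i c x w) ↔
      ∀ u v : TangentSpace 𝓘(ℝ, E4) x,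
        tetradMetric h x u (K.difference N x v w) = tetradMetric h x v (K.difference N x u w) := by
  have hD : ∀ a b, tetradMetric h x (P.tetradField h i a x)
      (K.difference N x (P.tetradField h i b x) w) =
        sgn a * (tetradTheta P h K i c x w a b - tetradTheta P h N i c x w a b) := by
    intro a b
    rw [difference_apply_field K N (mdiffField_tetradField P hsec hi b), sub_apply,
      tetradMetric_tetradField_left P hi, tetradTheta_apply P hsec K hi hx,
      tetradTheta_apply P hsec N hi hx]
    exact congrArg (sgn a * ·) (frameCoeff_sub _ _ _ a)
  constructor
  · intro hθ u v
    refine tetradMetric_symm_of_tetradField P hi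
      { toFun := fun u => K.difference N x u w
        map_add' := fun u v => by rw [map_add, add_apply]
        map_smul' := fun r u => by rw [map_smul, smul_apply, RingHom.id_apply] } (fun a b => ?_) u v
    have h1 := congrFun (congrFun hθ a) b
    rw [antisymEta_entry, antisymEta_entry] at h1
    refine (hD a b).trans (Eq.trans ?_ (hD b a).symm)
    have ha := sgn_mul_self a
    have hb := sgn_mul_self b
    generalize tetradTheta P h K i c x w a b = p at *
    generalize tetradTheta P h K i c x w b a = q at *
    generalize tetradTheta P h N i c x w a b = p' at *
    generalize tetradTheta P h N i c x w b a = q' at *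
    linear_combination (2 * sgn a * sgn b) * h1 - sgn a * (p - p') * hb + sgn b * (q - q') * ha
  · intro hS
    ext a b
    have h1 := (hD a b).symm.trans ((hS _ _).trans (hD b a))
    rw [antisymEta_entry, antisymEta_entry]
    have ha := sgn_mul_self a
    have hb := sgn_mul_self b
    generalize tetradTheta P h K i c x w a b = p at *
    generalize tetradTheta P h K i c x w b a = q at *
    generalize tetradTheta P h N i c x w a b = p' at *
    generalize tetradTheta P h N i c x w b a = q' at *
    linear_combination (1 / 2 * sgn a * sgn b) * h1 - 1 / 2 * sgn b * (p - p') * ha +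
      1 / 2 * sgn a * (q - q') * hb

end difference

/-! ### Spin connections of metric connections -/

section spinConn

variable {X : Type*} [TopologicalSpace X] [ChartedSpace E4 X] [IsManifold 𝓘(ℝ, E4) ∞ X]
  [OrientedAtlas X] {ι : Type*} (P : SpinLift X ι)
  {V : Type*} [NormedAddCommGroup V] [NormedSpace ℂ V] [FiniteDimensional ℂ V]
  (𝒮 : SpinorSpace V) {h : TetradMap X} {K : WorldConn X}
  {A : P.ConnS 𝒮} {B : P.ConnH 𝒮 h}

lemma tetradFormH_eq_spinForm (hsec : ∀ x, (h x).pt = x) (hK : IsMetric K h) {i : ι}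
    {c : atlas E4 X} {x : X} (hi : h x ∈ P.baseSet i) (hx : x ∈ c.1.source) (a b μ : Fin 4) :
    P.tetradFormH K h i c a b μ x = P.spinForm K h i a b x (coordField c μ x) := by
  rw [tetradFormH_eq, antisymEta_tetradTheta_of_isMetric P hsec hK hi hx,
    spinForm_eq P hsec K hi hx]

/-- The induced connection is the spin connection of the torsion-free metric connection `N` exactly
if `∇ g_h` is totally symmetric. -/
lemma isSpinConn_iff_isCodazzi (hsec : ∀ x, (h x).pt = x) (hA : P.IsTetradConn 𝒮 K A)
    (hB : P.IsInduced 𝒮 A h B) (hK : K.torsion = 0) {N : WorldConn X} (hN : N.torsion = 0)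
    (hNh : IsMetric N h) : P.IsSpinConn 𝒮 N h B ↔ IsCodazzi K h := by
  rw [isSpinConn_iff P 𝒮 hsec hA hB N hNh, isCodazzi_iff P hK hN hNh]
  constructor
  · intro hθ x u v w
    have hi : h x ∈ P.baseSet (P.indexAt (h x)) := P.mem_baseSet_at _
    have hx : x ∈ (achart E4 x).1.source := mem_chart_source E4 x
    exact (antisymEta_tetradTheta_eq_iff P hsec K N hi hx w).mp (hθ _ _ x hi hx w) u v
  · intro hD i c x hi hx w
    exact (antisymEta_tetradTheta_eq_iff P hsec K N hi hx w).mpr fun u v => hD x u v w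

end spinConn

end

end CompositeSpinor

theorem mainTheorem8
    {X : Type*} [TopologicalSpace X] [T2Space X] [SecondCountableTopology X] [ConnectedSpace X]
    [ChartedSpace E4 X] [IsManifold 𝓘(ℝ, E4) ∞ X] [OrientedAtlas X]
    {ι : Type*} (P : SpinLift X ι)
    {V : Type*} [NormedAddCommGroup V] [NormedSpace ℂ V] [FiniteDimensional ℂ V]
    (𝒮 : SpinorSpace V) :
    -- the local expression of `γ_Σ` in every trivialization
    (∀ (i : ι) (σ : Tetrads X), σ ∈ P.baseSet i →
      ∀ (α : TangentSpace 𝓘(ℝ, E4) σ.pt →L[ℝ] ℝ) (u : (P.core 𝒮).Fiber σ),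
        P.fib 𝒮 i ⟨σ, P.gammaSigma 𝒮 σ α u⟩ =
          ∑ a, α ((P.frame i σ).vec a) • 𝒮.gamma a (P.fib 𝒮 i ⟨σ, u⟩)) ∧
    -- every connection on `S → Σ` defines a total Dirac operator
    (∀ A : P.ConnS 𝒮,
      -- the vertical covariant differential is `pr₁ ∘ D_B` for each composite connection `B`
      (∀ Γ : Conn 𝓘(ℝ, E4) 𝓘(ℝ, E4 × LowTri) (Tetrads.pt : Tetrads X → X),
        ∃ B : Conn 𝓘(ℝ, E4) (𝓘(ℝ, E4 × LowTri).prod 𝓘(ℝ, V)) (P.projX 𝒮),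
          (∀ (y : P.S 𝒮) (v : TangentSpace 𝓘(ℝ, E4) y.proj.pt),
            (B.jet y).1 v = (A.jet y).1 ((Γ.jet y.proj).1 v)) ∧
          ∀ (y : P.S 𝒮) (φ : P.JetS 𝒮 y) (v : TangentSpace 𝓘(ℝ, E4) y.proj.pt),
            vertCovDiff A Tetrads.pt φ v = vertProj A y (covDiff B φ v).1) ∧
      -- smoothness and the coordinate expression
      P.IsSmoothOperator 𝒮 (P.totalDirac 𝒮 A) ∧
      (∀ (y : P.S 𝒮) (φ : P.JetS 𝒮 y) (i : ι) (c : atlas E4 X),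
        y.proj ∈ P.baseSet i → y.proj.pt ∈ c.1.source →
          P.dfib 𝒮 i y (P.totalDirac 𝒮 A y φ).1 =
            ∑ lam, ∑ a, P.sig i c lam a y.proj • 𝒮.gamma a
              (P.dfib 𝒮 i y (φ.1 (coordField c lam y.proj.pt)) -
                P.dfib 𝒮 i y ((A.jet y).1
                  (mfderiv (𝓘(ℝ, E4 × LowTri).prod 𝓘(ℝ, V)) 𝓘(ℝ, E4 × LowTri) (P.projS 𝒮) y
                    (φ.1 (coordField c lam y.proj.pt)))))) ∧
      -- restriction to `J¹S_h`
      (∀ h : TetradMap X, (∀ x, (h x).pt = x) →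
        (∃! B : P.ConnH 𝒮 h, P.IsInduced 𝒮 A h B) ∧
        ∀ B : P.ConnH 𝒮 h, P.IsInduced 𝒮 A h B →
          ∀ (y : P.SH 𝒮 h) (ψ : P.JetH 𝒮 h y),
            ∃ φ : P.JetS 𝒮 (P.incl 𝒮 h y),
              (∀ v, φ.1 v = P.tincl 𝒮 h y (ψ.1 v)) ∧
              P.tincl 𝒮 h y (P.diracH 𝒮 h B y ψ).1 =
                (P.totalDirac 𝒮 A (P.incl 𝒮 h y) φ).1)) ∧
    -- the explicit connection defined by a symmetric connection `K` on `TX`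
    (∀ K : WorldConn X, K.torsion = 0 → K.ContMDiffCovariantDerivative ∞ →
      -- it is a principal connection on `LX → Σ`
      (∀ (i j : ι) (c c' : atlas E4 X) (σ : Tetrads X), σ ∈ P.baseSet i → σ ∈ P.baseSet j →
        σ.pt ∈ c.1.source → σ.pt ∈ c'.1.source →
        ∀ (w : TangentSpace 𝓘(ℝ, E4 × LowTri) σ) (a b : Fin 4),
          ∑ e, P.lor i j a e σ * P.tetradFormMixed K i c e b σ w =
            ∑ e, P.tetradFormMixed K j c' a e σ w * P.lor i j e b σ +
              dfunTet (P.lor i j a b) σ w) ∧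
      (∃! A : P.ConnS 𝒮, P.IsTetradConn 𝒮 K A) ∧
      ∀ A : P.ConnS 𝒮, P.IsTetradConn 𝒮 K A → ∀ h : TetradMap X, (∀ x, (h x).pt = x) →
        ∀ B : P.ConnH 𝒮 h, P.IsInduced 𝒮 A h B →
          -- the induced connection on `S_h`
          (∀ (i : ι) (c : atlas E4 X) (y : P.SH 𝒮 h), h y.proj ∈ P.baseSet i →
            y.proj ∈ c.1.source → ∀ v : TangentSpace 𝓘(ℝ, E4) y.proj,
              P.dfib 𝒮 i (P.incl 𝒮 h y) (P.tincl 𝒮 h y ((B.jet y).1 v)) =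
                -(1 / 2 : ℝ) • ∑ a, ∑ b,
                  (∑ μ, P.tetradFormH K h i c a b μ y.proj * dcoord c μ y.proj v) •
                    𝒮.gen a b (P.fib 𝒮 i (P.incl 𝒮 h y))) ∧
          -- it is the Levi-Civita spin connection if `K` is the Levi-Civita connection of `g_h`
          (IsMetric K h →
            (∀ (i : ι) (c : atlas E4 X) (x : X), h x ∈ P.baseSet i → x ∈ c.1.source →
              ∀ a b μ : Fin 4, P.tetradFormH K h i c a b μ x =
                P.spinForm K h i a b x (coordField c μ x)) ∧
            P.IsSpinConn 𝒮 K h B) ∧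
          -- in general this holds exactly if the covariant derivative of `g_h` is symmetric
          ∀ N : WorldConn X, N.torsion = 0 → IsMetric N h →
            (P.IsSpinConn 𝒮 N h B ↔ IsCodazzi K h)) := by
  refine ⟨fun i σ hi α u => fib_gammaSigma P 𝒮 hi α u, fun A => ⟨fun Γ => ⟨compConn P 𝒮 A Γ,
    fun y v => rfl, fun y φ v => vertCovDiff_eq P 𝒮 A Γ y φ v⟩,
    isSmoothOperator_totalDirac P 𝒮 A, fun y φ i c hi hc => dfib_totalDirac P 𝒮 A y φ hi hc,
    fun h hsec => ⟨existsUnique_induced P 𝒮 h A, fun B hB y ψ =>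
      ⟨jetIncl P 𝒮 h hsec ψ, fun v => rfl, tincl_diracH P 𝒮 h hsec A hB y ψ⟩⟩⟩,
    fun K htor hK => ⟨fun i j c c' σ hi hj hc hc' w a b =>
      tetradFormMixed_gauge P K hi hj hc hc' w a b, existsUnique_tetradConn P 𝒮 hK,
      fun A hA h hsec B hB => ⟨fun i c y hi hx v =>
        dfib_induced_coord P 𝒮 hsec hA hB hi hx v, fun hmet =>
          ⟨fun i c x hi hx a b μ => tetradFormH_eq_spinForm P hsec hmet hi hx a b μ, ?_⟩,
        fun N hN hNh => isSpinConn_iff_isCodazzi P 𝒮 hsec hA hB htor hN hNh⟩⟩⟩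
  exact (isSpinConn_iff P 𝒮 hsec hA hB K hmet).mpr fun _ _ _ _ _ _ => rfl
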